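/- Let $n\ge 2$ and let $P:\mathbb R^n\to\mathbb R$ be a real elliptic (inhomogeneous) polynomial of even order $m\ge 4$, that is, its principal part satisfies $P_m(\xi)\neq 0$ for $\xi\ne0$, and suppose that $P(\xi)>0$ for all $\xi\in\mathbb R^n$. Let $n\ge m$ and $m_1:=m/2$. For $t\neq0$ let $$V(t,\cdot)=\mathcal F^{-1}\,\frac{\sin\big(P^{1/2}(\xi)\,t\big)}{P^{1/2}(\xi)}\,\mathcal F u_1$$ be the sine part of the solution of $\partial_{tt}u+P(-i\nabla)u=0$, $u(0)=u_0$, $\partial_tu(0)=u_1$, where $\mathcal F$ is the Fourier transform of tempered distributions. Let $p,q\in[1,\infty]$ be such that $(\frac1p,\frac1q)$ lies in the closed triangle $AEF$ with vertices $A=(\frac12,\frac12)$, $E=(\frac{n+m}{2n},\frac12)$, $F=(\frac12,\frac{n-m}{2n})$, and let $q<\infty$ (which excludes only the point $F$, and only when $n=m$). Put $L^q_*:=L^{q,\infty}(\mathbb R^n)$ (weak $L^q$) if $\frac1q=\frac1p-\frac m{2n}$, and $L^q_*:=L^q(\mathbb R^n)$ otherwise. Then there is a constant $C>0$, independent of $t$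 and $u_1$, such that for every $t\ne0$ and $u_1\in L^p(\mathbb R^n)$ the tempered distribution $V(t,\cdot)$ is a function and $$\|V(t,\cdot)\|_{L^q_*}\le C\,|t|^{\frac n{m_1}\left(\frac1q-\frac1p\right)+1}\,\|u_1\|_{L^p}\quad\text{for }0<|t|\le1,$$ $$\|V(t,\cdot)\|_{L^q_*}\le C\,\|u_1\|_{L^p}\quad\text{for }|t|\ge1.$$ -/

import Mathlib

open MeasureTheory
open scoped ENNReal NNReal SchwartzMap FourierTransform ContDiff

noncomputable section

namespace HigherOrderWave

/-- The value at `ξ ∈ ℝⁿ` of a real polynomial `P` in `n` variables. -/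
def polyEval {n : ℕ} (P : MvPolynomial (Fin n) ℝ) (ξ : EuclideanSpace ℝ (Fin n)) : ℝ :=
  MvPolynomial.eval (fun i => ξ i) P

/-- The standing hypothesis on the symbol: `P` is a real elliptic polynomial on `ℝⁿ`, `n ≥ 2`,
of even order `m ≥ 4`, with `P(ξ) > 0` for all `ξ` (the origin included, so that `P` is
automatically inhomogeneous).  Elliptic: the principal part has no zero besides the origin. -/
structure EllipticPositive {n : ℕ} (P : MvPolynomial (Fin n) ℝ) (m : ℕ) : Prop where
  two_le_dim : 2 ≤ n
  four_le_order : 4 ≤ m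
  even_order : Even m
  order_eq : P.totalDegree = m
  elliptic : ∀ ξ : EuclideanSpace ℝ (Fin n), ξ ≠ 0 →
    polyEval (MvPolynomial.homogeneousComponent m P) ξ ≠ 0
  pos : ∀ ξ : EuclideanSpace ℝ (Fin n), 0 < polyEval P ξ

/-- The symbol `Q(t, ξ) = sin (P(ξ)^{1/2} t) / P(ξ)^{1/2}`. -/
def sineSymbol {n : ℕ} (P : MvPolynomial (Fin n) ℝ) (t : ℝ) (ξ : EuclideanSpace ℝ (Fin n)) : ℝ :=
  Real.sin (√(polyEval P ξ) * t) / √(polyEval P ξ)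

/-- The sine part `V(t) = 𝓕⁻¹ Q(t, ·) 𝓕 u₁` of the solution of
`∂ₜₜ u + P(-i∇) u = 0`, `u(0) = u₀`, `∂ₜ u(0) = u₁`, as a tempered distribution.
Mathlib's Fourier transform has the kernel `exp (-2πi⟨x, ξ⟩)`, so that the frequency dual to
`-i∇` is `2πξ`.  That the multiplier is of temperate growth is proved below. -/
def sinePart {n : ℕ} (P : MvPolynomial (Fin n) ℝ) (t : ℝ)
    (u₁ : 𝓢'(EuclideanSpace ℝ (Fin n), ℂ)) : 𝓢'(EuclideanSpace ℝ (Fin n), ℂ) :=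
  TemperedDistribution.fourierMultiplierCLM ℂ
    (fun ξ => ((sineSymbol P t ((2 * Real.pi) • ξ) : ℝ) : ℂ)) u₁

/-- The tempered distribution `T` is (integration against) the measurable function `v`. -/
def IsGivenBy {n : ℕ} (T : 𝓢'(EuclideanSpace ℝ (Fin n), ℂ))
    (v : EuclideanSpace ℝ (Fin n) → ℂ) : Prop :=
  AEStronglyMeasurable v volume ∧
    ∀ ψ : 𝓢(EuclideanSpace ℝ (Fin n), ℂ),
      Integrable (fun x => ψ x • v x) volume ∧ T ψ = ∫ x, ψ x • v x

/-- The weak-`L^q` quasi-norm (the quasi-norm of the Lorentz space `L^{q,∞}`):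
`sup_{s > 0} s · |{x : |f(x)| > s}|^{1/q}` for `q < ∞`, and `L^{∞,∞} = L^∞`. -/
def weakLpNorm {n : ℕ} (f : EuclideanSpace ℝ (Fin n) → ℂ) (q : ℝ≥0∞) : ℝ≥0∞ :=
  if q = ⊤ then eLpNormEssSup f volume
  else ⨆ s : ℝ≥0, (s : ℝ≥0∞) * (volume {x | s < ‖f x‖₊}) ^ (1 / q.toReal)

/-- `1 / p` as a real number, with `1 / ∞ = 0`. -/
def recip (p : ℝ≥0∞) : ℝ := (p⁻¹).toReal

open Classical in
/-- The norm of the target space `L_*^q`: the weak space `L^{q,∞}` if `1/q = 1/p - m/(2n)`, and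
`L^q` otherwise. -/
def targetNorm (n m : ℕ) (p q : ℝ≥0∞) (f : EuclideanSpace ℝ (Fin n) → ℂ) : ℝ≥0∞ :=
  if recip q = recip p - (m : ℝ) / (2 * n) then weakLpNorm f q else eLpNorm f q volume

/-- The closed triangle with the vertices `A = (1/2, 1/2)`, `E = ((n+m)/(2n), 1/2)` and
`F = (1/2, (n-m)/(2n))`. -/
def triangleAEF (n m : ℕ) : Set (ℝ × ℝ) :=
  convexHull ℝ {((1 : ℝ) / 2, (1 : ℝ) / 2),
    (((n : ℝ) + m) / (2 * n), (1 : ℝ) / 2),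
    ((1 : ℝ) / 2, ((n : ℝ) - m) / (2 * n))}

theorem hasTemperateGrowth_polyEval {n : ℕ} (P : MvPolynomial (Fin n) ℝ) :
    (polyEval P).HasTemperateGrowth := by
  induction P using MvPolynomial.induction_on with
  | C a =>
    have : polyEval (n := n) (MvPolynomial.C a) = fun _ => a := by
      funext ξ; simp [polyEval]
    rw [this]; exact .const a
  | add p q hp hq =>
    have : polyEval (p + q) = polyEval p + polyEval q := by
      funext ξ; simp [polyEval]
    rw [this]; exact hp.add hq
  | mul_X p i hp =>
    have : polyEval (p * MvPolynomial.X i) =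
        polyEval p * fun ξ => (EuclideanSpace.proj i : EuclideanSpace ℝ (Fin n) →L[ℝ] ℝ) ξ := by
      funext ξ; simp [polyEval]
    rw [this]; exact hp.mul (ContinuousLinearMap.hasTemperateGrowth _)

theorem polyEval_abs_le {n : ℕ} (P : MvPolynomial (Fin n) ℝ) (k : ℕ)
    (hk : ∀ d ∈ P.support, d.degree ≤ k) :
    ∃ C : ℝ, 0 ≤ C ∧ ∀ ξ, |polyEval P ξ| ≤ C * (1 + ‖ξ‖) ^ k := by
  refine ⟨∑ d ∈ P.support, |P.coeff d|, Finset.sum_nonneg fun _ _ => abs_nonneg _, fun ξ => ?_⟩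
  rw [polyEval, MvPolynomial.eval_eq', Finset.sum_mul]
  refine (Finset.abs_sum_le_sum_abs _ _).trans (Finset.sum_le_sum fun d hd => ?_)
  rw [abs_mul, Finset.abs_prod]
  gcongr
  calc ∏ i, |ξ i ^ d i| ≤ ∏ i, (1 + ‖ξ‖) ^ d i := by
        gcongr with i _
        rw [abs_pow]
        gcongr
        have := PiLp.norm_apply_le ξ i
        rw [Real.norm_eq_abs] at this
        linarith
    _ = (1 + ‖ξ‖) ^ d.degree := by
        rw [Finset.prod_pow_eq_pow_sum, Finsupp.degree_eq_sum]
    _ ≤ (1 + ‖ξ‖) ^ k := by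
        gcongr
        · linarith [norm_nonneg ξ]
        · exact hk d hd

theorem polyEval_smul {n m : ℕ} {P : MvPolynomial (Fin n) ℝ} (hP : P.IsHomogeneous m)
    (r : ℝ) (ξ : EuclideanSpace ℝ (Fin n)) : polyEval P (r • ξ) = r ^ m * polyEval P ξ := by
  rw [polyEval, polyEval, MvPolynomial.eval_eq', MvPolynomial.eval_eq', Finset.mul_sum]
  refine Finset.sum_congr rfl fun d hd => ?_
  have hdeg : d.degree = m := by
    by_contra h
    exact MvPolynomial.mem_support_iff.1 hd (hP.coeff_eq_zero h)
  simp only [PiLp.smul_apply, smul_eq_mul, mul_pow, Finset.prod_mul_distrib,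
    Finset.prod_pow_eq_pow_sum]
  rw [← Finsupp.degree_eq_sum, hdeg]
  ring

theorem EllipticPositive.exists_lower_bound {n m : ℕ} {P : MvPolynomial (Fin n) ℝ}
    (hP : EllipticPositive P m) : ∃ c : ℝ, 0 < c ∧ ∀ ξ, c ≤ polyEval P ξ := by
  set H := MvPolynomial.homogeneousComponent m P with hH
  have hHom : H.IsHomogeneous m := MvPolynomial.homogeneousComponent_isHomogeneous _ _
  have hcont : ∀ R : MvPolynomial (Fin n) ℝ, Continuous (polyEval R) :=
    fun R => (hasTemperateGrowth_polyEval R).1.continuous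
  have hm := hP.four_le_order
  obtain ⟨C, hC, hR⟩ := polyEval_abs_le (P - H) (m - 1) (by
    intro d hd
    rw [MvPolynomial.mem_support_iff, MvPolynomial.coeff_sub, hH,
      MvPolynomial.coeff_homogeneousComponent] at hd
    have hne : d.degree ≠ m := by
      intro h; simp [h] at hd
    have hd' : P.coeff d ≠ 0 := by simpa [hne] using hd
    have := MvPolynomial.le_totalDegree (MvPolynomial.mem_support_iff.2 hd')
    rw [hP.order_eq] at this
    have h2 : d.degree = d.sum fun _ e => e := rfl
    omega)
  obtain ⟨a, ha, hlow⟩ := (isCompact_sphere (0 : EuclideanSpace ℝ (Fin n)) 1).exists_forall_le'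
    (f := fun ξ => |polyEval H ξ|) (hcont H).abs.continuousOn (a := 0) (by
      intro ξ hξ
      exact abs_pos.2 (hP.elliptic ξ (ne_zero_of_mem_unit_sphere ⟨ξ, hξ⟩)))
  have hlow' : ∀ ξ, ξ ≠ 0 → a * ‖ξ‖ ^ m ≤ |polyEval H ξ| := by
    intro ξ hξ
    have h0 : ‖ξ‖ ≠ 0 := norm_ne_zero_iff.2 hξ
    have h1 := hlow (‖ξ‖⁻¹ • ξ) (by simp [norm_smul, h0])
    have h2 : polyEval H ξ = ‖ξ‖ ^ m * polyEval H (‖ξ‖⁻¹ • ξ) := by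
      rw [← polyEval_smul hHom, smul_smul, mul_inv_cancel₀ h0, one_smul]
    rw [h2, abs_mul, abs_of_nonneg (by positivity), mul_comm]
    gcongr
  have hev : ∀ᶠ ξ in Filter.cocompact (EuclideanSpace ℝ (Fin n)),
      polyEval P 0 ≤ polyEval P ξ := by
    set B : ℝ := (C * 2 ^ (m - 1) + polyEval P 0) / a with hB
    filter_upwards [(tendsto_norm_cocompact_atTop (E := EuclideanSpace ℝ (Fin n))).eventually_ge_atTop
      (max 1 B)] with ξ hξ
    have h1 : 1 ≤ ‖ξ‖ := (le_max_left _ _).trans hξ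
    have h2 : B ≤ ‖ξ‖ := (le_max_right _ _).trans hξ
    have hne : ξ ≠ 0 := by
      rintro rfl; simp at h1; linarith
    have h3 : |polyEval H ξ| - |polyEval (P - H) ξ| ≤ polyEval P ξ := by
      have : polyEval P ξ = polyEval H ξ + polyEval (P - H) ξ := by simp [polyEval]
      rw [← abs_of_pos (hP.pos ξ), this]
      have := abs_sub_abs_le_abs_sub (polyEval H ξ) (-polyEval (P - H) ξ)
      rwa [abs_neg, sub_neg_eq_add] at this
    have h4 : |polyEval (P - H) ξ| ≤ C * 2 ^ (m - 1) * ‖ξ‖ ^ (m - 1) := by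
      refine (hR ξ).trans ?_
      rw [mul_assoc, ← mul_pow]
      gcongr
      linarith
    have h5 : a * ‖ξ‖ ^ m = a * ‖ξ‖ * ‖ξ‖ ^ (m - 1) := by
      rw [mul_assoc, ← pow_succ', Nat.sub_add_cancel (by omega)]
    have h6 : C * 2 ^ (m - 1) + polyEval P 0 ≤ a * ‖ξ‖ := by
      rw [hB, div_le_iff₀ ha] at h2; linarith
    have h7 : (1 : ℝ) ≤ ‖ξ‖ ^ (m - 1) := one_le_pow₀ h1
    have h8 := hlow' ξ hne
    have h9 := hP.pos 0
    nlinarith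
  obtain ⟨ξ₀, h₀⟩ := (hcont P).exists_forall_le' 0 hev
  exact ⟨polyEval P ξ₀, hP.pos ξ₀, h₀⟩

theorem hasTemperateGrowth_rpow {E : Type*} [NormedAddCommGroup E] [NormedSpace ℝ E]
    {f : E → ℝ} (hf : f.HasTemperateGrowth) (h1 : ∀ x, 1 ≤ f x) (r : ℝ) :
    (fun x => f x ^ r).HasTemperateGrowth := by
  set t := {y : ℝ | 1 / 2 < y}
  have ht : Set.range f ⊆ t := by
    rintro - ⟨y, rfl⟩
    exact lt_of_lt_of_le (by norm_num) (h1 y)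
  have hdiff : ContDiffOn ℝ ∞ (fun x : ℝ ↦ x ^ r) t :=
    contDiffOn_fun_id.rpow_const_of_ne fun x hx ↦ (lt_trans (by norm_num) hx).ne'
  have hunique : UniqueDiffOn ℝ t := (isOpen_lt' (1 / 2)).uniqueDiffOn
  refine Function.HasTemperateGrowth.comp' ht hunique hdiff ?_ hf
  intro N
  obtain ⟨k, hk⟩ := exists_nat_ge (max r <| (N - r) * Real.log 2 / (Real.log (3 / 2)))
  have hk₁ : r ≤ k := le_sup_left.trans hk
  have hk₂ : Real.log 2 * (N - r) ≤ (Real.log (3 / 2)) * k := by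
    have := le_sup_right.trans hk
    field_simp at this
    grind
  use k, ∑ k ∈ Finset.range (N + 1), ‖Polynomial.eval r (descPochhammer ℝ k)‖, by positivity
  intro n hn x hx
  have : ContDiffAt ℝ n (fun x : ℝ ↦ x ^ r) x :=
    Real.contDiffAt_rpow_const <| Or.inl (lt_trans (by norm_num) hx).ne'
  rw [norm_iteratedFDerivWithin_eq_norm_iteratedDerivWithin,
    iteratedDerivWithin_eq_iteratedDeriv hunique this hx, iteratedDeriv_eq_iterate,
    Real.iter_deriv_rpow_const, norm_mul]
  gcongr 1
  · have : n ∈ Finset.range (N + 1) := by grind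
    apply Finset.single_le_sum (fun _ _ ↦ by positivity) this
  have hx' : 1 / 2 < x := by simpa [t] using hx
  have hx'' : 0 < x := lt_of_lt_of_le (by norm_num) hx'.le
  simp only [Real.norm_eq_abs]
  apply (Real.abs_rpow_le_abs_rpow _ _).trans
  by_cases! h : 0 ≤ r - n
  · have : r - n ≤ k := by simpa using hk₁.trans (by simp)
    rw [← Real.rpow_natCast]
    exact (Real.rpow_le_rpow (by positivity) (by simp) h).trans
      (Real.rpow_le_rpow_of_exponent_le (by simp) this)
  have h : 0 < n - r := by grind
  calc
    _ = x ^ (-(n - r)) := by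
      rw [neg_sub]
      congr
      simpa using hx''.le
    _ ≤ (2 : ℝ) ^ (n - r) := by
      rw [Real.rpow_neg_eq_inv_rpow]
      gcongr
      exact ((inv_lt_comm₀ hx'' (by norm_num)).mpr (by simpa using hx')).le
    _ = Real.exp (Real.log 2 * (n - r)) := by
      rw [Real.rpow_def_of_pos]
      norm_num
    _ ≤ Real.exp (Real.log (3 / 2) * k) := by
      gcongr 1
      apply le_trans _ hk₂
      gcongr
    _ ≤ (3 / 2) ^ k := by
      rw [← Real.rpow_natCast, Real.rpow_def_of_pos]
      norm_num
    _ ≤ _ := by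
      gcongr
      grind

theorem hasTemperateGrowth_sin : Real.sin.HasTemperateGrowth := by
  refine ⟨Real.contDiff_sin, fun k => ⟨0, 1, fun x => ?_⟩⟩
  rw [norm_iteratedFDeriv_eq_norm_iteratedDeriv, Real.norm_eq_abs]
  simpa using Real.abs_iteratedDeriv_sin_le_one k x

/-- The multiplier in the definition of the sine part is of temperate growth, so that the product
with a tempered distribution is the genuine one. -/
theorem EllipticPositive.hasTemperateGrowth_sineSymbol {n m : ℕ} {P : MvPolynomial (Fin n) ℝ}
    (hP : EllipticPositive P m) (t : ℝ) :
    (fun ξ : EuclideanSpace ℝ (Fin n) =>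
      ((sineSymbol P t ((2 * Real.pi) • ξ) : ℝ) : ℂ)).HasTemperateGrowth := by
  obtain ⟨c, hc, hlow⟩ := hP.exists_lower_bound
  have hf : (fun ξ => c⁻¹ * polyEval P ξ).HasTemperateGrowth :=
    (Function.HasTemperateGrowth.const c⁻¹).mul (hasTemperateGrowth_polyEval P)
  have h1 : ∀ ξ, 1 ≤ c⁻¹ * polyEval P ξ := fun ξ => by
    rw [inv_mul_eq_div, one_le_div hc]; exact hlow ξ
  have hp := hasTemperateGrowth_rpow hf h1 (1 / 2)
  have hn := hasTemperateGrowth_rpow hf h1 (-(1 / 2))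
  have hs := hasTemperateGrowth_sin.comp
    ((Function.HasTemperateGrowth.const (√c * t)).mul hp)
  have hQ : sineSymbol P t = (fun ξ => (√c)⁻¹ * ((c⁻¹ * polyEval P ξ) ^ (-(1 / 2) : ℝ)))
      * (Real.sin ∘ ((fun _ => √c * t) * fun ξ => (c⁻¹ * polyEval P ξ) ^ (1 / 2 : ℝ))) := by
    funext ξ
    have hpos := hP.pos ξ
    have hsq : (c⁻¹ * polyEval P ξ) ^ (1 / 2 : ℝ) = (√c)⁻¹ * √(polyEval P ξ) := by
      rw [← Real.sqrt_eq_rpow, Real.sqrt_mul (by positivity), Real.sqrt_inv]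
    have hc' : √c ≠ 0 := (Real.sqrt_pos.2 hc).ne'
    have hP' : √(polyEval P ξ) ≠ 0 := (Real.sqrt_pos.2 hpos).ne'
    simp only [Pi.mul_apply, Function.comp, sineSymbol]
    rw [Real.rpow_neg (by positivity), hsq]
    have : √c * t * ((√c)⁻¹ * √(polyEval P ξ)) = √(polyEval P ξ) * t := by
      field_simp
    rw [this]
    field_simp
  have hQt : (sineSymbol P t).HasTemperateGrowth := by
    rw [hQ]
    exact ((Function.HasTemperateGrowth.const _).mul hn).mul hs
  have hlin := ((2 * Real.pi) • ContinuousLinearMap.id ℝ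
    (EuclideanSpace ℝ (Fin n))).hasTemperateGrowth
  exact Function.Complex.hasTemperateGrowth_ofReal.comp (hQt.comp hlin)

end HigherOrderWave

end

open HigherOrderWave

/-! Put `Q(t, ξ) = sin(t √P) / √P`. Since `√P ≳ (1 + |ξ|)^{m/2}` and `|sin x| ≤ |x|^{1-κ}` for `0 ≤
κ ≤ 1`, one has `|Q| ≲ |t|^{1-κ} (1 + |ξ|)^{-κm/2}`. With `κ = (2n/m)(1/p - 1/q)` the decay has
order `n(1/p - 1/2) + n(1/2 - 1/q)`, which is what the dual Sobolev estimate on `L^p` and the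
Sobolev embedding into `L^q` consume. In the triangle `p ≤ 2 ≤ q` and `κ ≤ 1`; so for `p > 1`, `q <
∞` the size of the multiplier alone, without any oscillation, gives a strong bound
(`exists_eLpNorm_fourierMultiplier_le`, `EllipticPositive.exists_eLpNorm_sinePart_le`), and it
dominates the weak one.

The remaining case `p = 1` forces `m = n = 2l` and `q = 2`, the vertex `E`. Here the kernels `𝓕⁻
Q(t, ·)`, truncated in frequency, must be bounded in weak `L²` uniformly in `t`
(`EllipticPositive.exists_volume_kernel_le`). All dyadic shells carry comparable `L²` mass, so
Plancherel alone does not suffice. For a level `s` the frequencies are split at `2^J` with `(t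
2^{J(l-1)})^{-l}` about `s`. Low frequencies travel at most a distance of order `R = t 2^{J(l-1)}`:
the ball of radius `R` has volume `≲ s^{-2}`, and outside it `‖|x| K‖₂ ≲ R` together with Chebyshev
suffices. High frequencies disperse, but the Hessian of the phase `√P` may degenerate. Each shell is
therefore cut into a part with sup norm `≲ ε^{-2n} (t 2^{j(l-1)})^{-l}` and a part with squared `L²`
norm `≲ ε^σ`; with `ε` decaying geometrically in `j - J` both series converge.

The sup bound comes from wave packets of width `τ`, where `τ^{-2}` is the size of the phase: a
packet at `ζ` is concentrated where its group velocity sends it, and the gradient of the phase is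
expansive where the Hessian is bounded below. The bad set is small because, up to a positive factor,
the Hessian determinant is a homogeneous polynomial in the rescaled variables `(1/r, ξ/r)`. It does
not vanish at a point of the unit sphere where the principal symbol is minimal, which uses `m ≥ 4`,
so its sublevel sets obey a power bound uniform in the scale `r`.

The weak bound is carried from kernels to `L¹` data through the estimates `∫_A |V| ≤ C |A|^{1/2}
‖u‖₁`, which survive convolution, Fatou limits and extension by density. -/

namespace HigherOrderWave

/-! ### Plancherel and Chebyshev for Fourier integrals of integrable functions. -/

section Plancherel

variable {E : Type*} [NormedAddCommGroup E] [InnerProductSpace ℝ E] [FiniteDimensional ℝ E]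
  [MeasurableSpace E] [BorelSpace E]

theorem continuous_fourierInv {h : E → ℂ} (hi : Integrable h) : Continuous (𝓕⁻ h) := by
  have := (VectorFourier.fourierIntegral_continuous (e := Real.fourierChar) (μ := volume)
    (L := innerₗ E) Real.continuous_fourierChar (continuous_inner (𝕜 := ℝ) (E := E)) hi).comp continuous_neg
  refine this.congr fun x => ?_
  rw [Real.fourierInv_eq_fourier_neg]
  rfl

theorem norm_fourierInv_le_integral_norm (h : E → ℂ) (x : E) : ‖𝓕⁻ h x‖ ≤ ∫ ξ, ‖h ξ‖ := by
  rw [Real.fourierInv_eq_fourier_neg]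
  exact VectorFourier.norm_fourierIntegral_le_integral_norm _ _ _ _ _

/-- Self-adjointness of the inverse Fourier transform. -/
theorem integral_fourierInv_mul_eq {f g : E → ℂ} (hf : Integrable f) (hg : Integrable g) :
    ∫ x, 𝓕⁻ f x * g x = ∫ x, f x * 𝓕⁻ g x := by
  have h := VectorFourier.integral_fourierIntegral_smul_eq_flip (e := Real.fourierChar)
    (μ := volume) (ν := volume) (L := -innerₗ E) Real.continuous_fourierChar
    (continuous_inner (𝕜 := ℝ) (E := E)).neg hf hg
  have hflip : (-innerₗ E).flip = -innerₗ E := by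
    ext x y; simp [real_inner_comm]
  have hF : ∀ u : E → ℂ, VectorFourier.fourierIntegral Real.fourierChar volume (-innerₗ E) u
      = 𝓕⁻ u := by
    intro u; ext x
    rw [Real.fourierInv_eq]
    simp [VectorFourier.fourierIntegral]
  rw [hflip, hF, hF] at h
  simpa [smul_eq_mul] using h

/-- The easy half of Plancherel's identity, for the Fourier integral of an integrable function. -/
theorem lintegral_fourierInv_sq_le {h : E → ℂ} (hi : Integrable h) :
    ∫⁻ x, ‖𝓕⁻ h x‖ₑ ^ 2 ≤ ∫⁻ ξ, ‖h ξ‖ₑ ^ 2 := by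
  have key : ∀ f : E → ℂ, ∫⁻ x, ‖f x‖ₑ ^ 2 = eLpNorm f 2 volume ^ 2 := by
    intro f
    rw [eLpNorm_eq_lintegral_rpow_enorm_toReal (by norm_num) (by norm_num)]
    simp only [ENNReal.toReal_ofNat, ENNReal.rpow_ofNat]
    rw [← ENNReal.rpow_natCast, ← ENNReal.rpow_mul]
    norm_num
  rw [key, key]
  gcongr
  by_cases htop : eLpNorm h 2 volume = ⊤
  · rw [htop]; exact le_top
  have h2 : MemLp h 2 volume := ⟨hi.1, lt_top_iff_ne_top.2 htop⟩
  set k : Lp ℂ 2 (volume : Measure E) := 𝓕⁻ (h2.toLp h) with hk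
  -- The `L²` transform is defined abstractly; pairing with test functions identifies it with the
  -- Fourier integral, so that its isometry property applies.
  have hae : ∀ᵐ x, k x = 𝓕⁻ h x := by
    refine ae_eq_of_integral_contDiff_smul_eq ((Lp.memLp k).locallyIntegrable (by norm_num))
      (continuous_fourierInv hi).locallyIntegrable fun g hg hgc => ?_
    have hg₁ : HasCompactSupport (Complex.ofRealCLM ∘ g) := hgc.comp_left rfl
    have hg₂ : ContDiff ℝ ∞ (Complex.ofRealCLM ∘ g) := by fun_prop
    set ψ : 𝓢(E, ℂ) := hg₁.toSchwartzMap hg₂ with hψ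
    have hψ' : ∀ x, ψ x = (g x : ℂ) := fun x => rfl
    have e1 : ∫ x, g x • k x = (k : 𝓢'(E, ℂ)) ψ := by
      rw [Lp.toTemperedDistribution_apply]
      refine integral_congr_ae (.of_forall fun x => ?_)
      simp [hψ']
    have e2 : (k : 𝓢'(E, ℂ)) ψ = ((h2.toLp h : Lp ℂ 2 volume) : 𝓢'(E, ℂ)) (𝓕⁻ ψ) := by
      rw [hk, ← Lp.fourierInv_toTemperedDistribution_eq, TemperedDistribution.fourierInv_apply]
    have e3 : ((h2.toLp h : Lp ℂ 2 volume) : 𝓢'(E, ℂ)) (𝓕⁻ ψ) = ∫ x, 𝓕⁻ (ψ : E → ℂ) x * h x := by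
      rw [Lp.toTemperedDistribution_apply]
      refine integral_congr_ae ?_
      filter_upwards [h2.coeFn_toLp] with x hx
      rw [hx, smul_eq_mul, SchwartzMap.fourierInv_coe]
    rw [e1, e2, e3, integral_fourierInv_mul_eq ψ.integrable hi]
    refine integral_congr_ae (.of_forall fun x => ?_)
    simp [hψ']
  have hn : ‖k‖ = ‖h2.toLp h‖ := by
    rw [← Lp.norm_fourier_eq k, hk, FourierTransform.fourier_fourierInv_eq]
  rw [← eLpNorm_congr_ae hae, ← eLpNorm_congr_ae h2.coeFn_toLp]
  rw [Lp.norm_def, Lp.norm_def] at hn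
  exact ((ENNReal.toReal_eq_toReal_iff' (Lp.eLpNorm_ne_top _) (Lp.eLpNorm_ne_top _)).1 hn).le

end Plancherel

/-- Chebyshev's inequality in `L²`. -/
theorem volume_lt_enorm_le {α : Type*} [MeasurableSpace α] {μ : Measure α} {f : α → ℂ}
    (hf : AEMeasurable f μ) {s : ℝ≥0∞} (hs : s ≠ 0) (hs' : s ≠ ⊤) :
    μ {x | s < ‖f x‖ₑ} ≤ (∫⁻ x, ‖f x‖ₑ ^ 2 ∂μ) / s ^ 2 := by
  refine (measure_mono fun x (hx : s < ‖f x‖ₑ) => ?_).trans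
    (meas_ge_le_lintegral_div (ε := s ^ 2) (hf.enorm.pow_const 2) (by simpa using hs)
      (by simpa using hs'))
  exact pow_le_pow_left₀ zero_le hx.le 2

end HigherOrderWave

namespace HigherOrderWave

/-! ### The Sobolev embedding into `L^q`, `2 < q < ∞`, by splitting frequencies at each level. -/

section Sobolev

open Metric Set

variable {E : Type*} [NormedAddCommGroup E] [InnerProductSpace ℝ E] [FiniteDimensional ℝ E]
  [MeasurableSpace E] [BorelSpace E]

local notation "dim" => Module.finrank ℝ E

theorem exists_setLIntegral_closedBall_norm_rpow_le [Nontrivial E] {θ : ℝ} (hθ : θ < dim) :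
    ∃ c : ℝ, 0 < c ∧ ∀ A : ℝ, 0 ≤ A →
      ∫⁻ ξ in closedBall (0 : E) A, ENNReal.ofReal (‖ξ‖ ^ (-θ)) ≤
        ENNReal.ofReal (c * A ^ (dim - θ)) := by
  have hd : 0 < dim := Module.finrank_pos
  have hθ' : 0 < dim - θ := by linarith
  set v := (volume : Measure E).real (ball 0 1) with hv
  have hv0 : 0 ≤ v := measureReal_nonneg
  -- The `+ 1` only makes the constant visibly positive; the same device recurs below.
  refine ⟨dim * v / (dim - θ) + 1, by positivity, fun A hA => ?_⟩
  have hint : IntegrableOn (fun ξ : E => ‖ξ‖ ^ (-θ)) (closedBall 0 A) := by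
    refine (integrableOn_ball_of_norm_le_rpow (μ := volume) (E := E) (C := 1) (α := θ) (r := A + 1)
      hd hθ (.of_forall fun ξ => ?_) (by fun_prop : Measurable _).aestronglyMeasurable).mono_set (closedBall_subset_ball (by linarith))
    rw [one_mul, Real.norm_of_nonneg (by positivity)]
  rw [← ofReal_integral_eq_lintegral_ofReal hint (.of_forall fun ξ => by positivity)]
  refine ENNReal.ofReal_le_ofReal ?_
  have h1 : ∫ ξ in closedBall (0 : E) A, ‖ξ‖ ^ (-θ)
      = ∫ ξ : E, (Iic A).indicator (fun y => y ^ (-θ)) ‖ξ‖ := by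
    rw [← integral_indicator measurableSet_closedBall]
    refine integral_congr_ae (.of_forall fun ξ => ?_)
    simp [indicator]
  have h2 : ∫ y in Ioi (0 : ℝ), y ^ (dim - 1) • (Iic A).indicator (fun y => y ^ (-θ)) y
      = A ^ (dim - θ) / (dim - θ) := by
    have : ∀ y ∈ Ioi (0 : ℝ), y ^ (dim - 1) • (Iic A).indicator (fun y => y ^ (-θ)) y
        = (Iic A).indicator (fun y : ℝ => y ^ (dim - 1 - θ)) y := by
      intro y (hy : 0 < y)
      by_cases hyA : y ≤ A
      · simp only [indicator, mem_Iic, hyA, if_true, smul_eq_mul]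
        rw [← Real.rpow_natCast y (dim - 1), ← Real.rpow_add hy]
        congr 1
        rw [Nat.cast_sub hd]; push_cast; ring
      · simp [indicator, hyA]
    rw [setIntegral_congr_fun measurableSet_Ioi this, setIntegral_indicator measurableSet_Iic,
      Ioi_inter_Iic, ← intervalIntegral.integral_of_le hA, integral_rpow (.inl (by linarith))]
    rw [Real.zero_rpow (by linarith)]
    ring_nf
  rw [h1, integral_fun_norm_addHaar, h2, nsmul_eq_mul, smul_eq_mul]
  have : (0 : ℝ) ≤ A ^ (dim - θ) := by positivity
  calc (dim : ℝ) * (v * (A ^ (dim - θ) / (dim - θ)))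
      = dim * v / (dim - θ) * A ^ (dim - θ) := by ring
    _ ≤ _ := by gcongr; linarith

/-- Cauchy–Schwarz for the product `(‖H‖ √w) · √(w⁻¹)`. It bounds the sup norm of a low-frequency
part by a weighted `L²` norm. -/
theorem setLIntegral_enorm_sq_le {H : E → ℂ} (hH : AEMeasurable H) {w : E → ℝ} (hw : Measurable w)
    {s : Set E} (hpos : ∀ᵐ ξ ∂volume.restrict s, 0 < w ξ) :
    (∫⁻ ξ in s, ‖H ξ‖ₑ) ^ 2 ≤
      (∫⁻ ξ in s, ‖H ξ‖ₑ ^ 2 * ENNReal.ofReal (w ξ)) *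
        ∫⁻ ξ in s, ENNReal.ofReal ((w ξ)⁻¹) := by
  have h := ENNReal.lintegral_mul_le_Lp_mul_Lq (volume.restrict s) Real.HolderConjugate.two_two
    (f := fun ξ => ‖H ξ‖ₑ * ENNReal.ofReal √(w ξ)) (g := fun ξ => ENNReal.ofReal √((w ξ)⁻¹))
    (by have := hH.restrict (s := s); fun_prop) (by fun_prop)
  have e1 : ∫⁻ ξ in s, ‖H ξ‖ₑ = ∫⁻ ξ in s, ((fun ξ => ‖H ξ‖ₑ * ENNReal.ofReal √(w ξ)) *
      fun ξ => ENNReal.ofReal √((w ξ)⁻¹)) ξ := by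
    refine lintegral_congr_ae ?_
    filter_upwards [hpos] with ξ hξ
    rw [Pi.mul_apply, mul_assoc, ← ENNReal.ofReal_mul (by positivity), ← Real.sqrt_mul hξ.le,
      mul_inv_cancel₀ hξ.ne']
    simp
  have e2 : ∀ r : ℝ, 0 ≤ r → ENNReal.ofReal √r ^ (2 : ℝ) = ENNReal.ofReal r := by
    intro r hr
    rw [ENNReal.rpow_ofNat, ← ENNReal.ofReal_pow (by positivity), Real.sq_sqrt hr]
  have e3 : ∫⁻ ξ in s, (‖H ξ‖ₑ * ENNReal.ofReal √(w ξ)) ^ (2 : ℝ)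
      = ∫⁻ ξ in s, ‖H ξ‖ₑ ^ 2 * ENNReal.ofReal (w ξ) := by
    refine lintegral_congr_ae ?_
    filter_upwards [hpos] with ξ hξ
    rw [ENNReal.mul_rpow_of_nonneg _ _ (by norm_num), e2 _ hξ.le, ENNReal.rpow_ofNat]
  have e4 : ∫⁻ ξ in s, (ENNReal.ofReal √((w ξ)⁻¹)) ^ (2 : ℝ)
      = ∫⁻ ξ in s, ENNReal.ofReal ((w ξ)⁻¹) := by
    refine lintegral_congr_ae ?_
    filter_upwards [hpos] with ξ hξ
    rw [e2 _ (by positivity)]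
  rw [e1]
  refine (pow_le_pow_left₀ zero_le h 2).trans ?_
  rw [e3, e4, mul_pow, ← ENNReal.rpow_natCast, ← ENNReal.rpow_natCast, ← ENNReal.rpow_mul,
    ← ENNReal.rpow_mul]
  norm_num

/-- A form of the Sobolev embedding `Ḣ^s ⊂ L^q`, `1/q = 1/2 - s/d`, `2 < q < ∞`, in terms of
the Fourier transform. -/
theorem exists_lintegral_fourierInv_rpow_le [Nontrivial E] {q : ℝ} (hq : 2 < q) :
    ∃ C : ℝ, 0 < C ∧ ∀ (H : E → ℂ), Integrable H → ∀ M : ℝ, 0 < M →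
      ∫⁻ ξ, ‖H ξ‖ₑ ^ 2 * ENNReal.ofReal (‖ξ‖ ^ (dim * (1 - 2 / q))) ≤ ENNReal.ofReal (M ^ 2) →
      ∫⁻ x, ENNReal.ofReal (‖𝓕⁻ H x‖ ^ q) ≤ ENNReal.ofReal (C * M ^ q) := by
  have hd : 0 < (dim : ℝ) := by exact_mod_cast Module.finrank_pos
  set θ : ℝ := dim * (1 - 2 / q) with hθ
  have hθd : θ < dim := by
    have : 0 < 2 / q := by positivity
    rw [hθ]; nlinarith
  obtain ⟨c, hc, hball⟩ := exists_setLIntegral_closedBall_norm_rpow_le (E := E) hθd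
  refine ⟨q * (4 * ((2 * √c) ^ (q - 2) / (q - 2))), by
    have : 0 < q - 2 := by linarith
    positivity, fun H hH M hM hN => ?_⟩
  -- At the level `t` the frequencies are split where `κ ‖ξ‖ ^ (dim / q) = t`. The factor `2 √c M`
  -- is the one for which the low part is at most `t / 2` everywhere, so that `{|g| > t}` lies in
  -- the level set `{> t / 2}` of the high part, to which Chebyshev and Plancherel apply.
  set κ := 2 * √c * M with hκ
  have hκ0 : 0 < κ := by positivity
  set g := 𝓕⁻ H with hg
  have hgc : Continuous g := continuous_fourierInv hH
  set T : E → ℝ := fun ξ => κ * ‖ξ‖ ^ (dim / q) with hT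
  have hTm : Measurable T := by fun_prop
  have hHm : AEMeasurable H := hH.1.aemeasurable
  have level : ∀ t : ℝ, 0 < t → volume {x | t < ‖g x‖} ≤
      ∫⁻ ξ, ENNReal.ofReal (4 * t ^ (-2 : ℝ)) * ({ξ | t < T ξ}.indicator (fun ξ => ‖H ξ‖ₑ ^ 2) ξ) := by
    intro t ht
    set S := {ξ | t < T ξ} with hS
    have hSm : MeasurableSet S := measurableSet_lt measurable_const hTm
    set A := (t / κ) ^ (q / dim) with hA
    have hA0 : 0 ≤ A := by positivity
    have hSc : Sᶜ ⊆ closedBall 0 A := by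
      intro ξ hξ
      simp only [hS, hT, mem_compl_iff, mem_ofPred_eq, not_lt] at hξ
      rw [mem_closedBall_zero_iff, hA]
      have : ‖ξ‖ ^ (dim / q) ≤ t / κ := by rw [le_div_iff₀ hκ0]; linarith
      calc ‖ξ‖ = (‖ξ‖ ^ (dim / q)) ^ (q / dim) := by
            rw [← Real.rpow_mul (norm_nonneg _), div_mul_div_cancel₀ (by linarith : q ≠ 0),
              div_self hd.ne', Real.rpow_one]
        _ ≤ _ := by gcongr
    have hAe : A ^ (dim - θ) = (t / κ) ^ 2 := by
      rw [hA, ← Real.rpow_mul (by positivity), ← Real.rpow_natCast]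
      congr 1
      rw [hθ]; field_simp; simp
    have low : (∫⁻ ξ in Sᶜ, ‖H ξ‖ₑ) ^ 2 ≤ ENNReal.ofReal ((t / 2) ^ 2) := by
      refine (setLIntegral_enorm_sq_le (w := fun ξ => ‖ξ‖ ^ θ) hHm (by fun_prop) ?_).trans ?_
      · refine ae_restrict_of_ae ?_
        have : ∀ᵐ ξ : E, ξ ≠ 0 := by simp [ae_iff]
        filter_upwards [this] with ξ hξ
        have := norm_pos_iff.2 hξ
        positivity
      calc _ ≤ ENNReal.ofReal (M ^ 2) * ENNReal.ofReal (c * A ^ (dim - θ)) := by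
            gcongr
            · exact (setLIntegral_le_lintegral _ _).trans hN
            · refine (lintegral_mono_set hSc).trans ((le_of_eq ?_).trans (hball A hA0))
              congr 1; funext ξ; rw [Real.rpow_neg (norm_nonneg _)]
        _ = ENNReal.ofReal ((t / 2) ^ 2) := by
            rw [← ENNReal.ofReal_mul (by positivity), hAe, hκ]
            congr 1
            have := Real.sq_sqrt hc.le
            field_simp
            rw [this]
    have low' : ∫⁻ ξ in Sᶜ, ‖H ξ‖ₑ ≤ ENNReal.ofReal (t / 2) := by
      rw [ENNReal.ofReal_pow (by positivity)] at low
      exact (ENNReal.pow_le_pow_left_iff two_ne_zero).1 low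
    have hi1 : Integrable (S.indicator H) := hH.indicator hSm
    have hi2 : Integrable (Sᶜ.indicator H) := hH.indicator hSm.compl
    have hsplit : ∀ x, g x = 𝓕⁻ (S.indicator H) x + 𝓕⁻ (Sᶜ.indicator H) x := by
      intro x
      have : H = S.indicator H + Sᶜ.indicator H := (indicator_self_add_compl S H).symm
      simp only [hg, Real.fourierInv_eq]
      rw [← integral_add]
      · refine integral_congr_ae (.of_forall fun ξ => ?_)
        simp only
        rw [← smul_add]; congr 1; exact congrFun this ξ
      · simpa using (VectorFourier.fourierIntegral_convergent_iff (μ := volume)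
          Real.continuous_fourierChar (L := -innerₗ E)
          (continuous_inner (𝕜 := ℝ) (E := E)).neg x).2 hi1
      · simpa using (VectorFourier.fourierIntegral_convergent_iff (μ := volume)
          Real.continuous_fourierChar (L := -innerₗ E)
          (continuous_inner (𝕜 := ℝ) (E := E)).neg x).2 hi2
    have hlow : ∀ x, ‖𝓕⁻ (Sᶜ.indicator H) x‖ ≤ t / 2 := by
      intro x
      refine (norm_fourierInv_le_integral_norm _ x).trans ?_
      rw [integral_norm_eq_lintegral_enorm hi2.1]
      refine ENNReal.toReal_le_of_le_ofReal (by positivity) ?_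
      rw [← lintegral_indicator hSm.compl] at low'
      refine (lintegral_mono fun ξ => ?_).trans low'
      by_cases h : ξ ∈ Sᶜ <;> simp [indicator, h]
    calc volume {x | t < ‖g x‖} ≤ volume {x | ENNReal.ofReal (t / 2) < ‖𝓕⁻ (S.indicator H) x‖ₑ} := by
          refine measure_mono fun x (hx : t < ‖g x‖) => ?_
          rw [mem_ofPred_eq, ← ofReal_norm, ENNReal.ofReal_lt_ofReal_iff_of_nonneg
            (by positivity)]
          have := norm_add_le (𝓕⁻ (S.indicator H) x) (𝓕⁻ (Sᶜ.indicator H) x)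
          rw [← hsplit] at this
          linarith [hlow x]
      _ ≤ _ := volume_lt_enorm_le (continuous_fourierInv hi1).measurable.aemeasurable
          (by simpa using ht) ENNReal.ofReal_ne_top
      _ ≤ (∫⁻ ξ, ‖S.indicator H ξ‖ₑ ^ 2) / ENNReal.ofReal (t / 2) ^ 2 := by
          exact ENNReal.div_le_div_right (lintegral_fourierInv_sq_le hi1) _
      _ = ENNReal.ofReal (4 * t ^ (-2 : ℝ)) * ∫⁻ ξ, S.indicator (fun ξ => ‖H ξ‖ₑ ^ 2) ξ := by
          rw [mul_comm, div_eq_mul_inv]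
          congr 1
          · refine lintegral_congr fun ξ => ?_
            by_cases h : ξ ∈ S <;> simp [indicator, h]
          · rw [← ENNReal.ofReal_pow (by positivity), ← ENNReal.ofReal_inv_of_pos (by positivity)]
            congr 1
            rw [Real.rpow_neg ht.le, Real.rpow_ofNat]
            field_simp; norm_num
      _ = _ := by
          rw [lintegral_const_mul'' _ ((hHm.enorm.pow_const 2).indicator hSm)]
  rw [lintegral_rpow_eq_lintegral_meas_lt_mul _ (.of_forall fun x => norm_nonneg _)
    hgc.norm.measurable.aemeasurable (by linarith)]
  -- After Tonelli, `t` runs over `0 < t < T ξ`; the integral of `t ^ (q - 3)` converges at zero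
  -- because `q > 2`, and the resulting power `(dim / q) (q - 2)` of `‖ξ‖` is the Sobolev weight
  -- `θ`.
  have inner : ∀ ξ, ∫⁻ t in Ioi (0 : ℝ), ENNReal.ofReal (4 * t ^ (-2 : ℝ)) *
      ({ξ | t < T ξ}.indicator (fun ξ => ‖H ξ‖ₑ ^ 2) ξ) * ENNReal.ofReal (t ^ (q - 1)) ≤
      ENNReal.ofReal (4 * (κ ^ (q - 2) / (q - 2))) *
        (‖H ξ‖ₑ ^ 2 * ENNReal.ofReal (‖ξ‖ ^ θ)) := by
    intro ξ
    have hTnn : 0 ≤ T ξ := by positivity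
    have e1 : ∀ t ∈ Ioi (0 : ℝ), ENNReal.ofReal (4 * t ^ (-2 : ℝ)) *
      ({ξ | t < T ξ}.indicator (fun ξ => ‖H ξ‖ₑ ^ 2) ξ) * ENNReal.ofReal (t ^ (q - 1)) =
        ‖H ξ‖ₑ ^ 2 * (Iio (T ξ)).indicator (fun t => ENNReal.ofReal (4 * t ^ (q - 3))) t := by
      intro t (ht : 0 < t)
      by_cases h : t < T ξ
      · simp only [indicator, mem_ofPred_eq, h, if_true, mem_Iio]
        rw [mul_comm (ENNReal.ofReal _), mul_assoc, ← ENNReal.ofReal_mul (by positivity), mul_assoc,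
          ← Real.rpow_add ht]
        congr 4; ring
      · simp [indicator, h]
    rw [setLIntegral_congr_fun measurableSet_Ioi e1, lintegral_const_mul _
      (Measurable.indicator (by fun_prop) measurableSet_Iio), setLIntegral_indicator measurableSet_Iio,
      Iio_inter_Ioi, mul_comm (ENNReal.ofReal _), mul_assoc]
    gcongr
    have hint : IntegrableOn (fun t : ℝ => 4 * t ^ (q - 3)) (Ioo 0 (T ξ)) := by
      refine Integrable.const_mul ?_ _
      rcases hTnn.eq_or_lt with h | h
      · rw [← h]; simp
      · exact (intervalIntegral.integrableOn_Ioo_rpow_iff h).2 (by linarith)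
    rw [← ofReal_integral_eq_lintegral_ofReal hint ?_, ← ENNReal.ofReal_mul (by positivity)]
    · refine ENNReal.ofReal_le_ofReal (le_of_eq ?_)
      rw [integral_const_mul, ← integral_Ioc_eq_integral_Ioo, ← intervalIntegral.integral_of_le hTnn,
        integral_rpow (.inl (by linarith)), Real.zero_rpow (by linarith), hT,
        Real.mul_rpow hκ0.le (by positivity), ← Real.rpow_mul (norm_nonneg _)]
      rw [show q - 3 + 1 = q - 2 by ring, show dim / q * (q - 2) = θ by rw [hθ]; field_simp]
      ring
    · refine (ae_restrict_iff' measurableSet_Ioo).2 (.of_forall fun t ht => ?_)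
      have := ht.1
      simp only [Pi.zero_apply]; positivity
  calc ENNReal.ofReal q * ∫⁻ t in Ioi (0 : ℝ), volume {x | t < ‖g x‖} * ENNReal.ofReal (t ^ (q - 1))
      ≤ ENNReal.ofReal q * ∫⁻ t in Ioi (0 : ℝ), ∫⁻ ξ, ENNReal.ofReal (4 * t ^ (-2 : ℝ)) *
        ({ξ | t < T ξ}.indicator (fun ξ => ‖H ξ‖ₑ ^ 2) ξ) * ENNReal.ofReal (t ^ (q - 1)) := by
        gcongr 1
        refine setLIntegral_mono' measurableSet_Ioi fun t ht => ?_
        rw [lintegral_mul_const' _ _ ENNReal.ofReal_ne_top]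
        gcongr
        exact level t ht
    _ = ENNReal.ofReal q * ∫⁻ ξ, ∫⁻ t in Ioi (0 : ℝ), ENNReal.ofReal (4 * t ^ (-2 : ℝ)) *
        ({ξ | t < T ξ}.indicator (fun ξ => ‖H ξ‖ₑ ^ 2) ξ) * ENNReal.ofReal (t ^ (q - 1)) := by
        congr 1
        refine lintegral_lintegral_swap ?_
        have m1 : AEMeasurable (fun p : ℝ × E => {p : ℝ × E | p.1 < T p.2}.indicator
            (fun p => ‖H p.2‖ₑ ^ 2) p) ((volume.restrict (Ioi 0)).prod volume) := by
          refine AEMeasurable.indicator ?_ (measurableSet_lt measurable_fst (hTm.comp measurable_snd))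
          exact (hHm.comp_snd).enorm.pow_const 2
        have m2 : AEMeasurable (fun p : ℝ × E => ENNReal.ofReal (4 * p.1 ^ (-2 : ℝ)) *
          ({p : ℝ × E | p.1 < T p.2}.indicator (fun p => ‖H p.2‖ₑ ^ 2) p) *
          ENNReal.ofReal (p.1 ^ (q - 1))) ((volume.restrict (Ioi 0)).prod volume) := by
          fun_prop
        refine m2.congr (.of_forall fun p => ?_)
        simp only [Function.uncurry, indicator, mem_ofPred_eq]
    _ ≤ ENNReal.ofReal q * ∫⁻ ξ, ENNReal.ofReal (4 * (κ ^ (q - 2) / (q - 2))) *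
        (‖H ξ‖ₑ ^ 2 * ENNReal.ofReal (‖ξ‖ ^ θ)) := by
        gcongr with ξ; exact inner ξ
    _ ≤ ENNReal.ofReal q * (ENNReal.ofReal (4 * (κ ^ (q - 2) / (q - 2))) *
        ENNReal.ofReal (M ^ 2)) := by
        rw [lintegral_const_mul' _ _ ENNReal.ofReal_ne_top]; gcongr
    _ = _ := by
        have : 0 < q - 2 := by linarith
        rw [← ENNReal.ofReal_mul (by positivity), ← ENNReal.ofReal_mul (by linarith)]
        congr 1
        have e : M ^ q = M ^ (q - 2) * M ^ 2 := by
          rw [← Real.rpow_natCast, ← Real.rpow_add hM]; norm_num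
        rw [e, hκ, Real.mul_rpow (by positivity) hM.le]
        ring

end Sobolev

end HigherOrderWave

namespace HigherOrderWave

/-! ### Multipliers of given decay: Schwartz bounds and extension to `L^p`. -/

section Multiplier

theorem hasTemperateGrowth_japanese {E : Type*} [NormedAddCommGroup E] [InnerProductSpace ℝ E]
    (s : ℝ) : (fun ξ : E => (((1 + ‖ξ‖ ^ 2) ^ s : ℝ) : ℂ)).HasTemperateGrowth := by
  fun_prop

open Set

variable {E : Type*} [NormedAddCommGroup E] [InnerProductSpace ℝ E] [FiniteDimensional ℝ E]
  [MeasurableSpace E] [BorelSpace E]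

local notation "dim" => Module.finrank ℝ E

/-- Includes `q = 2`, which is Plancherel, and `M = 0`, which is reached by enlarging `M` slightly.
-/
theorem exists_eLpNorm_fourierInv_le [Nontrivial E] {q : ℝ≥0∞} (hq : 2 ≤ q) (hq' : q ≠ ⊤) :
    ∃ C : ℝ, 0 < C ∧ ∀ (H : E → ℂ), Integrable H → ∀ M : ℝ, 0 ≤ M →
      ∫⁻ ξ, ‖H ξ‖ₑ ^ 2 * ENNReal.ofReal (‖ξ‖ ^ (dim * (1 - 2 / q.toReal))) ≤
        ENNReal.ofReal (M ^ 2) →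
      eLpNorm (𝓕⁻ H) q volume ≤ ENNReal.ofReal (C * M) := by
  have hq0 : q ≠ 0 := by rintro rfl; simp at hq
  have hq2 : 2 ≤ q.toReal := by
    simpa using ENNReal.toReal_mono hq' hq
  have hqpos : 0 < q.toReal := by linarith
  have key : ∃ C : ℝ, 0 < C ∧ ∀ (H : E → ℂ), Integrable H → ∀ M : ℝ, 0 < M →
      ∫⁻ ξ, ‖H ξ‖ₑ ^ 2 * ENNReal.ofReal (‖ξ‖ ^ (dim * (1 - 2 / q.toReal))) ≤
        ENNReal.ofReal (M ^ 2) →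
      ∫⁻ x, ENNReal.ofReal (‖𝓕⁻ H x‖ ^ q.toReal) ≤ ENNReal.ofReal (C * M ^ q.toReal) := by
    rcases hq2.eq_or_lt with h | h
    · refine ⟨1, one_pos, fun H hH M hM hN => ?_⟩
      rw [← h] at hN ⊢
      simp only [div_self (two_ne_zero' ℝ), sub_self, mul_zero, Real.rpow_zero, ENNReal.ofReal_one,
        mul_one, Real.rpow_ofNat, one_mul] at hN ⊢
      refine (le_of_eq (lintegral_congr fun x => ?_)).trans
        ((lintegral_fourierInv_sq_le hH).trans hN)
      rw [ENNReal.ofReal_pow (norm_nonneg _), ofReal_norm]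
    · exact exists_lintegral_fourierInv_rpow_le h
  obtain ⟨C, hC, hkey⟩ := key
  have pos : ∀ (H : E → ℂ), Integrable H → ∀ M : ℝ, 0 < M →
      ∫⁻ ξ, ‖H ξ‖ₑ ^ 2 * ENNReal.ofReal (‖ξ‖ ^ (dim * (1 - 2 / q.toReal))) ≤
        ENNReal.ofReal (M ^ 2) →
      eLpNorm (𝓕⁻ H) q volume ≤ ENNReal.ofReal (C ^ (1 / q.toReal) * M) := by
    intro H hH M hM hN
    rw [eLpNorm_eq_lintegral_rpow_enorm_toReal hq0 hq']
    have e : ∫⁻ x, ‖𝓕⁻ H x‖ₑ ^ q.toReal = ∫⁻ x, ENNReal.ofReal (‖𝓕⁻ H x‖ ^ q.toReal) := by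
      refine lintegral_congr fun x => ?_
      rw [← ENNReal.ofReal_rpow_of_nonneg (norm_nonneg _) hqpos.le, ofReal_norm]
    rw [e]
    refine (ENNReal.rpow_le_rpow (hkey H hH M hM hN) (by positivity)).trans ?_
    rw [ENNReal.ofReal_rpow_of_nonneg (by positivity) (by positivity),
      Real.mul_rpow hC.le (by positivity), ← Real.rpow_mul hM.le, mul_one_div_cancel hqpos.ne',
      Real.rpow_one]
  refine ⟨C ^ (1 / q.toReal), by positivity, fun H hH M hM hN => ?_⟩
  refine ENNReal.le_of_forall_pos_le_add fun ε hε _ => ?_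
  have hCp : 0 < C ^ (1 / q.toReal) := by positivity
  have hε' : (0 : ℝ) < ε := hε
  refine (pos H hH (M + ε / C ^ (1 / q.toReal)) (by positivity) (hN.trans ?_)).trans ?_
  · refine ENNReal.ofReal_le_ofReal ?_
    gcongr
    have : 0 < (ε : ℝ) / C ^ (1 / q.toReal) := by positivity
    linarith
  · rw [mul_add, mul_div_cancel₀ _ hCp.ne', ENNReal.ofReal_add (by positivity) hε'.le,
      ENNReal.ofReal_coe_nnreal]

/-- The dual Sobolev estimate `‖(1 + |ξ|²)^{-s/2} 𝓕 f‖₂ ≤ C ‖f‖_p`, `1/p = 1/2 + s/d`, `p > 1`. -/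
theorem exists_lintegral_fourier_sq_le [Nontrivial E] {p : ℝ≥0∞} (hp1 : 1 < p) (hp2 : p ≤ 2) :
    ∃ C : ℝ, 0 < C ∧ ∀ f : 𝓢(E, ℂ),
      ∫⁻ ξ, ‖𝓕 f ξ‖ₑ ^ 2 * ENNReal.ofReal ((1 + ‖ξ‖ ^ 2) ^ (-(dim * (1 / p.toReal - 1 / 2)))) ≤
        ENNReal.ofReal (C ^ 2) * eLpNorm f p volume ^ 2 := by
  have hp' : p ≠ ⊤ := (hp2.trans_lt (by norm_num)).ne
  have hpr : 1 < p.toReal := by simpa using (ENNReal.toReal_lt_toReal (by simp) hp').2 hp1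
  have hpr2 : p.toReal ≤ 2 := by simpa using ENNReal.toReal_mono (by simp) hp2
  set r := p.toReal / (p.toReal - 1) with hr
  have hr0 : 0 < r := div_pos (by linarith) (by linarith)
  have hr2 : 2 ≤ r := by rw [hr, le_div_iff₀ (by linarith)]; linarith
  set p' := ENNReal.ofReal r with hp'def
  have hp'r : p'.toReal = r := ENNReal.toReal_ofReal hr0.le
  have hconj : p.HolderConjugate p' := by
    rw [ENNReal.holderConjugate_iff]
    rw [← ENNReal.ofReal_toReal hp', hp'def, ← ENNReal.ofReal_inv_of_pos (by linarith),
      ← ENNReal.ofReal_inv_of_pos hr0, ← ENNReal.ofReal_add (by positivity) (by positivity)]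
    rw [hr, inv_div, ← one_div, ← add_div]
    rw [show 1 + (p.toReal - 1) = p.toReal by ring, div_self (by linarith), ENNReal.ofReal_one]
  have h2p' : 2 ≤ p' := by
    rw [hp'def]
    calc (2 : ℝ≥0∞) = ENNReal.ofReal 2 := by simp
      _ ≤ _ := ENNReal.ofReal_le_ofReal hr2
  obtain ⟨C, hC, hbound⟩ := exists_eLpNorm_fourierInv_le (E := E) h2p' ENNReal.ofReal_ne_top
  refine ⟨C, hC, fun f => ?_⟩
  set s : ℝ := dim * (1 / p.toReal - 1 / 2) with hs
  have hs0 : 0 ≤ s := by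
    have : (1 : ℝ) / 2 ≤ 1 / p.toReal := one_div_le_one_div_of_le (by linarith) hpr2
    rw [hs]; exact mul_nonneg (by positivity) (by linarith)
  have hse : dim * (1 - 2 / p'.toReal) = 2 * s := by
    rw [hp'r, hs, hr]; field_simp; ring
  set w : E → ℝ := fun ξ => (1 + ‖ξ‖ ^ 2) ^ (-s) with hw
  have hwpos : ∀ ξ, 0 < w ξ := fun ξ => by positivity
  have hwt : (fun ξ : E => ((w ξ : ℝ) : ℂ)).HasTemperateGrowth := hasTemperateGrowth_japanese _
  -- Duality by squaring: `X = ∫ w |𝓕 f|² = ⟨f, 𝓕⁻ H⟩ ≤ ‖f‖_p ‖𝓕⁻ H‖_{p'}`, and the Sobolev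
  -- embedding bounds the last norm by `C √X` because `w ‖ξ‖^{2s} ≤ 1`. It remains to divide by
  -- `√X`, which is finite for Schwartz `f`.
  set H : 𝓢(E, ℂ) := SchwartzMap.smulLeftCLM ℂ (fun ξ => ((w ξ : ℝ) : ℂ)) (𝓕 f) with hH
  have hHa : ∀ ξ, H ξ = (w ξ : ℂ) * 𝓕 f ξ := fun ξ => by
    rw [hH, SchwartzMap.smulLeftCLM_apply_apply hwt, smul_eq_mul]
  have hXint : Integrable (fun ξ => w ξ * ‖𝓕 f ξ‖ ^ 2) := by
    have h := ((𝓕 f).integrable (μ := volume)).norm.mul_const (‖(𝓕 f).toBoundedContinuousFunction‖)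
    refine h.mono' (by
      have := (𝓕 f).continuous
      have h2 : Measurable w := by fun_prop
      exact (h2.mul (this.norm.measurable.pow_const 2)).aestronglyMeasurable) (.of_forall fun ξ => ?_)
    rw [Real.norm_of_nonneg (by have := hwpos ξ; positivity)]
    have h1 : w ξ ≤ 1 := by
      rw [hw]; exact Real.rpow_le_one_of_one_le_of_nonpos (by nlinarith [norm_nonneg ξ]) (by linarith)
    have h2 : ‖𝓕 f ξ‖ ≤ ‖(𝓕 f).toBoundedContinuousFunction‖ :=
      (𝓕 f).toBoundedContinuousFunction.norm_coe_le_norm ξ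
    calc w ξ * ‖𝓕 f ξ‖ ^ 2 ≤ 1 * ‖𝓕 f ξ‖ ^ 2 := by gcongr
      _ = ‖𝓕 f ξ‖ * ‖𝓕 f ξ‖ := by ring
      _ ≤ _ := by gcongr
  set X : ℝ := ∫ ξ, w ξ * ‖𝓕 f ξ‖ ^ 2 with hX
  have hX0 : 0 ≤ X := integral_nonneg fun ξ => by have := hwpos ξ; positivity
  have hXl : ∫⁻ ξ, ‖𝓕 f ξ‖ₑ ^ 2 * ENNReal.ofReal (w ξ) = ENNReal.ofReal X := by
    rw [hX, ofReal_integral_eq_lintegral_ofReal hXint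
      (.of_forall fun ξ => by have := hwpos ξ; positivity)]
    refine lintegral_congr fun ξ => ?_
    rw [ENNReal.ofReal_mul (hwpos ξ).le, ENNReal.ofReal_pow (norm_nonneg _), ofReal_norm, mul_comm]
  rw [hXl]
  have hB : eLpNorm (𝓕⁻ (H : E → ℂ)) p' volume ≤ ENNReal.ofReal (C * √X) := by
    refine hbound H H.integrable _ (by positivity) ?_
    rw [Real.sq_sqrt hX0, ← hXl, hse]
    refine lintegral_mono fun ξ => ?_
    rw [hHa, enorm_mul, mul_pow, mul_comm (_ ^ 2), mul_assoc]
    gcongr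
    have h1 : ‖(w ξ : ℂ)‖ₑ = ENNReal.ofReal (w ξ) := by
      rw [← ofReal_norm, Complex.norm_of_nonneg (hwpos ξ).le]
    rw [h1, ← ENNReal.ofReal_pow (hwpos ξ).le, ← ENNReal.ofReal_mul (by have := hwpos ξ; positivity)]
    refine ENNReal.ofReal_le_ofReal ?_
    have h2 : w ξ * ‖ξ‖ ^ (2 * s) ≤ 1 := by
      rw [hw, Real.rpow_mul (norm_nonneg _), Real.rpow_ofNat]
      simp only
      rw [Real.rpow_neg (by positivity), inv_mul_le_iff₀ (by positivity), mul_one]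
      gcongr; linarith
    have := hwpos ξ
    nlinarith
  have hpair : ENNReal.ofReal X ≤ eLpNorm f p volume * eLpNorm (𝓕⁻ (H : E → ℂ)) p' volume := by
    have e1 : (X : ℂ) = ∫ x, inner ℂ (f x) (𝓕⁻ H x) := by
      have h := SchwartzMap.integral_inner_fourier_fourier f (𝓕⁻ H)
      rw [FourierTransform.fourier_fourierInv_eq] at h
      rw [← h, hX, ← integral_complex_ofReal]
      refine integral_congr_ae (.of_forall fun ξ => ?_)
      simp only
      rw [hHa, RCLike.inner_apply, mul_assoc, Complex.mul_conj, Complex.normSq_eq_norm_sq]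
      push_cast; ring
    have e2 : ENNReal.ofReal X = ‖∫ x, inner ℂ (f x) (𝓕⁻ H x)‖ₑ := by
      rw [← e1, ← ofReal_norm, Complex.norm_of_nonneg hX0]
    rw [e2]
    refine (enorm_integral_le_lintegral_enorm _).trans ?_
    have h3 := eLpNorm_smul_le_mul_eLpNorm (p := p) (q := p') (r := 1) (μ := volume)
      (f := (𝓕⁻ H : 𝓢(E, ℂ))) (φ := f) (𝓕⁻ H : 𝓢(E, ℂ)).continuous.aestronglyMeasurable
      f.continuous.aestronglyMeasurable
    rw [eLpNorm_one_eq_lintegral_enorm] at h3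
    rw [← SchwartzMap.fourierInv_coe]
    refine (lintegral_mono fun x => ?_).trans h3
    rw [RCLike.inner_apply, enorm_mul]
    simp [mul_comm]
  rcases hX0.eq_or_lt with h0 | h0
  · rw [← h0]; simp
  have h4 : ENNReal.ofReal √X ≤ eLpNorm f p volume * ENNReal.ofReal C := by
    have h5 : ENNReal.ofReal √X * ENNReal.ofReal √X ≤
        (eLpNorm f p volume * ENNReal.ofReal C) * ENNReal.ofReal √X := by
      rw [← ENNReal.ofReal_mul (by positivity), Real.mul_self_sqrt hX0, mul_assoc,
        ← ENNReal.ofReal_mul hC.le]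
      exact hpair.trans (by gcongr)
    exact (ENNReal.mul_le_mul_iff_left (by simpa using h0) ENNReal.ofReal_ne_top).1 h5
  calc ENNReal.ofReal X = ENNReal.ofReal √X ^ 2 := by
        rw [← ENNReal.ofReal_pow (by positivity), Real.sq_sqrt hX0]
    _ ≤ (eLpNorm f p volume * ENNReal.ofReal C) ^ 2 := by gcongr
    _ = _ := by rw [mul_pow, ← ENNReal.ofReal_pow hC.le, mul_comm]

/-- The decay splits as `dim (1/p - 1/2) + dim (1/2 - 1/q)`: one share pays for the dual Sobolev
estimate of `𝓕 f`, the other for the embedding into `L^q`. The passage through `L²` is why `p ≤ 2 ≤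
q`. -/
theorem exists_eLpNorm_fourierMultiplier_le [Nontrivial E] {p q : ℝ≥0∞} (hp1 : 1 < p) (hp2 : p ≤ 2)
    (hq : 2 ≤ q) (hq' : q ≠ ⊤) :
    ∃ C : ℝ, 0 < C ∧ ∀ (g : E → ℂ) (B : ℝ), g.HasTemperateGrowth → 0 ≤ B →
      (∀ ξ, ‖g ξ‖ ≤ B * (1 + ‖ξ‖ ^ 2) ^ (-(dim * (1 / p.toReal - 1 / q.toReal)) / 2)) →
      ∀ f : 𝓢(E, ℂ), eLpNorm (SchwartzMap.fourierMultiplierCLM ℂ g f) q volume ≤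
        ENNReal.ofReal (C * B) * eLpNorm f p volume := by
  obtain ⟨C₁, hC₁, h₁⟩ := exists_lintegral_fourier_sq_le (E := E) hp1 hp2
  obtain ⟨C₂, hC₂, h₂⟩ := exists_eLpNorm_fourierInv_le (E := E) hq hq'
  have hq2 : 2 ≤ q.toReal := by simpa using ENNReal.toReal_mono hq' hq
  refine ⟨C₂ * C₁, by positivity, fun g B hg hB hgB f => ?_⟩
  have hfin : eLpNorm f p volume ≠ ⊤ := (f.memLp p volume).eLpNorm_ne_top
  obtain ⟨F, hF0, hFe⟩ : ∃ F : ℝ, 0 ≤ F ∧ eLpNorm f p volume = ENNReal.ofReal F :=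
    ⟨_, ENNReal.toReal_nonneg, (ENNReal.ofReal_toReal hfin).symm⟩
  obtain ⟨H, hH⟩ : ∃ H : 𝓢(E, ℂ), H = SchwartzMap.smulLeftCLM ℂ g (𝓕 f) := ⟨_, rfl⟩
  have hHa : ∀ ξ, H ξ = g ξ * 𝓕 f ξ := fun ξ => by
    rw [hH, SchwartzMap.smulLeftCLM_apply_apply hg, smul_eq_mul]
  have h := h₂ H H.integrable (B * C₁ * F) (by positivity) ?_
  · rw [SchwartzMap.fourierMultiplierCLM_apply, ← hH, SchwartzMap.fourierInv_coe]
    refine h.trans (le_of_eq ?_)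
    rw [hFe, ← ENNReal.ofReal_mul (by positivity)]
    congr 1; ring
  · calc _ ≤ ∫⁻ ξ, ENNReal.ofReal (B ^ 2) * (‖𝓕 f ξ‖ₑ ^ 2 *
          ENNReal.ofReal ((1 + ‖ξ‖ ^ 2) ^ (-(dim * (1 / p.toReal - 1 / 2))))) := by
          refine lintegral_mono fun ξ => ?_
          simp only
          rw [hHa, enorm_mul, mul_pow, mul_comm (_ ^ 2), mul_assoc,
            mul_left_comm (ENNReal.ofReal (B ^ 2))]
          gcongr ‖𝓕 f ξ‖ₑ ^ 2 * ?_
          rw [← ofReal_norm, ← ENNReal.ofReal_pow (norm_nonneg _), ← ENNReal.ofReal_mul (by positivity),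
            ← ENNReal.ofReal_mul (by positivity)]
          refine ENNReal.ofReal_le_ofReal ?_
          have hj : 0 < 1 + ‖ξ‖ ^ 2 := by positivity
          have e1 : ‖ξ‖ ^ (dim * (1 - 2 / q.toReal)) ≤ (1 + ‖ξ‖ ^ 2) ^ (dim * (1 / 2 - 1 / q.toReal)) := by
            have : dim * (1 - 2 / q.toReal) = 2 * (dim * (1 / 2 - 1 / q.toReal)) := by ring
            rw [this, Real.rpow_mul (norm_nonneg _), Real.rpow_ofNat]
            have : 1 / q.toReal ≤ 1 / 2 := one_div_le_one_div_of_le (by norm_num) hq2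
            have : 0 ≤ dim * (1 / 2 - 1 / q.toReal) := mul_nonneg (by positivity) (by linarith)
            gcongr
            linarith
          calc ‖g ξ‖ ^ 2 * ‖ξ‖ ^ (dim * (1 - 2 / q.toReal)) ≤
              (B * (1 + ‖ξ‖ ^ 2) ^ (-(dim * (1 / p.toReal - 1 / q.toReal)) / 2)) ^ 2 *
                (1 + ‖ξ‖ ^ 2) ^ (dim * (1 / 2 - 1 / q.toReal)) := by
                gcongr; exact hgB ξ
            _ = _ := by
                rw [mul_pow, ← Real.rpow_natCast ((1 + ‖ξ‖ ^ 2) ^ _) 2, ← Real.rpow_mul hj.le,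
                  mul_assoc, ← Real.rpow_add hj]
                congr 2
                push_cast; ring
      _ ≤ ENNReal.ofReal (B ^ 2) * (ENNReal.ofReal (C₁ ^ 2) * eLpNorm f p volume ^ 2) := by
          rw [lintegral_const_mul' _ _ ENNReal.ofReal_ne_top]
          gcongr; exact h₁ f
      _ = _ := by
          rw [hFe, ← ENNReal.ofReal_pow hF0, ← ENNReal.ofReal_mul (by positivity),
            ← ENNReal.ofReal_mul (by positivity)]
          congr 1; ring

/-- Boundedness of a Fourier multiplier on Schwartz functions extends to `L^p`. -/
theorem exists_fourierMultiplier_Lp {p q : ℝ≥0∞} [Fact (1 ≤ p)] [Fact (1 ≤ q)] (hp : p ≠ ⊤)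
    {g : E → ℂ} (hg : g.HasTemperateGrowth) {K : ℝ} (hK : 0 ≤ K)
    (h : ∀ f : 𝓢(E, ℂ), eLpNorm (SchwartzMap.fourierMultiplierCLM ℂ g f) q volume ≤
        ENNReal.ofReal K * eLpNorm f p volume) (u : Lp ℂ p (volume : Measure E)) :
    ∃ v : Lp ℂ q (volume : Measure E),
      TemperedDistribution.fourierMultiplierCLM ℂ g (Lp.toTemperedDistribution u) =
        Lp.toTemperedDistribution v ∧ ‖v‖ ≤ K * ‖u‖ := by
  set T : 𝓢(E, ℂ) →ₗ[ℂ] Lp ℂ q (volume : Measure E) :=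
    (SchwartzMap.toLpCLM ℂ (E := E) ℂ q volume ∘L
      SchwartzMap.fourierMultiplierCLM ℂ g).toLinearMap with hT
  set e : 𝓢(E, ℂ) →ₗ[ℂ] Lp ℂ p (volume : Measure E) := 
    (SchwartzMap.toLpCLM ℂ (E := E) ℂ p volume).toLinearMap with he
  have hd : DenseRange e := SchwartzMap.denseRange_toLpCLM hp
  have hb : ∀ f, ‖T f‖ ≤ K * ‖e f‖ := by
    intro f
    change ‖(SchwartzMap.fourierMultiplierCLM ℂ g f).toLp q volume‖ ≤ K * ‖f.toLp p volume‖
    rw [SchwartzMap.norm_toLp, SchwartzMap.norm_toLp]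
    have := ENNReal.toReal_mono (ENNReal.mul_ne_top ENNReal.ofReal_ne_top (f.memLp p volume).eLpNorm_ne_top) (h f)
    rwa [ENNReal.toReal_mul, ENNReal.toReal_ofReal hK] at this
  set S := T.extendOfNorm e with hS
  have hSe : ∀ f, S (e f) = T f := fun f => LinearMap.extendOfNorm_eq hd ⟨K, hb⟩ f
  refine ⟨S u, ?_, LinearMap.norm_extendOfNorm_apply_le hd K hb u⟩
  -- Both sides are continuous in `u` with values in tempered distributions, so the identity passes
  -- from Schwartz functions to their closure.
  have hcl : IsClosed {u : Lp ℂ p (volume : Measure E) |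
      TemperedDistribution.fourierMultiplierCLM ℂ g (Lp.toTemperedDistribution u) =
        Lp.toTemperedDistribution (S u)} := by
    apply isClosed_eq
    · exact (TemperedDistribution.fourierMultiplierCLM ℂ g ∘L
        Lp.toTemperedDistributionCLM ℂ volume p).continuous
    · exact (Lp.toTemperedDistributionCLM ℂ volume q ∘L S).continuous
  refine hd.induction_on (p := fun u => u ∈ {u : Lp ℂ p (volume : Measure E) |
      TemperedDistribution.fourierMultiplierCLM ℂ g (Lp.toTemperedDistribution u) =
        Lp.toTemperedDistribution (S u)}) u hcl fun f => ?_
  · rw [Set.mem_ofPred_eq, hSe]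
    change TemperedDistribution.fourierMultiplierCLM ℂ g
      (Lp.toTemperedDistribution (f.toLp p volume)) =
        Lp.toTemperedDistribution ((SchwartzMap.fourierMultiplierCLM ℂ g f).toLp q volume)
    rw [Lp.toTemperedDistribution_toLp_eq, Lp.toTemperedDistribution_toLp_eq,
      TemperedDistribution.fourierMultiplierCLM_toTemperedDistributionCLM_eq hg]

end Multiplier

end HigherOrderWave

namespace HigherOrderWave

/-! ### Homogenised symbol: size and gradient of `P` by compactness. -/

section Homogenization

open Set Metric

variable {n m : ℕ}

/-- The homogenisation, of degree `m` and with the new variable at the index `0`, of the polynomial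
`ξ ↦ P (2πξ)`. -/
noncomputable def homogenization (P : MvPolynomial (Fin n) ℝ) (m : ℕ) :
    MvPolynomial (Fin (n + 1)) ℝ :=
  ∑ d ∈ P.support, MvPolynomial.monomial (d.cons (m - d.degree))
    ((2 * Real.pi) ^ d.degree * P.coeff d)

/-- `(δ, η) ↦ (δ, η₀, …, ηₙ₋₁)`. -/
noncomputable def consL (n : ℕ) :
    ℝ × EuclideanSpace ℝ (Fin n) →L[ℝ] EuclideanSpace ℝ (Fin (n + 1)) :=
  LinearMap.toContinuousLinearMap
    { toFun := fun z => WithLp.toLp 2 (Fin.cons z.1 (fun i => z.2 i) : Fin (n + 1) → ℝ)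
      map_add' := fun x y => by
        ext i; refine Fin.cases ?_ (fun j => ?_) i <;> simp
      map_smul' := fun c x => by
        ext i; refine Fin.cases ?_ (fun j => ?_) i <;> simp }

@[simp] theorem consL_zero (z : ℝ × EuclideanSpace ℝ (Fin n)) : consL n z 0 = z.1 := rfl

@[simp] theorem consL_succ (z : ℝ × EuclideanSpace ℝ (Fin n)) (i : Fin n) :
    consL n z i.succ = z.2 i := rfl

/-- The homogenised symbol as a function of `(δ, η)`; it equals `δ^m P (2πη / δ)`. -/
noncomputable def homSymbol (P : MvPolynomial (Fin n) ℝ) (m : ℕ)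
    (z : ℝ × EuclideanSpace ℝ (Fin n)) : ℝ :=
  polyEval (homogenization P m) (consL n z)

theorem EllipticPositive.degree_le {P : MvPolynomial (Fin n) ℝ} (hP : EllipticPositive P m)
    {d : Fin n →₀ ℕ} (hd : d ∈ P.support) : d.degree ≤ m := by
  have := MvPolynomial.le_totalDegree hd
  rwa [hP.order_eq] at this

theorem EllipticPositive.isHomogeneous {P : MvPolynomial (Fin n) ℝ} (hP : EllipticPositive P m) :
    (homogenization P m).IsHomogeneous m := by
  refine MvPolynomial.IsHomogeneous.sum _ _ _ fun d hd => MvPolynomial.isHomogeneous_monomial _ ?_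
  rw [Finsupp.degree_eq_sum, Fin.sum_univ_succ]
  simp only [Finsupp.cons_zero, Finsupp.cons_succ]
  rw [← Finsupp.degree_eq_sum]
  have := hP.degree_le hd
  omega

theorem homSymbol_eq_sum (P : MvPolynomial (Fin n) ℝ) (m : ℕ)
    (z : ℝ × EuclideanSpace ℝ (Fin n)) :
    homSymbol P m z = ∑ d ∈ P.support,
      (2 * Real.pi) ^ d.degree * P.coeff d * (z.1 ^ (m - d.degree) * ∏ i, z.2 i ^ d i) := by
  rw [homSymbol, polyEval, homogenization, map_sum]
  refine Finset.sum_congr rfl fun d _ => ?_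
  rw [MvPolynomial.eval_monomial, Finsupp.prod_fintype _ _ (by simp), Fin.prod_univ_succ]
  simp

theorem homSymbol_one (P : MvPolynomial (Fin n) ℝ) (m : ℕ) (ξ : EuclideanSpace ℝ (Fin n)) :
    homSymbol P m (1, ξ) = polyEval P ((2 * Real.pi) • ξ) := by
  rw [homSymbol_eq_sum, polyEval, MvPolynomial.eval_eq']
  refine Finset.sum_congr rfl fun d _ => ?_
  simp only [one_pow, one_mul, PiLp.smul_apply, smul_eq_mul, mul_pow, Finset.prod_mul_distrib,
    Finset.prod_pow_eq_pow_sum, ← Finsupp.degree_eq_sum]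
  ring

theorem EllipticPositive.homSymbol_zero {P : MvPolynomial (Fin n) ℝ} (hP : EllipticPositive P m)
    (ξ : EuclideanSpace ℝ (Fin n)) :
    homSymbol P m (0, ξ) =
      polyEval (MvPolynomial.homogeneousComponent m P) ((2 * Real.pi) • ξ) := by
  rw [homSymbol_eq_sum, polyEval, MvPolynomial.homogeneousComponent_apply, map_sum,
    ← Finset.sum_filter_add_sum_filter_not P.support (fun d => d.degree = m),
    Finset.sum_eq_zero (s := Finset.filter (fun d => ¬ d.degree = m) P.support), add_zero]
  · refine Finset.sum_congr rfl fun d hd => ?_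
    have hdm := (Finset.mem_filter.1 hd).2
    rw [MvPolynomial.eval_monomial, Finsupp.prod_fintype _ _ (by simp)]
    simp only [hdm, Nat.sub_self, pow_zero, one_mul, PiLp.smul_apply, smul_eq_mul, mul_pow,
      Finset.prod_mul_distrib, Finset.prod_pow_eq_pow_sum]
    rw [← Finsupp.degree_eq_sum, hdm]
    ring
  · intro d hd
    have hd' := Finset.mem_filter.1 hd
    have := hP.degree_le hd'.1
    have : m - d.degree ≠ 0 := by have := hd'.2; omega
    simp [this]

theorem EllipticPositive.homSymbol_smul {P : MvPolynomial (Fin n) ℝ} (hP : EllipticPositive P m)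
    (s : ℝ) (z : ℝ × EuclideanSpace ℝ (Fin n)) :
    homSymbol P m (s • z) = s ^ m * homSymbol P m z := by
  rw [homSymbol, map_smul, polyEval_smul hP.isHomogeneous, homSymbol]

theorem contDiff_homSymbol (P : MvPolynomial (Fin n) ℝ) (m : ℕ) :
    ContDiff ℝ ∞ (homSymbol P m) :=
  (hasTemperateGrowth_polyEval _).1.comp (consL n).contDiff

/-- For `δ > 0` this is the positivity of `P` after scaling. At `δ = 0` only the principal part
survives: it is nonzero by ellipticity and nonnegative as a limit. Having `δ = 0` included makes the
later compactness arguments uniform over all large frequencies. -/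
theorem EllipticPositive.homSymbol_pos {P : MvPolynomial (Fin n) ℝ} (hP : EllipticPositive P m)
    {z : ℝ × EuclideanSpace ℝ (Fin n)} (h0 : 0 ≤ z.1) (hz : z ≠ 0) : 0 < homSymbol P m z := by
  obtain ⟨δ, η⟩ := z
  have pos : ∀ δ' : ℝ, 0 < δ' → ∀ η', 0 < homSymbol P m (δ', η') := by
    intro δ' hδ' η'
    have : (δ', η') = δ' • ((1 : ℝ), δ'⁻¹ • η') := by
      simp [smul_smul, hδ'.ne']
    rw [this, hP.homSymbol_smul, homSymbol_one]
    have := hP.pos ((2 * Real.pi) • δ'⁻¹ • η')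
    positivity
  rcases h0.eq_or_lt with h | h
  · have h : δ = 0 := h.symm
    subst h
    have hη : η ≠ 0 := by rintro rfl; exact hz rfl
    have hne : homSymbol P m (0, η) ≠ 0 := by
      rw [hP.homSymbol_zero]
      exact hP.elliptic _ (smul_ne_zero (by positivity) hη)
    refine lt_of_le_of_ne ?_ hne.symm
    have hc : Continuous fun δ : ℝ => homSymbol P m (δ, η) :=
      (contDiff_homSymbol P m).continuous.comp (by fun_prop)
    have ht : Filter.Tendsto (fun δ : ℝ => homSymbol P m (δ, η)) (nhdsWithin 0 (Ioi 0))
        (nhds (homSymbol P m (0, η))) := (hc.tendsto 0).mono_left nhdsWithin_le_nhds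
    refine ge_of_tendsto ht ?_
    filter_upwards [self_mem_nhdsWithin] with δ hδ
    exact (pos δ hδ η).le
  · exact pos δ h η

/-- The compact set of the `(δ, η)` with `δ ≥ 0` and `δ + |η| = 1`. -/
theorem isCompact_normalized :
    IsCompact {z : ℝ × EuclideanSpace ℝ (Fin n) | 0 ≤ z.1 ∧ z.1 + ‖z.2‖ = 1} := by
  refine (isCompact_Icc (a := (0 : ℝ)) (b := 1)).prod
    (isCompact_closedBall (0 : EuclideanSpace ℝ (Fin n)) 1) |>.of_isClosed_subset ?_ ?_
  · exact (isClosed_le continuous_const continuous_fst).inter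
      (isClosed_eq (by fun_prop) continuous_const)
  · rintro ⟨δ, η⟩ ⟨h0, h1⟩
    simp only at h0 h1
    have := norm_nonneg η
    simp only [mem_prod, mem_Icc, mem_closedBall_zero_iff]
    exact ⟨⟨h0, by linarith⟩, by linarith⟩

theorem normalize_mem (ξ : EuclideanSpace ℝ (Fin n)) :
    (1 + ‖ξ‖)⁻¹ • ((1 : ℝ), ξ) ∈
      {z : ℝ × EuclideanSpace ℝ (Fin n) | 0 ≤ z.1 ∧ z.1 + ‖z.2‖ = 1} := by
  have h : 0 < 1 + ‖ξ‖ := by positivity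
  refine ⟨by simpa using h.le, ?_⟩
  simp only [Prod.smul_mk, norm_smul, norm_inv, Real.norm_of_nonneg h.le, smul_eq_mul]
  field_simp

/-- `(1, ξ)` is `1 + ‖ξ‖` times a point of the compact set `δ + ‖η‖ = 1`, `δ ≥ 0`, on which the
homogeneous symbol has a positive minimum. -/
theorem EllipticPositive.exists_le_polyEval {P : MvPolynomial (Fin n) ℝ}
    (hP : EllipticPositive P m) :
    ∃ c : ℝ, 0 < c ∧ ∀ ξ : EuclideanSpace ℝ (Fin n),
      c * (1 + ‖ξ‖) ^ m ≤ polyEval P ((2 * Real.pi) • ξ) := by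
  obtain ⟨c, hc, h⟩ := (isCompact_normalized (n := n)).exists_forall_le'
    (contDiff_homSymbol P m).continuous.continuousOn (a := 0) (by
      intro z hz
      refine hP.homSymbol_pos hz.1 ?_
      rintro rfl
      simp at hz)
  refine ⟨c, hc, fun ξ => ?_⟩
  have h1 := h _ (normalize_mem ξ)
  have h0 : 0 < 1 + ‖ξ‖ := by positivity
  rw [hP.homSymbol_smul, homSymbol_one, inv_pow, ← div_eq_inv_mul, le_div_iff₀ (by positivity)] at h1
  exact h1

/-- The derivative of the homogenised symbol is homogeneous of degree `m - 1`, and it is bounded on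
the same compact set. -/
theorem EllipticPositive.exists_norm_fderiv_polyEval_le {P : MvPolynomial (Fin n) ℝ}
    (hP : EllipticPositive P m) :
    ∃ C : ℝ, 0 < C ∧ ∀ ξ : EuclideanSpace ℝ (Fin n),
      ‖fderiv ℝ (fun ξ => polyEval P ((2 * Real.pi) • ξ)) ξ‖ ≤ C * (1 + ‖ξ‖) ^ (m - 1) := by
  have hcd := contDiff_homSymbol P m
  have hdiff : Differentiable ℝ (homSymbol P m) := hcd.differentiable (by simp)
  obtain ⟨C, hC⟩ := (isCompact_normalized (n := n)).exists_bound_of_continuousOn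
    (hcd.continuous_fderiv (by simp)).continuousOn
  set I := ContinuousLinearMap.inr ℝ ℝ (EuclideanSpace ℝ (Fin n)) with hI
  refine ⟨(max C 0 + 1) * (‖I‖ + 1), by positivity, fun ξ => ?_⟩
  have h0 : 0 < 1 + ‖ξ‖ := by positivity
  have hm := hP.four_le_order
  have e1 : HasFDerivAt (fun ξ => polyEval P ((2 * Real.pi) • ξ))
      ((fderiv ℝ (homSymbol P m) (1, ξ)).comp I) ξ := by
    have h1 : HasFDerivAt (fun ξ : EuclideanSpace ℝ (Fin n) => ((1 : ℝ), ξ)) I ξ :=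
      hasFDerivAt_prodMk_right 1 ξ
    have h2 := (hdiff (1, ξ)).hasFDerivAt.comp ξ h1
    refine h2.congr_of_eventuallyEq (.of_forall fun η => ?_)
    simp [homSymbol_one]
  have e2 : fderiv ℝ (homSymbol P m) (1, ξ) =
      (1 + ‖ξ‖) ^ (m - 1) • fderiv ℝ (homSymbol P m) ((1 + ‖ξ‖)⁻¹ • ((1 : ℝ), ξ)) := by
    set s := 1 + ‖ξ‖
    have h1 : homSymbol P m = fun z => s ^ m * homSymbol P m (s⁻¹ • z) := by
      funext z
      rw [← hP.homSymbol_smul, smul_smul, mul_inv_cancel₀ h0.ne', one_smul]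
    have h2 : HasFDerivAt (fun z : ℝ × EuclideanSpace ℝ (Fin n) => s⁻¹ • z)
        (s⁻¹ • ContinuousLinearMap.id ℝ (ℝ × EuclideanSpace ℝ (Fin n))) (1, ξ) :=
      (ContinuousLinearMap.id ℝ (ℝ × EuclideanSpace ℝ (Fin n))).hasFDerivAt.const_smul s⁻¹
    have h3 := ((hdiff (s⁻¹ • ((1 : ℝ), ξ))).hasFDerivAt.comp ((1 : ℝ), ξ) h2).const_mul (s ^ m)
    have h4 := h3.congr_of_eventuallyEq (f₁ := homSymbol P m) (.of_forall fun z => congrFun h1 z)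
    rw [h4.fderiv]
    ext v <;>
    · simp only [smul_apply, ContinuousLinearMap.comp_apply, smul_eq_mul,
        ContinuousLinearMap.id_apply, map_smul]
      rw [← mul_assoc]
      congr 1
      obtain ⟨k, rfl⟩ : ∃ k, m = k + 1 := ⟨m - 1, by omega⟩
      rw [Nat.add_sub_cancel, pow_succ]
      field_simp
  rw [e1.fderiv, e2]
  refine (ContinuousLinearMap.opNorm_comp_le _ _).trans ?_
  rw [norm_smul, Real.norm_of_nonneg (by positivity)]
  have h5 := hC _ (normalize_mem ξ)
  have h6 : ‖fderiv ℝ (homSymbol P m) ((1 + ‖ξ‖)⁻¹ • ((1 : ℝ), ξ))‖ ≤ max C 0 + 1 :=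
    h5.trans ((le_max_left _ _).trans (by linarith))
  calc _ ≤ (1 + ‖ξ‖) ^ (m - 1) * (max C 0 + 1) * (‖I‖ + 1) := by gcongr; linarith
    _ = _ := by ring

end Homogenization

end HigherOrderWave

namespace HigherOrderWave

/-! ### The strong bound for `p > 1`. -/

section Interior

open Set

variable {n m : ℕ}

/-- Interpolates between `|sin x| ≤ |x|` (`κ = 0`) and `|sin x| ≤ 1` (`κ = 1`). -/
theorem abs_sin_mul_div_le {a t κ : ℝ} (ha : 0 < a) (hκ0 : 0 ≤ κ) (hκ1 : κ ≤ 1) :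
    |Real.sin (a * t) / a| ≤ |t| ^ (1 - κ) * a ^ (-κ) := by
  rcases eq_or_ne t 0 with rfl | ht
  · simp only [mul_zero, Real.sin_zero, zero_div, abs_zero]
    positivity
  have ht' : 0 < |t| := abs_pos.2 ht
  have h1 : |Real.sin (a * t)| ≤ (a * |t|) ^ (1 - κ) := by
    rcases le_total (a * |t|) 1 with h | h
    · calc |Real.sin (a * t)| ≤ |a * t| := Real.abs_sin_le_abs
        _ = (a * |t|) ^ (1 : ℝ) := by rw [abs_mul, abs_of_pos ha, Real.rpow_one]
        _ ≤ _ := Real.rpow_le_rpow_of_exponent_ge (by positivity) h (by linarith)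
    · exact (Real.abs_sin_le_one _).trans (Real.one_le_rpow h (by linarith))
  rw [abs_div, abs_of_pos ha, div_le_iff₀ ha]
  refine h1.trans (le_of_eq ?_)
  rw [Real.mul_rpow ha.le ht'.le, mul_comm, mul_assoc]
  congr 1
  nth_rw 3 [← Real.rpow_one a]
  rw [← Real.rpow_add ha]
  congr 1; ring

/-- The second bound is the case `κ = 1`, in which `t` disappears, with the excess decay discarded;
it provides the time-independent estimate. -/
theorem EllipticPositive.exists_sineSymbol_le {P : MvPolynomial (Fin n) ℝ}
    (hP : EllipticPositive P m) {κ : ℝ} (hκ0 : 0 ≤ κ) (hκ1 : κ ≤ 1) :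
    ∃ C : ℝ, 0 < C ∧ ∀ (t : ℝ) (ξ : EuclideanSpace ℝ (Fin n)),
      |sineSymbol P t ((2 * Real.pi) • ξ)| ≤
        C * |t| ^ (1 - κ) * (1 + ‖ξ‖ ^ 2) ^ (-(κ * m / 4)) ∧
      |sineSymbol P t ((2 * Real.pi) • ξ)| ≤ C * (1 + ‖ξ‖ ^ 2) ^ (-(κ * m / 4)) := by
  obtain ⟨c, hc, hlow⟩ := hP.exists_le_polyEval
  have key : ∀ (κ : ℝ), 0 ≤ κ → ∀ ξ : EuclideanSpace ℝ (Fin n),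
      √(polyEval P ((2 * Real.pi) • ξ)) ^ (-κ) ≤
        c ^ (-(κ / 2)) * (1 + ‖ξ‖ ^ 2) ^ (-(κ * m / 4)) := by
    intro κ hκ ξ
    have hp := hP.pos ((2 * Real.pi) • ξ)
    have hj : 0 < 1 + ‖ξ‖ ^ 2 := by positivity
    have h1 : c * (1 + ‖ξ‖ ^ 2) ^ ((m : ℝ) / 2) ≤ polyEval P ((2 * Real.pi) • ξ) := by
      refine le_trans ?_ (hlow ξ)
      gcongr
      have : (1 + ‖ξ‖) ^ m = ((1 + ‖ξ‖) ^ 2) ^ ((m : ℝ) / 2) := by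
        rw [← Real.rpow_natCast (1 + ‖ξ‖) 2, ← Real.rpow_mul (by positivity), ← Real.rpow_natCast]
        congr 1; push_cast; ring
      rw [this]
      gcongr
      nlinarith [norm_nonneg ξ]
    rw [Real.sqrt_eq_rpow, ← Real.rpow_mul hp.le]
    calc polyEval P ((2 * Real.pi) • ξ) ^ (1 / 2 * -κ)
        ≤ (c * (1 + ‖ξ‖ ^ 2) ^ ((m : ℝ) / 2)) ^ (1 / 2 * -κ) :=
          Real.rpow_le_rpow_of_nonpos (by positivity) h1 (by linarith)
      _ = _ := by
          rw [Real.mul_rpow hc.le (by positivity), ← Real.rpow_mul hj.le]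
          congr 2 <;> ring
  refine ⟨c ^ (-(κ / 2)) + c ^ (-(1 / 2 : ℝ)), by positivity, fun t ξ => ?_⟩
  have hs : 0 < √(polyEval P ((2 * Real.pi) • ξ)) := Real.sqrt_pos.2 (hP.pos _)
  have hc1 : 0 < c ^ (-(κ / 2)) := by positivity
  have hc2 : 0 < c ^ (-(1 / 2 : ℝ)) := by positivity
  constructor
  · refine (abs_sin_mul_div_le hs hκ0 hκ1).trans ?_
    calc _ ≤ |t| ^ (1 - κ) * (c ^ (-(κ / 2)) * (1 + ‖ξ‖ ^ 2) ^ (-(κ * m / 4))) := by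
          gcongr; exact key κ hκ0 ξ
      _ = c ^ (-(κ / 2)) * |t| ^ (1 - κ) * (1 + ‖ξ‖ ^ 2) ^ (-(κ * m / 4)) := by ring
      _ ≤ _ := by gcongr; linarith
  · refine (abs_sin_mul_div_le (κ := 1) hs zero_le_one le_rfl).trans ?_
    rw [sub_self, Real.rpow_zero, one_mul]
    refine (key 1 zero_le_one ξ).trans ?_
    gcongr
    · linarith
    · nlinarith [norm_nonneg ξ]

theorem weakLpNorm_le_eLpNorm {q : ℝ≥0∞} (hq0 : q ≠ 0) (hq : q ≠ ⊤)
    {f : EuclideanSpace ℝ (Fin n) → ℂ} (hf : AEStronglyMeasurable f volume) :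
    weakLpNorm f q ≤ eLpNorm f q volume := by
  rw [weakLpNorm, if_neg hq]
  refine iSup_le fun s => ?_
  have hqr : 0 < q.toReal := ENNReal.toReal_pos hq0 hq
  have h := mul_meas_ge_le_pow_eLpNorm' volume hq0 hq hf (s : ℝ≥0∞)
  have h2 : (s : ℝ≥0∞) ^ q.toReal * volume {x | s < ‖f x‖₊} ≤ eLpNorm f q volume ^ q.toReal := by
    refine le_trans ?_ h
    gcongr with x
    intro hx
    exact ENNReal.coe_le_coe.2 hx.le
  have h3 := ENNReal.rpow_le_rpow h2 (z := 1 / q.toReal) (by positivity)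
  rwa [ENNReal.mul_rpow_of_nonneg _ _ (by positivity), ← ENNReal.rpow_mul, ← ENNReal.rpow_mul,
    mul_one_div_cancel hqr.ne', ENNReal.rpow_one, ENNReal.rpow_one] at h3

theorem targetNorm_le_eLpNorm {p q : ℝ≥0∞} (hq0 : q ≠ 0) (hq : q ≠ ⊤)
    {f : EuclideanSpace ℝ (Fin n) → ℂ} (hf : AEStronglyMeasurable f volume) :
    targetNorm n m p q f ≤ eLpNorm f q volume := by
  rw [targetNorm]
  split_ifs
  · exact weakLpNorm_le_eLpNorm hq0 hq hf
  · exact le_rfl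

/-- The half-planes are convex, so the vertices suffice. They encode `p ≤ 2 ≤ q` and the side `EF`,
which is the limit set by the decay of order `m/2` of `P^{-1/2}`. -/
theorem triangleAEF_subset (hn : 0 < n) :
    triangleAEF n m ⊆ {z | 1 / 2 ≤ z.1 ∧ z.2 ≤ 1 / 2 ∧ z.1 - z.2 ≤ (m : ℝ) / (2 * n)} := by
  have hn' : (0 : ℝ) < n := by exact_mod_cast hn
  refine convexHull_min ?_ ?_
  · have h1 : ((n : ℝ) + m) / (2 * n) = 1 / 2 + m / (2 * n) := by field_simp
    have h2 : ((n : ℝ) - m) / (2 * n) = 1 / 2 - m / (2 * n) := by field_simp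
    have h3 : (0 : ℝ) ≤ m / (2 * n) := by positivity
    rintro z (rfl | rfl | rfl)
    · simpa using h3
    · rw [h1]; refine ⟨?_, ?_, ?_⟩ <;> simp only <;> linarith
    · rw [h2]; refine ⟨?_, ?_, ?_⟩ <;> simp only <;> linarith
  · rintro ⟨x1, x2⟩ ⟨h1, h2, h3⟩ ⟨y1, y2⟩ ⟨h4, h5, h6⟩ a b ha hb hab
    simp only at h1 h2 h3 h4 h5 h6
    refine ⟨?_, ?_, ?_⟩ <;>
      simp only [Prod.smul_mk, Prod.mk_add_mk, smul_eq_mul]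
    · nlinarith
    · nlinarith
    · have := mul_le_mul_of_nonneg_left h3 ha
      have := mul_le_mul_of_nonneg_left h6 hb
      have : a * ((m : ℝ) / (2 * n)) + b * (m / (2 * n)) = m / (2 * n) := by
        rw [← add_mul, hab, one_mul]
      linarith

theorem isGivenBy_toTemperedDistribution {q : ℝ≥0∞} [Fact (1 ≤ q)]
    (v : Lp ℂ q (volume : Measure (EuclideanSpace ℝ (Fin n)))) :
    IsGivenBy (Lp.toTemperedDistribution v) v := by
  refine ⟨Lp.aestronglyMeasurable v, fun ψ => ⟨?_, Lp.toTemperedDistribution_apply v ψ⟩⟩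
  have hconj : ENNReal.HolderConjugate q (1 - q⁻¹)⁻¹ :=
    ENNReal.HolderConjugate.inv_one_sub_inv' Fact.out
  have := hconj.symm
  exact memLp_one_iff_integrable.1 (MemLp.smul (r := 1) (Lp.memLp v) (ψ.memLp (1 - q⁻¹)⁻¹ volume))

theorem recip_eq (p : ℝ≥0∞) : recip p = 1 / p.toReal := by
  rw [recip, ENNReal.toReal_inv, one_div]

/-- The strong `L^p → L^q` bound, for `p > 1`. -/
theorem EllipticPositive.exists_eLpNorm_sinePart_le {P : MvPolynomial (Fin n) ℝ}
    (hP : EllipticPositive P m) {p q : ℝ≥0∞} [Fact (1 ≤ p)] (hp1 : 1 < p) (hp2 : p ≤ 2)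
    (hq2 : 2 ≤ q) (hq' : q ≠ ⊤) (hpq : recip p - recip q ≤ (m : ℝ) / (2 * n)) :
    ∃ C : ℝ, 0 < C ∧
      ∀ t : ℝ, ∀ u : Lp ℂ p (volume : Measure (EuclideanSpace ℝ (Fin n))),
        ∃ v : EuclideanSpace ℝ (Fin n) → ℂ,
          IsGivenBy (sinePart P t (Lp.toTemperedDistribution u)) v ∧
          eLpNorm v q volume ≤ ENNReal.ofReal
              (C * |t| ^ ((n : ℝ) / ((m : ℝ) / 2) * (recip q - recip p) + 1) * ‖u‖) ∧
          eLpNorm v q volume ≤ ENNReal.ofReal (C * ‖u‖) := by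
  have hn : (0 : ℝ) < n := by have := hP.two_le_dim; exact_mod_cast (by omega : 0 < n)
  have hm : (0 : ℝ) < m := by have := hP.four_le_order; exact_mod_cast (by omega : 0 < m)
  have : NeZero n := ⟨by have := hP.two_le_dim; omega⟩
  have : Fact (1 ≤ q) := ⟨le_trans (by norm_num) hq2⟩
  have hpt : p ≠ ⊤ := (hp2.trans_lt (by norm_num)).ne
  -- Chosen so that `κ m / 2 = n (1/p - 1/q)`, the decay required by the multiplier theorem; `κ ≤ 1`
  -- is the inequality of the side `EF`, and `1 - κ` is the power of `|t|` in the claim.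
  set κ : ℝ := 2 * n / m * (recip p - recip q) with hκ
  have hrp : 1 / 2 ≤ recip p := by
    have h1 : 1 < p.toReal := by simpa using (ENNReal.toReal_lt_toReal (by simp) hpt).2 hp1
    rw [recip_eq]
    exact one_div_le_one_div_of_le (by linarith) (by simpa using ENNReal.toReal_mono (by simp) hp2)
  have hrq : recip q ≤ 1 / 2 := by
    rw [recip_eq]
    exact one_div_le_one_div_of_le (by linarith) (by simpa using ENNReal.toReal_mono hq' hq2)
  have hκ0 : 0 ≤ κ := mul_nonneg (by positivity) (by linarith)
  have hκ1 : κ ≤ 1 := by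
    calc κ ≤ 2 * n / m * (m / (2 * n)) := by rw [hκ]; gcongr
      _ = 1 := by field_simp
  obtain ⟨C₁, hC₁, hsym⟩ := hP.exists_sineSymbol_le hκ0 hκ1
  obtain ⟨C₂, hC₂, hmult⟩ := exists_eLpNorm_fourierMultiplier_le
    (E := EuclideanSpace ℝ (Fin n)) hp1 hp2 hq2 hq'
  have hexp : ∀ ξ : EuclideanSpace ℝ (Fin n), (1 + ‖ξ‖ ^ 2) ^ (-(κ * m / 4)) = (1 + ‖ξ‖ ^ 2) ^
      (-((Module.finrank ℝ (EuclideanSpace ℝ (Fin n)) : ℝ) *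
        (1 / p.toReal - 1 / q.toReal)) / 2) := by
    intro ξ
    rw [finrank_euclideanSpace_fin, ← recip_eq, ← recip_eq, hκ]
    congr 1; field_simp; ring
  refine ⟨C₂ * C₁, by positivity, fun t u => ?_⟩
  have hg := hP.hasTemperateGrowth_sineSymbol t
  have hte : (n : ℝ) / ((m : ℝ) / 2) * (recip q - recip p) + 1 = 1 - κ := by
    rw [hκ]; field_simp; ring
  rw [hte]
  have bound : ∀ B : ℝ, 0 ≤ B → (∀ ξ : EuclideanSpace ℝ (Fin n),
      |sineSymbol P t ((2 * Real.pi) • ξ)| ≤ B * (1 + ‖ξ‖ ^ 2) ^ (-(κ * m / 4))) →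
      ∃ v : Lp ℂ q (volume : Measure (EuclideanSpace ℝ (Fin n))),
        sinePart P t (Lp.toTemperedDistribution u) = Lp.toTemperedDistribution v ∧
          ‖v‖ ≤ C₂ * B * ‖u‖ := by
    intro B hB hBξ
    refine exists_fourierMultiplier_Lp hpt hg (by positivity) (hmult _ B hg hB fun ξ => ?_) u
    rw [← hexp, Complex.norm_real, Real.norm_eq_abs]
    exact hBξ ξ
  have conv : ∀ (v : Lp ℂ q (volume : Measure (EuclideanSpace ℝ (Fin n)))) (K : ℝ), ‖v‖ ≤ K →
      eLpNorm v q volume ≤ ENNReal.ofReal K := by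
    intro v K hv
    rw [Lp.norm_def] at hv
    exact ENNReal.le_ofReal_iff_toReal_le (Lp.eLpNorm_ne_top v)
      (ENNReal.toReal_nonneg.trans hv) |>.2 hv
  obtain ⟨v₁, hv₁, hn₁⟩ := bound (C₁ * |t| ^ (1 - κ)) (by positivity) fun ξ => (hsym t ξ).1
  obtain ⟨v₂, hv₂, hn₂⟩ := bound C₁ hC₁.le fun ξ => (hsym t ξ).2
  -- The two bounds come from two extensions; they represent the same distribution, hence are the
  -- same element of `L^q`.
  have hinj : v₁ = v₂ := by
    have h := Lp.ker_toTemperedDistributionCLM_eq_bot (F := ℂ) (p := q)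
      (μ := (volume : Measure (EuclideanSpace ℝ (Fin n))))
    rw [LinearMap.ker_eq_bot] at h
    exact h (hv₁.symm.trans hv₂)
  refine ⟨v₁, by rw [hv₁]; exact isGivenBy_toTemperedDistribution v₁, conv _ _ ?_, conv _ _ ?_⟩
  · rwa [mul_assoc C₂]
  · rwa [hinj]

end Interior

end HigherOrderWave

namespace HigherOrderWave

/-! ### Uniform smoothness of wave packets and decay of their transforms. -/

section WavePackets

open Set Metric

variable {E : Type*} [NormedAddCommGroup E] [InnerProductSpace ℝ E]

theorem norm_iteratedFDeriv_mul_le_two_pow {f g : E → ℂ} (hf : ContDiff ℝ ∞ f) (hg : ContDiff ℝ ∞ g)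
    {K : ℕ} {A B : ℝ} {x : E} (hA : 0 ≤ A) (hfA : ∀ k ≤ K, ‖iteratedFDeriv ℝ k f x‖ ≤ A)
    (hgB : ∀ k ≤ K, ‖iteratedFDeriv ℝ k g x‖ ≤ B) :
    ∀ k ≤ K, ‖iteratedFDeriv ℝ k (fun y => f y * g y) x‖ ≤ 2 ^ K * A * B := by
  intro k hk
  have hB : 0 ≤ B := (norm_nonneg _).trans (hgB 0 (zero_le))
  refine (norm_iteratedFDeriv_mul_le hf hg x (by exact_mod_cast le_top)).trans ?_
  calc _ ≤ ∑ i ∈ Finset.range (k + 1), (k.choose i : ℝ) * A * B := by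
        gcongr with i hi
        · exact hfA i (by have := Finset.mem_range.1 hi; omega)
        · exact hgB _ (by omega)
    _ = 2 ^ k * A * B := by
        rw [← Finset.sum_mul, ← Finset.sum_mul, ← Nat.cast_sum, Nat.sum_range_choose]
        push_cast; ring
    _ ≤ _ := by gcongr; norm_num

theorem norm_iteratedFDeriv_affine_le {F : Type*} [NormedAddCommGroup F] [NormedSpace ℝ F]
    {f : E → F} (hf : ContDiff ℝ ∞ f) (ζ : E) {τ : ℝ} (hτ : 0 ≤ τ) (k : ℕ) (σ : E) :
    ‖iteratedFDeriv ℝ k (fun σ => f (ζ + τ • σ)) σ‖ = τ ^ k * ‖iteratedFDeriv ℝ k f (ζ + τ • σ)‖ := by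
  have h1 : ContDiff ℝ k (fun z => f (ζ + z)) :=
    (hf.of_le (by exact_mod_cast le_top)).comp (contDiff_const.add contDiff_id)
  have h2 := congrFun (iteratedFDeriv_comp_const_smul (i := k) τ h1) σ
  rw [h2, norm_smul, iteratedFDeriv_comp_add_left, norm_pow, Real.norm_of_nonneg hτ]

theorem contDiff_cexp_I : ContDiff ℝ ∞ (fun y : ℝ => Complex.exp (y * Complex.I)) :=
  (Complex.ofRealCLM.contDiff.mul contDiff_const).cexp

theorem norm_iteratedFDeriv_cexp_I (k : ℕ) (y : ℝ) :
    ‖iteratedFDeriv ℝ k (fun y : ℝ => Complex.exp (y * Complex.I)) y‖ = 1 := by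
  rw [norm_iteratedFDeriv_eq_norm_iteratedDeriv]
  have : ∀ k : ℕ, iteratedDeriv k (fun y : ℝ => Complex.exp (y * Complex.I)) =
      fun y : ℝ => Complex.I ^ k * Complex.exp (y * Complex.I) := by
    intro k
    induction k with
    | zero => ext; simp
    | succ k ih =>
      rw [iteratedDeriv_succ, ih]
      ext y
      have h1 : HasDerivAt (fun y : ℝ => Complex.exp (y * Complex.I))
          (Complex.exp (y * Complex.I) * (1 * Complex.I)) y :=
        ((Complex.ofRealCLM.hasDerivAt (x := y)).mul_const Complex.I).cexp
      rw [(h1.const_mul (Complex.I ^ k)).deriv, pow_succ]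
      ring
  rw [this]
  simp [Complex.norm_exp]

/-- The wave packet at `ζ`: the amplitude `a` and the phase `τ⁻² φ`, with the linear part of the
phase at `ζ` removed, in the variable `η = ζ + τ σ` and cut off by `θ (σ)`. -/
noncomputable def packet (φ : E → ℝ) (a : E → ℂ) (θ : E → ℝ) (ζ : E) (τ : ℝ) (σ : E) : ℂ :=
  a (ζ + τ • σ) * (θ σ : ℂ) *
    Complex.exp (((τ⁻¹ ^ 2 * (φ (ζ + τ • σ) - τ * fderiv ℝ φ ζ σ) : ℝ) : ℂ) * Complex.I)

variable {φ : E → ℝ} {a : E → ℂ} {θ : E → ℝ}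

theorem contDiff_packet (hφ : ContDiff ℝ ∞ φ) (ha : ContDiff ℝ ∞ a) (hθ : ContDiff ℝ ∞ θ)
    (ζ : E) (τ : ℝ) : ContDiff ℝ ∞ (packet φ a θ ζ τ) := by
  have h1 : ContDiff ℝ ∞ (fun σ : E => ζ + τ • σ) := by fun_prop
  have h2 := hφ.comp h1
  refine ((ha.comp h1).mul (Complex.ofRealCLM.contDiff.comp hθ)).mul (contDiff_cexp_I.comp ?_)
  exact contDiff_const.mul (h2.sub (contDiff_const.mul (fderiv ℝ φ ζ).contDiff))

theorem tsupport_packet_subset (hθs : tsupport θ ⊆ closedBall 0 1) (ζ : E) (τ : ℝ) :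
    tsupport (packet φ a θ ζ τ) ⊆ closedBall 0 1 := by
  refine (closure_mono fun σ hσ => ?_).trans hθs
  rw [Function.mem_support] at hσ ⊢
  contrapose! hσ
  simp [packet, hσ]

theorem mem_shell_of_mem {ζ : E} (h1 : 1 / 4 ≤ ‖ζ‖) (h2 : ‖ζ‖ ≤ 4) {z : E} (hz : ‖z‖ ≤ 1 / 8) :
    1 / 8 ≤ ‖ζ + z‖ ∧ ‖ζ + z‖ ≤ 8 := by
  constructor
  · have := norm_sub_norm_le ζ (-z)
    rw [sub_neg_eq_add, norm_neg] at this
    linarith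
  · have := norm_add_le ζ z
    linarith

theorem norm_fderiv_sub_le_of_shell {G : Type*} [NormedAddCommGroup G] [NormedSpace ℝ G]
    {φ : E → G} (hφ : ContDiff ℝ ∞ φ) {A : ℝ}
    (hA : ∀ η : E, 1 / 8 ≤ ‖η‖ → ‖η‖ ≤ 8 → ‖iteratedFDeriv ℝ 2 φ η‖ ≤ A)
    {ζ : E} (h1 : 1 / 4 ≤ ‖ζ‖) (h2 : ‖ζ‖ ≤ 4) {z : E} (hz : ‖z‖ ≤ 1 / 8) :
    ‖fderiv ℝ φ (ζ + z) - fderiv ℝ φ ζ‖ ≤ A * ‖z‖ := by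
  have hd : Differentiable ℝ (fderiv ℝ φ) :=
    (hφ.fderiv_right (m := ∞) (by simp)).differentiable (by simp)
  have h := (convex_closedBall ζ (1 / 8)).norm_image_sub_le_of_norm_fderiv_le (𝕜 := ℝ)
    (f := fderiv ℝ φ) (C := A) (fun x _ => hd x) (fun x hx => ?_)
    (x := ζ) (y := ζ + z) (mem_closedBall_self (by norm_num)) (by simpa using hz)
  · simpa using h
  · have hx' : ‖x - ζ‖ ≤ 1 / 8 := by simpa [dist_eq_norm] using hx
    have hm := mem_shell_of_mem h1 h2 hx'
    rw [add_sub_cancel] at hm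
    rw [← norm_iteratedFDeriv_one, norm_iteratedFDeriv_fderiv]
    exact hA x hm.1 hm.2

/-- The point is uniformity in `τ`. Once the linear part is removed, the gradient of the phase is
`τ⁻¹ (∇φ(ζ + τσ) - ∇φ(ζ))`, bounded by the second derivatives of `φ` since `‖σ‖ ≤ 1`, and every
further derivative brings a factor `τ`. The constant `τ⁻² φ(ζ)`, large as it may be, affects only
the unimodular factor. The bound `τ ≤ 1/8` keeps `ζ + τσ` where the derivatives of `φ` are
controlled. -/
theorem exists_norm_iteratedFDeriv_packet_le (K : ℕ) (A : ℝ) (hA1 : 1 ≤ A) :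
    ∃ C : ℝ, 0 < C ∧ ∀ (φ : E → ℝ) (a : E → ℂ) (θ : E → ℝ), ContDiff ℝ ∞ φ → ContDiff ℝ ∞ a →
      ContDiff ℝ ∞ θ → tsupport θ ⊆ closedBall 0 1 →
      (∀ k ≤ K + 2, ∀ η : E, 1 / 8 ≤ ‖η‖ → ‖η‖ ≤ 8 → ‖iteratedFDeriv ℝ k φ η‖ ≤ A) →
      (∀ k ≤ K, ∀ η : E, ‖iteratedFDeriv ℝ k a η‖ ≤ A) →
      (∀ k ≤ K, ∀ σ : E, ‖iteratedFDeriv ℝ k (fun σ => (θ σ : ℂ)) σ‖ ≤ A) →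
      ∀ (ζ : E) (τ : ℝ), 1 / 4 ≤ ‖ζ‖ → ‖ζ‖ ≤ 4 → 0 < τ → τ ≤ 1 / 8 →
      ∀ k ≤ K, ∀ σ : E, ‖iteratedFDeriv ℝ k (packet φ a θ ζ τ) σ‖ ≤ C := by
  refine ⟨2 ^ K * (2 ^ K * A * A) * (K.factorial * 1 * A ^ K), by positivity, ?_⟩
  intro φ a θ hφ ha hθ hθs hφA haA hθA ζ τ hζ1 hζ2 hτ0 hτ1 k hk σ
  have hA0 : 0 ≤ A := by linarith
  by_cases hσ : ‖σ‖ ≤ 1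
  swap
  · have : iteratedFDeriv ℝ k (packet φ a θ ζ τ) σ = 0 := by
      by_contra h
      have := tsupport_packet_subset hθs ζ τ (support_iteratedFDeriv_subset k h)
      exact hσ (by simpa using this)
    rw [this, norm_zero]; positivity
  have hτσ : ∀ σ : E, ‖σ‖ ≤ 1 → ‖τ • σ‖ ≤ 1 / 8 := fun σ hσ => by
    rw [norm_smul, Real.norm_of_nonneg hτ0.le]; nlinarith [norm_nonneg σ]
  have hsh := mem_shell_of_mem hζ1 hζ2 (hτσ σ hσ)
  have haff : ContDiff ℝ ∞ (fun σ : E => ζ + τ • σ) := by fun_prop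
  set Ψ : E → ℝ := fun σ => τ⁻¹ ^ 2 * (φ (ζ + τ • σ) - τ * fderiv ℝ φ ζ σ) with hΨ
  have hΨs : ContDiff ℝ ∞ Ψ :=
    contDiff_const.mul ((hφ.comp haff).sub (contDiff_const.mul (fderiv ℝ φ ζ).contDiff))
  have hdφ : ContDiff ℝ ∞ (fderiv ℝ φ) := hφ.fderiv_right (m := ∞) (by simp)
  have hΨ' : fderiv ℝ Ψ = fun σ => τ⁻¹ • (fderiv ℝ φ (ζ + τ • σ) - fderiv ℝ φ ζ) := by
    funext σ
    have h1 : HasFDerivAt (fun σ : E => ζ + τ • σ) (τ • ContinuousLinearMap.id ℝ E) σ :=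
      ((ContinuousLinearMap.id ℝ E).hasFDerivAt.const_smul τ).const_add ζ
    have h2 := ((hφ.differentiable (by simp)) (ζ + τ • σ)).hasFDerivAt.comp σ h1
    have h3 := (h2.sub (((fderiv ℝ φ ζ).hasFDerivAt (x := σ)).const_mul τ)).const_mul (τ⁻¹ ^ 2)
    refine (HasFDerivAt.fderiv h3).trans ?_
    ext v
    simp
    field_simp
  have hD : ∀ i, 1 ≤ i → i ≤ k → ‖iteratedFDeriv ℝ i Ψ σ‖ ≤ A ^ i := by
    intro i hi hik
    refine le_trans ?_ (le_self_pow₀ hA1 (by omega))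
    obtain ⟨j, rfl⟩ : ∃ j, i = j + 1 := ⟨i - 1, by omega⟩
    rw [← norm_iteratedFDeriv_fderiv, hΨ']
    have hg : ContDiff ℝ ∞ (fun σ => fderiv ℝ φ (ζ + τ • σ)) := hdφ.comp haff
    rw [iteratedFDeriv_const_smul_apply' ((hg.sub contDiff_const).contDiffAt.of_le
      (by exact_mod_cast le_top)), norm_smul, norm_inv, Real.norm_of_nonneg hτ0.le,
      inv_mul_le_iff₀ hτ0]
    rcases Nat.eq_zero_or_pos j with rfl | hj
    · rw [norm_iteratedFDeriv_zero]
      refine (norm_fderiv_sub_le_of_shell hφ (hφA 2 (by omega)) hζ1 hζ2 (hτσ σ hσ)).trans ?_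
      rw [norm_smul, Real.norm_of_nonneg hτ0.le]
      have : τ * ‖σ‖ ≤ τ := by nlinarith
      nlinarith
    · rw [fun_iteratedFDeriv_sub_apply (hg.contDiffAt.of_le (by exact_mod_cast le_top))
        contDiffAt_const, iteratedFDeriv_const_of_ne (by omega)]
      rw [Pi.zero_apply, sub_zero, norm_iteratedFDeriv_affine_le hdφ ζ hτ0.le,
        norm_iteratedFDeriv_fderiv]
      have h1 : τ ^ j ≤ τ := pow_le_of_le_one hτ0.le (by linarith) (by omega)
      have h2 := hφA (j + 1) (by omega) _ hsh.1 hsh.2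
      gcongr
  have hexp : ∀ i ≤ K, i ≤ k → ‖iteratedFDeriv ℝ i
      (fun σ => Complex.exp ((Ψ σ : ℂ) * Complex.I)) σ‖ ≤ K.factorial * 1 * A ^ K := by
    intro i hi hik
    refine (norm_iteratedFDeriv_comp_le contDiff_cexp_I hΨs (n := i) (by exact_mod_cast le_top) σ
      (C := 1) (D := A) (fun l _ => (norm_iteratedFDeriv_cexp_I l _).le)
      (fun l hl hli => hD l hl (hli.trans hik))).trans ?_
    have := Nat.factorial_le hi
    gcongr
  have ha' : ∀ i ≤ K, ‖iteratedFDeriv ℝ i (fun σ => a (ζ + τ • σ)) σ‖ ≤ A := by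
    intro i hi
    rw [norm_iteratedFDeriv_affine_le ha ζ hτ0.le]
    calc _ ≤ 1 * A := by
          gcongr
          · exact pow_le_one₀ hτ0.le (by linarith)
          · exact haA i hi _
      _ = A := one_mul A
  have h12 := norm_iteratedFDeriv_mul_le_two_pow (ha.comp haff)
    (Complex.ofRealCLM.contDiff.comp hθ) hA0 ha' (fun i hi => hθA i hi σ)
  have h123 := norm_iteratedFDeriv_mul_le_two_pow (K := k)
    ((ha.comp haff).mul (Complex.ofRealCLM.contDiff.comp hθ)) (contDiff_cexp_I.comp hΨs)
    (by positivity) (fun i hi => h12 i (hi.trans hk)) (fun i hi => hexp i (hi.trans hk) hi) k le_rfl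
  refine h123.trans ?_
  gcongr
  norm_num

variable [FiniteDimensional ℝ E] [MeasurableSpace E] [BorelSpace E]

/-- Decay of the Fourier transform of a smooth function supported in the unit ball. -/
theorem exists_norm_fourierInv_le (N : ℕ) :
    ∃ C : ℝ, 0 < C ∧ ∀ (b : E → ℂ) (B : ℝ), ContDiff ℝ ∞ b → tsupport b ⊆ closedBall 0 1 →
      (∀ k ≤ N, ∀ σ : E, ‖iteratedFDeriv ℝ k b σ‖ ≤ B) →
      ∀ x, ‖𝓕⁻ b x‖ ≤ C * B * ((1 + ‖x‖) ^ N)⁻¹ := by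
  set V := (volume : Measure E).real (closedBall 0 1) with hV
  have hV0 : 0 ≤ V := measureReal_nonneg
  refine ⟨2 ^ N * (V + 2 ^ N * ((N + 1) * V)) + 1, by positivity, fun b B hb hbs hB x => ?_⟩
  have hB0 : 0 ≤ B := (norm_nonneg _).trans (hB 0 zero_le 0)
  have hcs : HasCompactSupport b := (isCompact_closedBall 0 1).of_isClosed_subset
    (isClosed_tsupport _) hbs
  have hint : ∀ k ≤ N, ∫ v, ‖iteratedFDeriv ℝ k b v‖ ≤ V * B := by
    intro k hk
    rw [← setIntegral_eq_integral_of_forall_compl_eq_zero (s := closedBall 0 1)]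
    · have := norm_setIntegral_le_of_norm_le_const (μ := volume) (s := closedBall (0 : E) 1)
        (f := fun v => ‖iteratedFDeriv ℝ k b v‖) (C := B) measure_closedBall_lt_top
        (fun v _ => by rw [norm_norm]; exact hB k hk v)
      rw [mul_comm]
      exact (Real.le_norm_self _).trans this
    · intro v hv
      rw [norm_eq_zero]
      by_contra h
      exact hv (hbs (support_iteratedFDeriv_subset k h))
  rw [Real.fourierInv_eq_fourier_neg, ← norm_neg x]
  set w := -x
  have h0 : ‖𝓕 b w‖ ≤ V * B := by
    refine (VectorFourier.norm_fourierIntegral_le_integral_norm _ _ _ _ _).trans ?_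
    simpa using hint 0 zero_le
  have hN : ‖w‖ ^ N * ‖𝓕 b w‖ ≤ 2 ^ N * ((N + 1) * V) * B := by
    have h := Real.pow_mul_norm_iteratedFDeriv_fourier_le (K := 0) (N := (⊤ : ℕ∞)) (f := b) hb
      (fun k n hk _ => by
        have hk : k = 0 := by simpa using hk
        subst hk
        simp only [pow_zero, one_mul]
        exact ((hb.continuous_iteratedFDeriv (by exact_mod_cast le_top)).norm.integrable_of_hasCompactSupport
          (hcs.iteratedFDeriv n).norm)) (k := 0) (n := N) (by simp) le_top w
    simp only [norm_iteratedFDeriv_zero, pow_zero, one_mul, zero_add, Finset.range_one,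
      Finset.sum_product, Finset.sum_singleton, Nat.cast_zero, mul_zero] at h
    refine h.trans ?_
    rw [mul_assoc]
    gcongr
    calc _ ≤ ∑ k ∈ Finset.range (N + 1), V * B := by
          refine Finset.sum_le_sum fun k hk => hint k ?_
          have := Finset.mem_range.1 hk; omega
      _ = _ := by simp; ring
  rw [← div_eq_mul_inv, le_div_iff₀ (by positivity)]
  have hpow : (1 + ‖w‖) ^ N ≤ 2 ^ N * (1 + ‖w‖ ^ N) := by
    rcases le_total ‖w‖ 1 with h | h
    · calc (1 + ‖w‖) ^ N ≤ 2 ^ N := by gcongr; linarith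
        _ ≤ _ := le_mul_of_one_le_right (by positivity) (by
            have : 0 ≤ ‖w‖ ^ N := by positivity
            linarith)
    · calc (1 + ‖w‖) ^ N ≤ (2 * ‖w‖) ^ N := by gcongr; linarith
        _ = 2 ^ N * ‖w‖ ^ N := by rw [mul_pow]
        _ ≤ _ := by gcongr; linarith
  calc ‖𝓕 b w‖ * (1 + ‖w‖) ^ N ≤ ‖𝓕 b w‖ * (2 ^ N * (1 + ‖w‖ ^ N)) := by gcongr
    _ = 2 ^ N * (‖𝓕 b w‖ + ‖w‖ ^ N * ‖𝓕 b w‖) := by ring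
    _ ≤ 2 ^ N * (V * B + 2 ^ N * ((N + 1) * V) * B) := by gcongr
    _ = 2 ^ N * (V + 2 ^ N * ((N + 1) * V)) * B := by ring
    _ ≤ _ := by gcongr; linarith

end WavePackets

end HigherOrderWave

namespace HigherOrderWave

/-! ### Integrals of decaying functions of an expansive map. -/

section Expansive

open Set Metric

/-- The closed spherical shell `1/4 ≤ ‖ζ‖ ≤ 4`. -/
def shell (E : Type*) [NormedAddCommGroup E] : Set E := {ζ | 1 / 4 ≤ ‖ζ‖ ∧ ‖ζ‖ ≤ 4}

theorem measurableSet_shell {E : Type*} [NormedAddCommGroup E] [MeasurableSpace E]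
    [OpensMeasurableSpace E] : MeasurableSet (shell E) :=
  (measurableSet_le measurable_const measurable_norm).inter
    (measurableSet_le measurable_norm measurable_const)

theorem shell_subset {E : Type*} [NormedAddCommGroup E] : shell E ⊆ closedBall 0 4 := fun ζ hζ => by simpa using hζ.2

variable {E G : Type*} [NormedAddCommGroup E] [InnerProductSpace ℝ E] [FiniteDimensional ℝ E]
  [MeasurableSpace E] [BorelSpace E] [NormedAddCommGroup G] [NormedSpace ℝ G]

local notation "dim" => Module.finrank ℝ E

/-- A quantitative inverse function argument: on a ball of radius at most `ε / (4A)` the derivative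
varies by at most `ε / 2`, so `F` keeps half of the expansion of its linearisation at `ζ₀`. -/
theorem le_norm_sub_of_mem_ball {F : E → G} (hF : Differentiable ℝ F) {ρ ε A : ℝ}
    {w ζ₀ : E} (hζ₀ : ζ₀ ∈ closedBall w ρ) (hε : ∀ v, ε * ‖v‖ ≤ ‖fderiv ℝ F ζ₀ v‖)
    (hA : ∀ z ∈ closedBall w ρ, ‖fderiv ℝ F z - fderiv ℝ F ζ₀‖ ≤ A * ‖z - ζ₀‖)
    (hA0 : 0 ≤ A) (hρ : 4 * A * ρ ≤ ε) {ζ ζ' : E} (h : ζ ∈ closedBall w ρ)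
    (h' : ζ' ∈ closedBall w ρ) : ε / 2 * ‖ζ - ζ'‖ ≤ ‖F ζ - F ζ'‖ := by
  have h1 := (convex_closedBall w ρ).norm_image_sub_le_of_norm_fderiv_le' (𝕜 := ℝ)
    (f := F) (φ := fderiv ℝ F ζ₀) (C := A * (2 * ρ)) (fun x _ => hF x) (fun z hz => (hA z hz).trans
      (by
        gcongr
        have h1 := mem_closedBall_iff_norm.1 hz
        have h2 := mem_closedBall_iff_norm'.1 hζ₀
        have := norm_add_le (z - w) (w - ζ₀)
        rw [sub_add_sub_cancel] at this
        linarith)) h' h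
  have h2 := hε (ζ - ζ')
  have h3 := norm_sub_norm_le (fderiv ℝ F ζ₀ (ζ - ζ')) (F ζ - F ζ')
  rw [norm_sub_rev (fderiv ℝ F ζ₀ (ζ - ζ'))] at h3
  have h4 : A * (2 * ρ) * ‖ζ - ζ'‖ ≤ ε / 2 * ‖ζ - ζ'‖ := by gcongr; linarith
  linarith

/-- An integral over the region where a map is expansive. -/
theorem exists_setLIntegral_inv_one_add_pow_le (A : ℝ) (hA1 : 1 ≤ A) :
    ∃ C : ℝ, 0 < C ∧ ∀ (F : E → G), ContDiff ℝ 1 F →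
      (∀ ζ ∈ shell E, ∀ z, ‖z‖ ≤ 1 / 8 → ‖fderiv ℝ F (ζ + z) - fderiv ℝ F ζ‖ ≤ A * ‖z‖) →
      ∀ (ε : ℝ) (S : Set E), 0 < ε → ε ≤ 1 → MeasurableSet S → S ⊆ shell E →
      (∀ ζ ∈ S, ∀ v, ε * ‖v‖ ≤ ‖fderiv ℝ F ζ v‖) → ∀ (μ : ℝ) (y : G), 0 < μ →
      ∫⁻ ζ in S, ENNReal.ofReal (((1 + μ * ‖F ζ - y‖) ^ (dim + 1))⁻¹) ≤
        ENNReal.ofReal (C * (ε ^ (2 * dim) * μ ^ dim)⁻¹) := by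
  set h : E → ℝ := fun z => ((1 + ‖z‖) ^ (dim + 1))⁻¹ with hh
  have hint : Integrable h := by
    have := integrable_one_add_norm (E := E) (μ := volume) (r := dim + 1) (by simp)
    refine this.congr (.of_forall fun z => ?_)
    rw [hh]
    simp only
    rw [Real.rpow_neg (by positivity), ← Nat.cast_add_one, Real.rpow_natCast]
  set J := ∫ z, h z with hJ
  have hJ0 : 0 ≤ J := integral_nonneg fun z => by positivity
  refine ⟨(5 * 16 * A * 4) ^ dim * J + 1, by positivity, ?_⟩
  intro F hF hF2 ε S hε0 hε1 hS hSs hSε μ y hμ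
  -- On a ball of radius `ρ` that meets `S` the map is expansive, so the ball contributes `O((ε
  -- μ)^{-dim})`; about `ρ^{-dim}` balls, hence another `ε^{-dim}`, cover the shell. Instead of
  -- choosing a covering, the proof averages over all centres `w`.
  set ρ := ε / (16 * A) with hρ
  have hρ0 : 0 < ρ := by positivity
  have hρ1 : ρ ≤ 1 / 16 := by rw [hρ, div_le_iff₀ (by positivity)]; linarith
  set G' : E → ℝ≥0∞ := fun ζ => ENNReal.ofReal (((1 + μ * ‖F ζ - y‖) ^ (dim + 1))⁻¹) with hG'
  have hFc := hF.continuous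
  have hGm : Measurable G' := by
    refine ENNReal.measurable_ofReal.comp (Continuous.measurable ?_)
    refine Continuous.inv₀ (by fun_prop) fun ζ => by positivity
  set c := μ * (ε / 4) with hc
  have hc0 : 0 < c := by positivity
  have hscale : ∀ ζ₁ : E, ∫⁻ ζ, ENNReal.ofReal (h (c • (ζ - ζ₁))) =
      ENNReal.ofReal ((c ^ dim)⁻¹ * J) := by
    intro ζ₁
    rw [← ofReal_integral_eq_lintegral_ofReal]
    · rw [integral_sub_right_eq_self (fun ζ => h (c • ζ)) ζ₁, Measure.integral_comp_smul,
        abs_of_pos (by positivity), smul_eq_mul]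
    · exact ((hint.comp_smul hc0.ne').comp_sub_right ζ₁)
    · exact .of_forall fun z => by simp only [hh]; positivity
  have hball : ∀ w : E, ∫⁻ ζ in S ∩ closedBall w ρ, G' ζ ≤
      ENNReal.ofReal ((c ^ dim)⁻¹ * J) := by
    intro w
    rcases (S ∩ closedBall w ρ).eq_empty_or_nonempty with he | ⟨ζ₀, hζ₀⟩
    · rw [he]; simp
    have hexp : ∀ ζ ∈ closedBall w ρ, ∀ ζ' ∈ closedBall w ρ,
        ε / 2 * ‖ζ - ζ'‖ ≤ ‖F ζ - F ζ'‖ := by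
      intro ζ hζ ζ' hζ'
      refine le_norm_sub_of_mem_ball (hF.differentiable (by simp)) hζ₀.2 (hSε ζ₀ hζ₀.1)
        (A := A) (fun z hz => ?_) (by linarith) ?_ hζ hζ'
      · have := hF2 ζ₀ (hSs hζ₀.1) (z - ζ₀) (by
          have h1 := mem_closedBall_iff_norm.1 hz
          have h2 := mem_closedBall_iff_norm'.1 hζ₀.2
          have := norm_add_le (z - w) (w - ζ₀)
          rw [sub_add_sub_cancel] at this
          linarith)
        rwa [add_sub_cancel] at this
      · rw [hρ]; field_simp; norm_num
    -- `y` need not be a value of `F`, so the nearest value takes its place: `‖F ζ - F ζ₁‖ ≤ 2 ‖F ζ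
    -- - y‖`. This turns `ε / 2` into the `ε / 4` in `c`.
    obtain ⟨ζ₁, hζ₁, hmin⟩ := (isCompact_closedBall w ρ).exists_isMinOn ⟨ζ₀, hζ₀.2⟩
      (f := fun ζ => ‖F ζ - y‖) (by fun_prop)
    calc ∫⁻ ζ in S ∩ closedBall w ρ, G' ζ
        ≤ ∫⁻ ζ in S ∩ closedBall w ρ, ENNReal.ofReal (h (c • (ζ - ζ₁))) := by
          refine setLIntegral_mono' (hS.inter measurableSet_closedBall) fun ζ hζ => ?_
          refine ENNReal.ofReal_le_ofReal ?_
          simp only [hh]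
          rw [norm_smul, Real.norm_of_nonneg hc0.le, hc, mul_assoc]
          gcongr
          have h1 := hexp ζ hζ.2 ζ₁ hζ₁
          have h2 : ‖F ζ₁ - y‖ ≤ ‖F ζ - y‖ := hmin hζ.2
          have h3 := norm_sub_le (F ζ - y) (F ζ₁ - y)
          rw [sub_sub_sub_cancel_right] at h3
          linarith
      _ ≤ ∫⁻ ζ, ENNReal.ofReal (h (c • (ζ - ζ₁))) := setLIntegral_le_lintegral _ _
      _ = _ := hscale ζ₁
  have hV : volume (closedBall (0 : E) 1) ≠ ⊤ := measure_closedBall_lt_top.ne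
  set V := volume (closedBall (0 : E) 1)
  have hV0 : V ≠ 0 := (measure_closedBall_pos _ _ one_pos).ne'
  have hvol : ∀ (x : E) (r : ℝ), 0 ≤ r → volume (closedBall x r) = ENNReal.ofReal (r ^ dim) * V :=
    fun x r hr => Measure.addHaar_closedBall' _ _ hr
  -- Tonelli: each `ζ` lies in the balls whose centres fill `closedBall ζ ρ`.
  have hTon : (∫⁻ ζ in S, G' ζ) * (ENNReal.ofReal (ρ ^ dim) * V) =
      ∫⁻ w, ∫⁻ ζ in S ∩ closedBall w ρ, G' ζ := by
    have e1 : ∀ w, ∫⁻ ζ in S ∩ closedBall w ρ, G' ζ =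
        ∫⁻ ζ in S, (closedBall ζ ρ).indicator (fun _ => G' ζ) w := by
      intro w
      rw [inter_comm, ← Measure.restrict_restrict measurableSet_closedBall,
        ← lintegral_indicator measurableSet_closedBall]
      congr 1; ext ζ
      simp only [indicator, mem_closedBall, dist_comm]
    simp_rw [e1]
    rw [lintegral_lintegral_swap]
    · rw [← lintegral_mul_const _ hGm]
      refine lintegral_congr fun ζ => ?_
      rw [lintegral_indicator measurableSet_closedBall, setLIntegral_const, hvol _ _ hρ0.le]
    · have : (Function.uncurry fun (w ζ : E) => (closedBall ζ ρ).indicator (fun _ => G' ζ) w) =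
          {z : E × E | dist z.1 z.2 ≤ ρ}.indicator (fun z => G' z.2) := by
        ext ⟨w, ζ⟩; simp [Function.uncurry, indicator]
      rw [this]
      exact ((hGm.comp measurable_snd).indicator
        (measurableSet_le (continuous_dist.measurable) measurable_const)).aemeasurable
  have hle : ∫⁻ w, ∫⁻ ζ in S ∩ closedBall w ρ, G' ζ ≤
      ENNReal.ofReal ((c ^ dim)⁻¹ * J) * (ENNReal.ofReal (5 ^ dim) * V) := by
    rw [← hvol 0 5 (by norm_num), ← setLIntegral_const,
      ← lintegral_indicator measurableSet_closedBall]
    refine lintegral_mono fun w => ?_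
    by_cases hw : w ∈ closedBall (0 : E) 5
    · rw [indicator_of_mem hw]; exact hball w
    · rw [indicator_of_notMem hw, nonpos_iff_eq_zero]
      have : S ∩ closedBall w ρ = ∅ := by
        refine eq_empty_of_forall_notMem fun ζ hζ => hw ?_
        have h1 := mem_closedBall_iff_norm'.1 hζ.2
        have h2 := (hSs hζ.1).2
        have := norm_add_le (w - ζ) ζ
        rw [sub_add_cancel] at this
        simp only [mem_closedBall, dist_zero_right]
        linarith
      rw [this]; simp
  rw [← hTon, ← mul_assoc, ← mul_assoc, ENNReal.mul_le_mul_iff_left hV0 hV] at hle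
  have hρd : 0 < ρ ^ dim := by positivity
  calc ∫⁻ ζ in S, G' ζ = (∫⁻ ζ in S, G' ζ) * ENNReal.ofReal (ρ ^ dim) *
        ENNReal.ofReal ((ρ ^ dim)⁻¹) := by
        rw [mul_assoc, ← ENNReal.ofReal_mul hρd.le, mul_inv_cancel₀ hρd.ne', ENNReal.ofReal_one,
          mul_one]
    _ ≤ ENNReal.ofReal ((c ^ dim)⁻¹ * J) * ENNReal.ofReal (5 ^ dim) *
        ENNReal.ofReal ((ρ ^ dim)⁻¹) := by gcongr
    _ = ENNReal.ofReal ((5 * 16 * A * 4) ^ dim * J * (ε ^ (2 * dim) * μ ^ dim)⁻¹) := by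
        rw [← ENNReal.ofReal_mul (by positivity), ← ENNReal.ofReal_mul (by positivity)]
        congr 1
        rw [hc, hρ, pow_mul, ← mul_pow, ← inv_pow, ← inv_pow, ← inv_pow]
        rw [mul_right_comm, mul_right_comm _ J, ← mul_pow, mul_right_comm _ J, ← mul_pow,
          mul_right_comm _ J, ← mul_pow]
        congr 2
        field_simp
    _ ≤ _ := by
        gcongr
        linarith

end Expansive

end HigherOrderWave

namespace HigherOrderWave

/-! ### Superposition of packets: dispersive bound off a bad set of frequencies. -/

section PacketDecomposition

open Set Metric

variable {E : Type*} [NormedAddCommGroup E] [InnerProductSpace ℝ E] [FiniteDimensional ℝ E]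
  [MeasurableSpace E] [BorelSpace E]

local notation "dim" => Module.finrank ℝ E

/-- The piece near `ζ` of the oscillating function `a exp (iτ⁻²φ)`. -/
noncomputable def oscPiece (φ : E → ℝ) (a : E → ℂ) (θ : E → ℝ) (τ : ℝ) (ζ η : E) : ℂ :=
  a η * (θ (τ⁻¹ • (η - ζ)) : ℂ) * Complex.exp (((τ⁻¹ ^ 2 * φ η : ℝ) : ℂ) * Complex.I)

/-- Substitution `η = ζ + τσ`. The linear part of the phase becomes a translation on the Fourier
side, and what depends on `ζ` and `x` alone has modulus one. -/
theorem norm_fourierInv_oscPiece (φ : E → ℝ) (a : E → ℂ) (θ : E → ℝ) {τ : ℝ} (hτ : 0 < τ)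
    (ζ x : E) : ‖𝓕⁻ (oscPiece φ a θ τ ζ) x‖ = τ ^ dim * ‖𝓕⁻ (packet φ a θ ζ τ)
      (τ • x + (2 * Real.pi * τ)⁻¹ • (InnerProductSpace.toDual ℝ E).symm (fderiv ℝ φ ζ))‖ := by
  set y := τ • x + (2 * Real.pi * τ)⁻¹ • (InnerProductSpace.toDual ℝ E).symm (fderiv ℝ φ ζ) with hy
  rw [Real.fourierInv_eq', Real.fourierInv_eq']
  set f : E → ℂ := fun v => Complex.exp ((↑(2 * Real.pi * inner ℝ v x) * Complex.I)) •
    oscPiece φ a θ τ ζ v with hf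
  have h1 : ∫ v, f v = (τ ^ dim : ℝ) • ∫ σ, f (ζ + τ • σ) := by
    have := Measure.integral_comp_smul (volume : Measure E) (fun z => f (ζ + z)) τ
    rw [this, integral_add_left_eq_self f ζ, abs_of_pos (by positivity), smul_smul,
      mul_inv_cancel₀ (by positivity), one_smul]
  have h2 : ∀ σ, f (ζ + τ • σ) = Complex.exp ((↑(2 * Real.pi * inner ℝ ζ x) * Complex.I)) *
      (Complex.exp ((↑(2 * Real.pi * inner ℝ σ y) * Complex.I)) • packet φ a θ ζ τ σ) := by
    intro σ
    have e1 : inner ℝ σ y = τ * inner ℝ σ x + (2 * Real.pi * τ)⁻¹ * fderiv ℝ φ ζ σ := by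
      rw [hy, inner_add_right, real_inner_smul_right, real_inner_smul_right,
        real_inner_comm _ σ, real_inner_comm _ σ, InnerProductSpace.toDual_symm_apply]
    simp only [hf, oscPiece, packet, add_sub_cancel_left, smul_smul, inv_mul_cancel₀ hτ.ne',
      one_smul, smul_eq_mul]
    have e2 : Complex.exp (↑(2 * Real.pi * inner ℝ (ζ + τ • σ) x) * Complex.I) *
        Complex.exp (((τ⁻¹ ^ 2 * φ (ζ + τ • σ) : ℝ) : ℂ) * Complex.I) =
        Complex.exp (↑(2 * Real.pi * inner ℝ ζ x) * Complex.I) *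
        Complex.exp (↑(2 * Real.pi * inner ℝ σ y) * Complex.I) *
        Complex.exp (((τ⁻¹ ^ 2 * (φ (ζ + τ • σ) - τ * fderiv ℝ φ ζ σ) : ℝ) : ℂ) * Complex.I) := by
      rw [← Complex.exp_add, ← Complex.exp_add, ← Complex.exp_add, ← add_mul, ← add_mul,
        ← add_mul, ← Complex.ofReal_add, ← Complex.ofReal_add, ← Complex.ofReal_add, e1,
        inner_add_left, real_inner_smul_left]
      congr 3
      have := Real.pi_pos
      field_simp
      ring
    linear_combination (a (ζ + τ • σ) * (θ σ : ℂ)) * e2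
  rw [h1]
  simp_rw [h2]
  rw [integral_const_mul, norm_smul, norm_mul, Complex.norm_exp_ofReal_mul_I, one_mul, norm_pow,
    Real.norm_of_nonneg hτ.le]

/-- The packet at `ζ` contributes at `x` at most a multiple of `(1 + μ |∇φ(ζ) - y|)^{-(dim+1)}`,
with `y` dual to `-2π τ² x` and `μ = (2πτ)⁻¹`. On `S` the map `∇φ` is expansive, so the integral
over `ζ` is `O(ε^{-2 dim} μ^{-dim})`, that is, `τ^dim`: the stationary phase bound, without a
stationary phase expansion. -/
theorem exists_setLIntegral_fourierInv_oscPiece_le (A : ℝ) (hA1 : 1 ≤ A) :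
    ∃ C : ℝ, 0 < C ∧ ∀ (φ : E → ℝ) (a : E → ℂ) (θ : E → ℝ), ContDiff ℝ ∞ φ → ContDiff ℝ ∞ a →
      ContDiff ℝ ∞ θ → tsupport θ ⊆ closedBall 0 1 →
      (∀ k ≤ dim + 3, ∀ η : E, 1 / 8 ≤ ‖η‖ → ‖η‖ ≤ 8 → ‖iteratedFDeriv ℝ k φ η‖ ≤ A) →
      (∀ k ≤ dim + 1, ∀ η : E, ‖iteratedFDeriv ℝ k a η‖ ≤ A) →
      (∀ k ≤ dim + 1, ∀ σ : E, ‖iteratedFDeriv ℝ k (fun σ => (θ σ : ℂ)) σ‖ ≤ A) →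
      ∀ (ε : ℝ) (S : Set E), 0 < ε → ε ≤ 1 → MeasurableSet S → S ⊆ shell E →
      (∀ ζ ∈ S, ∀ v, ε * ‖v‖ ≤ ‖fderiv ℝ (fderiv ℝ φ) ζ v‖) → ∀ τ : ℝ, 0 < τ → τ ≤ 1 / 8 →
      ∀ x, ∫⁻ ζ in S, ‖((τ ^ dim)⁻¹ : ℂ) * 𝓕⁻ (oscPiece φ a θ τ ζ) x‖ₑ ≤
        ENNReal.ofReal (C * (ε ^ (2 * dim))⁻¹ * τ ^ dim) := by
  obtain ⟨C₁, hC₁, hpk⟩ := exists_norm_iteratedFDeriv_packet_le (E := E) (dim + 1) A hA1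
  obtain ⟨C₂, hC₂, hF⟩ := exists_norm_fourierInv_le (E := E) (dim + 1)
  obtain ⟨C₃, hC₃, hexp⟩ := exists_setLIntegral_inv_one_add_pow_le (E := E) (G := E →L[ℝ] ℝ) A hA1
  refine ⟨C₂ * C₁ * (C₃ * (2 * Real.pi) ^ dim), by positivity, ?_⟩
  intro φ a θ hφ ha hθs hθsupp hφA haA hθA ε S hε0 hε1 hS hSs hSε τ hτ0 hτ1 x
  have hτd : 0 < τ ^ dim := by positivity
  set y : E →L[ℝ] ℝ := -(2 * Real.pi * τ ^ 2) • InnerProductSpace.toDual ℝ E x with hy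
  set μ := (2 * Real.pi * τ)⁻¹ with hμ
  have hμ0 : 0 < μ := by positivity
  have hpt : ∀ ζ ∈ S, ‖((τ ^ dim)⁻¹ : ℂ) * 𝓕⁻ (oscPiece φ a θ τ ζ) x‖ₑ ≤
      ENNReal.ofReal (C₂ * C₁) *
        ENNReal.ofReal (((1 + μ * ‖fderiv ℝ φ ζ - y‖) ^ (dim + 1))⁻¹) := by
    intro ζ hζ
    rw [← ENNReal.ofReal_mul (by positivity), ← ofReal_norm]
    refine ENNReal.ofReal_le_ofReal ?_
    rw [norm_mul, norm_fourierInv_oscPiece φ a θ hτ0]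
    have hz := hSs hζ
    have h1 := hF (packet φ a θ ζ τ) C₁ (contDiff_packet hφ ha hθs ζ τ)
      (tsupport_packet_subset hθsupp ζ τ)
      (hpk φ a θ hφ ha hθs hθsupp (fun k hk η h1 h2 => (hφA k (by omega) η h1 h2).trans
        le_rfl) haA hθA ζ τ hz.1 hz.2 hτ0 hτ1)
      (τ • x + μ • (InnerProductSpace.toDual ℝ E).symm (fderiv ℝ φ ζ))
    have h2 : ‖τ • x + μ • (InnerProductSpace.toDual ℝ E).symm (fderiv ℝ φ ζ)‖ =
        μ * ‖fderiv ℝ φ ζ - y‖ := by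
      rw [← LinearIsometryEquiv.norm_map (InnerProductSpace.toDual ℝ E), map_add]
      simp only [map_smul, LinearIsometryEquiv.apply_symm_apply]
      rw [← Real.norm_of_nonneg hμ0.le, ← norm_smul, Real.norm_of_nonneg hμ0.le, smul_sub, hy,
        neg_smul, smul_neg, sub_neg_eq_add, smul_smul, add_comm]
      congr 3
      rw [hμ]
      have := Real.pi_pos
      simp
      field_simp
    rw [h2] at h1
    have h3 : ‖((τ : ℂ) ^ dim)⁻¹‖ = (τ ^ dim)⁻¹ := by
      rw [norm_inv, norm_pow, Complex.norm_of_nonneg hτ0.le]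
    rw [h3, inv_mul_cancel_left₀ hτd.ne']
    exact h1
  have hdd : ContDiff ℝ ∞ (fderiv ℝ φ) := hφ.fderiv_right (m := ∞) (by simp)
  have h4 := hexp (fderiv ℝ φ) (hdd.of_le (by exact_mod_cast le_top))
    (fun ζ hζ z hz => norm_fderiv_sub_le_of_shell hdd (fun η h1 h2 => by
      rw [norm_iteratedFDeriv_fderiv]; exact hφA 3 (by omega) η h1 h2) hζ.1 hζ.2 hz)
    ε S hε0 hε1 hS hSs hSε μ y hμ0
  refine (setLIntegral_mono' hS hpt).trans ?_
  rw [lintegral_const_mul' _ _ ENNReal.ofReal_ne_top]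
  refine (mul_le_mul_right h4 _).trans_eq ?_
  rw [← ENNReal.ofReal_mul (by positivity)]
  congr 1
  rw [hμ, mul_inv, ← inv_pow, ← inv_pow, inv_inv, inv_pow, mul_pow]
  ring

theorem continuous_oscPiece {φ : E → ℝ} {a : E → ℂ} {θ : E → ℝ} (hφ : Continuous φ)
    (ha : Continuous a) (hθ : Continuous θ) (τ : ℝ) :
    Continuous (fun z : E × E => oscPiece φ a θ τ z.2 z.1) := by
  unfold oscPiece
  fun_prop

set_option maxHeartbeats 1000000 in
/-- The amplitude `a` is cut into the part near `S` and the rest. -/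
theorem exists_oscillatory_decomposition (A : ℝ) (hA1 : 1 ≤ A) :
    ∃ C : ℝ, 0 < C ∧ ∀ (φ : E → ℝ) (a : E → ℂ), ContDiff ℝ ∞ φ → ContDiff ℝ ∞ a →
      (∀ k ≤ dim + 3, ∀ η : E, 1 / 8 ≤ ‖η‖ → ‖η‖ ≤ 8 → ‖iteratedFDeriv ℝ k φ η‖ ≤ A) →
      (∀ k ≤ dim + 1, ∀ η : E, ‖iteratedFDeriv ℝ k a η‖ ≤ A) →
      (∀ η, a η ≠ 0 → 1 / 2 ≤ ‖η‖ ∧ ‖η‖ ≤ 2) →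
      ∀ (ε : ℝ) (S : Set E), 0 < ε → ε ≤ 1 → MeasurableSet S → S ⊆ shell E →
      (∀ ζ ∈ S, ∀ v, ε * ‖v‖ ≤ ‖fderiv ℝ (fderiv ℝ φ) ζ v‖) → ∀ τ : ℝ, 0 < τ → τ ≤ 1 / 8 →
      ∃ g b : E → ℂ, Integrable g ∧ Integrable b ∧
        (∀ η, a η * Complex.exp (((τ⁻¹ ^ 2 * φ η : ℝ) : ℂ) * Complex.I) = g η + b η) ∧
        (∀ x, ‖𝓕⁻ g x‖ ≤ C * (ε ^ (2 * dim))⁻¹ * τ ^ dim) ∧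
        ∫⁻ η, ‖b η‖ₑ ^ 2 ≤ ENNReal.ofReal C * volume (shell E \ S) := by
  set θ₀ : ContDiffBump (0 : E) := ⟨1 / 2, 1, by norm_num, by norm_num⟩ with hθ₀
  set θ : E → ℝ := θ₀.normed volume with hθ
  have hθs : ContDiff ℝ ∞ θ := θ₀.contDiff_normed
  have hθsupp : tsupport θ ⊆ closedBall 0 1 := (θ₀.tsupport_normed_eq (μ := volume)).subset
  have hθc : HasCompactSupport θ := θ₀.hasCompactSupport_normed
  have hθ0 : ∀ σ, 0 ≤ θ σ := fun σ => θ₀.nonneg_normed σ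
  have hθ1 : ∫ σ, θ σ = 1 := θ₀.integral_normed
  have hθz : ∀ σ, 1 < ‖σ‖ → θ σ = 0 := by
    intro σ hσ
    by_contra h
    have := hθsupp (subset_tsupport _ h)
    simp at this; linarith
  obtain ⟨B, hB⟩ : ∃ B : ℝ, ∀ k ≤ dim + 1, ∀ σ : E,
      ‖iteratedFDeriv ℝ k (fun σ => (θ σ : ℂ)) σ‖ ≤ B := by
    have hs : ContDiff ℝ ∞ (fun σ => (θ σ : ℂ)) := Complex.ofRealCLM.contDiff.comp hθs
    have hc : HasCompactSupport (fun σ => (θ σ : ℂ)) := hθc.comp_left Complex.ofReal_zero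
    have : ∀ k : ℕ, ∃ B : ℝ, ∀ σ : E, ‖iteratedFDeriv ℝ k (fun σ => (θ σ : ℂ)) σ‖ ≤ B := fun k =>
      (hc.iteratedFDeriv k).exists_bound_of_continuous
        (hs.continuous_iteratedFDeriv (by exact_mod_cast le_top))
    choose B hB using this
    refine ⟨∑ k ∈ Finset.range (dim + 2), |B k|, fun k hk σ => (hB k σ).trans ?_⟩
    exact (le_abs_self _).trans (Finset.single_le_sum (f := fun k => |B k|)
      (fun _ _ => abs_nonneg _) (Finset.mem_range.2 (by omega)))
  set A' := max A B with hA'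
  obtain ⟨C₁, hC₁, hsup⟩ := exists_setLIntegral_fourierInv_oscPiece_le (E := E) A'
    (hA1.trans (le_max_left _ _))
  refine ⟨C₁ + A ^ 2, by positivity, ?_⟩
  intro φ a hφ ha hφA haA has ε S hε0 hε1 hS hSs hSε τ hτ0 hτ1
  have hφc := hφ.continuous
  have hac := ha.continuous
  have hθcont := hθs.continuous
  have haC : HasCompactSupport a := HasCompactSupport.of_support_subset_isCompact
    (isCompact_closedBall 0 2) fun η hη => by simpa using (has η hη).2
  have hτd : 0 < τ ^ dim := by positivity
  -- `w` is the indicator of `S` averaged at scale `τ`. It splits the function into `a e w`, a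
  -- superposition of the pieces centred in `S`, and the remainder `a e (1 - w)`.
  set w : E → ℝ := fun η => ∫ ζ in S, (τ ^ dim)⁻¹ * θ (τ⁻¹ • (η - ζ)) with hw
  set e : E → ℂ := fun η => Complex.exp (((τ⁻¹ ^ 2 * φ η : ℝ) : ℂ) * Complex.I) with he
  have hek : ∀ η, ‖e η‖ = 1 := fun η => Complex.norm_exp_ofReal_mul_I _
  have hkint : ∀ η, Integrable (fun ζ => (τ ^ dim)⁻¹ * θ (τ⁻¹ • (η - ζ))) := by
    intro η
    have h1 : Integrable θ := hθcont.integrable_of_hasCompactSupport hθc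
    have h2 := (h1.comp_smul (R := τ⁻¹) (by positivity)).comp_sub_left η
    exact h2.const_mul _
  have hkone : ∀ η, ∫ ζ, (τ ^ dim)⁻¹ * θ (τ⁻¹ • (η - ζ)) = 1 := by
    intro η
    rw [integral_const_mul, integral_sub_left_eq_self (fun z => θ (τ⁻¹ • z)) volume η,
      Measure.integral_comp_smul, hθ1, abs_of_pos (by positivity)]
    simp [hτd.ne']
  have hwc : ∀ η, 1 - w η = ∫ ζ in Sᶜ, (τ ^ dim)⁻¹ * θ (τ⁻¹ • (η - ζ)) := by
    intro η
    rw [← hkone η, ← integral_add_compl hS (hkint η), hw]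
    ring
  have hk0 : ∀ η ζ, 0 ≤ (τ ^ dim)⁻¹ * θ (τ⁻¹ • (η - ζ)) :=
    fun η ζ => mul_nonneg (by positivity) (hθ0 _)
  have hw0 : ∀ η, 0 ≤ w η := fun η => integral_nonneg (hk0 η)
  have hw0' : ∀ η, 0 ≤ 1 - w η := fun η => by rw [hwc]; exact integral_nonneg (hk0 η)
  have hprod : Integrable (fun z : E × E => ((τ ^ dim)⁻¹ : ℂ) * oscPiece φ a θ τ z.2 z.1)
      (volume.prod (volume.restrict S)) := by
    have h1 : Integrable (fun z : E × E => oscPiece φ a θ τ z.2 z.1) (volume.prod volume) := by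
      refine (continuous_oscPiece hφc hac hθcont τ).integrable_of_hasCompactSupport ?_
      refine HasCompactSupport.of_support_subset_isCompact
        ((isCompact_closedBall 0 2).prod (isCompact_closedBall 0 3)) fun z hz => ?_
      have hz1 : a z.1 ≠ 0 := by rintro h; exact hz (by simp [oscPiece, h])
      have hz2 : ‖τ⁻¹ • (z.1 - z.2)‖ ≤ 1 := by
        by_contra! h; exact hz (by simp [oscPiece, hθz _ h])
      rw [norm_smul, norm_inv, Real.norm_of_nonneg hτ0.le, inv_mul_le_iff₀ hτ0, mul_one] at hz2
      refine ⟨by simpa using (has _ hz1).2, ?_⟩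
      have := norm_sub_le z.1 (z.1 - z.2)
      rw [sub_sub_cancel] at this
      have := (has _ hz1).2
      simp only [mem_closedBall, dist_zero_right]
      linarith
    rw [← Measure.restrict_univ (μ := (volume : Measure E)), Measure.prod_restrict]
    · rw [Measure.restrict_univ]; exact (h1.const_mul _).integrableOn
  have hinner : ∀ η, ∫ ζ in S, ((τ ^ dim)⁻¹ : ℂ) * oscPiece φ a θ τ ζ η = a η * e η * w η := by
    intro η
    rw [hw, ← integral_complex_ofReal, ← integral_const_mul]
    refine integral_congr_ae (.of_forall fun ζ => ?_)
    simp only [oscPiece, he]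
    push_cast
    ring
  set g : E → ℂ := fun η => a η * e η * w η with hg
  have hgint : Integrable g := by
    have := hprod.integral_prod_left
    simp only [hinner] at this
    exact this
  have htot : Integrable (fun η => a η * e η) := by
    refine Continuous.integrable_of_hasCompactSupport ?_ (haC.mul_right)
    simp only [he]; fun_prop
  refine ⟨g, fun η => a η * e η - g η, hgint, htot.sub hgint, fun η => by simp [he], fun x => ?_, ?_⟩
  · have hFg : 𝓕⁻ g x = ∫ ζ in S, ((τ ^ dim)⁻¹ : ℂ) * 𝓕⁻ (oscPiece φ a θ τ ζ) x := by
      rw [Real.fourierInv_eq']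
      simp only [hg, ← hinner]
      simp_rw [← integral_smul]
      rw [integral_integral_swap]
      · refine integral_congr_ae (.of_forall fun ζ => ?_)
        simp only
        rw [Real.fourierInv_eq', ← integral_const_mul]
        refine integral_congr_ae (.of_forall fun η => ?_)
        simp only [smul_eq_mul]
        ring
      · refine hprod.mono ?_ (.of_forall fun z => ?_)
        · refine AEStronglyMeasurable.smul (f := fun z : E × E => Complex.exp
            (↑(2 * Real.pi * inner ℝ z.1 x) * Complex.I)) ?_ hprod.1
          exact Continuous.aestronglyMeasurable (by fun_prop)
        · simp only [Function.uncurry, norm_smul]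
          rw [Complex.norm_exp_ofReal_mul_I, one_mul]
    rw [← ENNReal.ofReal_le_ofReal_iff (by positivity), ofReal_norm, hFg]
    refine (enorm_integral_le_lintegral_enorm _).trans ((hsup φ a θ hφ ha hθs hθsupp
      (fun k hk η h1 h2 => (hφA k hk η h1 h2).trans (le_max_left _ _))
      (fun k hk η => (haA k hk η).trans (le_max_left _ _))
      (fun k hk σ => (hB k hk σ).trans (le_max_right _ _)) ε S hε0 hε1 hS hSs hSε τ hτ0 hτ1
      x).trans ?_)
    refine ENNReal.ofReal_le_ofReal ?_
    gcongr
    nlinarith [sq_nonneg A]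
  -- Since `0 ≤ 1 - w ≤ 1`, also `(1 - w)² ≤ 1 - w`. On the support of `a` every packet centre
  -- within distance `τ` lies in the shell, so there `1 - w` is the average of the indicator of
  -- `shell E \ S`.
  · have hbw : ∀ η, ‖a η * e η - g η‖ₑ ^ 2 ≤ ENNReal.ofReal (A ^ 2) *
        ∫⁻ ζ in shell E \ S, ENNReal.ofReal ((τ ^ dim)⁻¹ * θ (τ⁻¹ • (η - ζ))) := by
      intro η
      by_cases haη : a η = 0
      · simp [hg, haη]
      have h1 : 1 - w η = ∫ ζ in shell E \ S, (τ ^ dim)⁻¹ * θ (τ⁻¹ • (η - ζ)) := by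
        rw [hwc]
        refine setIntegral_eq_of_subset_of_forall_sdiff_eq_zero hS.compl
          (fun ζ hζ => hζ.2) fun ζ hζ => ?_
        have hz : ζ ∉ shell E := fun h => hζ.2 ⟨h, hζ.1⟩
        rw [hθz, mul_zero]
        by_contra! h
        rw [norm_smul, norm_inv, Real.norm_of_nonneg hτ0.le, inv_mul_le_iff₀ hτ0, mul_one] at h
        have h1 := has η haη
        have h2 := norm_sub_norm_le η ζ
        have h3 := norm_sub_norm_le ζ η
        rw [norm_sub_rev] at h3
        exact hz ⟨by linarith, by linarith⟩
      have h2 : ‖a η * e η - g η‖ ^ 2 ≤ A ^ 2 * (1 - w η) := by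
        have : a η * e η - g η = a η * e η * ((1 - w η : ℝ) : ℂ) := by
          simp only [hg]; push_cast; ring
        rw [this, norm_mul, norm_mul, hek, mul_one, Complex.norm_of_nonneg (hw0' η), mul_pow]
        have h3 := haA 0 (by omega) η
        rw [norm_iteratedFDeriv_zero] at h3
        have h4 := hw0 η
        have h5 := hw0' η
        gcongr
        nlinarith
      rw [← ofReal_norm, ← ENNReal.ofReal_pow (norm_nonneg _)]
      refine (ENNReal.ofReal_le_ofReal h2).trans ?_
      rw [ENNReal.ofReal_mul (by positivity), h1, ofReal_integral_eq_lintegral_ofReal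
        (hkint η).integrableOn (.of_forall (hk0 η))]
    have hm : Measurable (Function.uncurry fun η ζ : E =>
        ENNReal.ofReal ((τ ^ dim)⁻¹ * θ (τ⁻¹ • (η - ζ)))) := by
      refine ENNReal.measurable_ofReal.comp (Continuous.measurable ?_)
      fun_prop
    calc ∫⁻ η, ‖a η * e η - g η‖ₑ ^ 2 ≤ ∫⁻ η, ENNReal.ofReal (A ^ 2) *
          ∫⁻ ζ in shell E \ S, ENNReal.ofReal ((τ ^ dim)⁻¹ * θ (τ⁻¹ • (η - ζ))) :=
          lintegral_mono hbw
      _ = ENNReal.ofReal (A ^ 2) * ∫⁻ ζ in shell E \ S, ∫⁻ η,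
          ENNReal.ofReal ((τ ^ dim)⁻¹ * θ (τ⁻¹ • (η - ζ))) := by
          rw [lintegral_const_mul' _ _ ENNReal.ofReal_ne_top, lintegral_lintegral_swap hm.aemeasurable]
      _ = ENNReal.ofReal (A ^ 2) * volume (shell E \ S) := by
          congr 1
          rw [← setLIntegral_one]
          refine lintegral_congr fun ζ => ?_
          rw [← ofReal_integral_eq_lintegral_ofReal]
          · rw [integral_const_mul, integral_sub_right_eq_self (fun z => θ (τ⁻¹ • z)) ζ,
              Measure.integral_comp_smul, hθ1, abs_of_pos (by positivity)]
            simp [hτd.ne']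
          · exact (((hθcont.integrable_of_hasCompactSupport hθc).comp_smul (R := τ⁻¹)
              (by positivity)).comp_sub_right ζ).const_mul _
          · exact .of_forall fun η => hk0 η ζ
      _ ≤ _ := by
          gcongr
          linarith

end PacketDecomposition

end HigherOrderWave

namespace HigherOrderWave

/-! ### Hessian of the phase: a polynomial determinant that is not identically zero. -/

section HessianDeterminant

open Set Metric MvPolynomial

variable {n m : ℕ}

local notation "𝔼" => EuclideanSpace ℝ (Fin n)

theorem hasFDerivAt_polyEval {k : ℕ} (R : MvPolynomial (Fin k) ℝ) (x : EuclideanSpace ℝ (Fin k)) :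
    HasFDerivAt (polyEval R) (∑ i, polyEval (pderiv i R) x •
      (EuclideanSpace.proj i : EuclideanSpace ℝ (Fin k) →L[ℝ] ℝ)) x := by
  induction R using MvPolynomial.induction_on with
  | C a =>
    have : polyEval (n := k) (MvPolynomial.C a) = fun _ => a := by
      funext ξ; simp [polyEval]
    rw [this]
    simpa [polyEval] using hasFDerivAt_const a x
  | add p q hp hq =>
    have : polyEval (p + q) = polyEval p + polyEval q := by
      funext ξ; simp [polyEval]
    rw [this]
    refine (hp.add hq).congr_fderiv ?_
    simp [polyEval, add_smul, Finset.sum_add_distrib]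
  | mul_X p j hp =>
    have : polyEval (p * MvPolynomial.X j) =
        fun ξ => polyEval p ξ * (EuclideanSpace.proj j : EuclideanSpace ℝ (Fin k) →L[ℝ] ℝ) ξ := by
      funext ξ; simp [polyEval]
    rw [this]
    refine (hp.mul (EuclideanSpace.proj j :
      EuclideanSpace ℝ (Fin k) →L[ℝ] ℝ).hasFDerivAt).congr_fderiv ?_
    ext v
    simp [polyEval, pderiv_X, Pi.single_apply, Finset.sum_add_distrib, add_mul, Finset.mul_sum,
      apply_ite, mul_assoc]

theorem hasFDerivAt_polyEval_consL (R : MvPolynomial (Fin (n + 1)) ℝ) (δ : ℝ) (η : 𝔼) :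
    HasFDerivAt (fun η => polyEval R (consL n (δ, η))) (∑ i : Fin n,
      polyEval (pderiv i.succ R) (consL n (δ, η)) • (EuclideanSpace.proj i : 𝔼 →L[ℝ] ℝ)) η := by
  have h1 : HasFDerivAt (fun η : 𝔼 => (δ, η)) (ContinuousLinearMap.inr ℝ ℝ 𝔼) η :=
    hasFDerivAt_prodMk_right δ η
  refine ((hasFDerivAt_polyEval R (consL n (δ, η))).comp η
    ((consL n).hasFDerivAt.comp η h1)).congr_fderiv ?_
  ext v
  simp [Fin.sum_univ_succ]

/-- The matrix of the polynomials `2 𝐏 ∂ᵢ∂ₖ𝐏 - ∂ᵢ𝐏 ∂ₖ𝐏`, with `𝐏` the homogenized symbol. -/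
noncomputable def hessMatrix (P : MvPolynomial (Fin n) ℝ) (m : ℕ) :
    Matrix (Fin n) (Fin n) (MvPolynomial (Fin (n + 1)) ℝ) := fun i k =>
  C 2 * homogenization P m * pderiv k.succ (pderiv i.succ (homogenization P m)) -
    pderiv i.succ (homogenization P m) * pderiv k.succ (homogenization P m)

/-- Homogeneity fixes the leading coefficient along every line of a given direction, as the sublevel
estimate requires. -/
theorem EllipticPositive.isHomogeneous_det_hessMatrix {P : MvPolynomial (Fin n) ℝ}
    (hP : EllipticPositive P m) : (hessMatrix P m).det.IsHomogeneous (n * (2 * m - 2)) := by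
  have hm := hP.four_le_order
  have h := hP.isHomogeneous
  have hent : ∀ i k, (hessMatrix P m i k).IsHomogeneous (2 * m - 2) := by
    intro i k
    have e1 : 0 + m + (m - 1 - 1) = 2 * m - 2 := by omega
    have e2 : (m - 1) + (m - 1) = 2 * m - 2 := by omega
    refine IsHomogeneous.sub ?_ ?_
    · rw [← e1]; exact ((isHomogeneous_C _ _).mul h).mul h.pderiv.pderiv
    · rw [← e2]; exact h.pderiv.mul h.pderiv
  rw [Matrix.det_apply]
  refine IsHomogeneous.sum _ _ _ fun σ _ => ?_
  have h1 : (∏ i, hessMatrix P m (σ i) i).IsHomogeneous (n * (2 * m - 2)) := by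
    have := IsHomogeneous.prod Finset.univ (fun i => hessMatrix P m (σ i) i)
      (fun _ => 2 * m - 2) (fun i _ => hent _ _)
    simpa using this
  rcases Int.units_eq_one_or (Equiv.Perm.sign σ) with hs | hs <;> rw [hs]
  · simpa using h1
  · simpa using h1.neg

/-- The values of `hessMatrix`. -/
noncomputable def hessVal (P : MvPolynomial (Fin n) ℝ) (m : ℕ) (z : ℝ × 𝔼) :
    Matrix (Fin n) (Fin n) ℝ := fun i k => polyEval (hessMatrix P m i k) (consL n z)

theorem det_hessVal (P : MvPolynomial (Fin n) ℝ) (m : ℕ) (z : ℝ × 𝔼) :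
    (hessVal P m z).det = polyEval (hessMatrix P m).det (consL n z) := by
  rw [polyEval, RingHom.map_det]
  rfl

theorem hessVal_apply (P : MvPolynomial (Fin n) ℝ) (m : ℕ) (z : ℝ × 𝔼) (i k : Fin n) :
    hessVal P m z i k = 2 * homSymbol P m z *
      polyEval (pderiv k.succ (pderiv i.succ (homogenization P m))) (consL n z) -
      polyEval (pderiv i.succ (homogenization P m)) (consL n z) *
      polyEval (pderiv k.succ (homogenization P m)) (consL n z) := by
  simp [hessVal, hessMatrix, polyEval, homSymbol]

theorem hasFDerivAt_sqrt_homSymbol {P : MvPolynomial (Fin n) ℝ} {δ : ℝ} {η : 𝔼}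
    (h : 0 < homSymbol P m (δ, η)) :
    HasFDerivAt (fun η => √(homSymbol P m (δ, η))) (∑ i : Fin n,
      (polyEval (pderiv i.succ (homogenization P m)) (consL n (δ, η)) /
        (2 * √(homSymbol P m (δ, η)))) • (EuclideanSpace.proj i : 𝔼 →L[ℝ] ℝ)) η := by
  refine ((hasFDerivAt_polyEval_consL (homogenization P m) δ η).sqrt h.ne').congr_fderiv ?_
  rw [Finset.smul_sum]
  refine Finset.sum_congr rfl fun i _ => ?_
  rw [smul_smul]
  congr 1
  simp only [homSymbol]
  ring

theorem hasFDerivAt_coeff {P : MvPolynomial (Fin n) ℝ} {δ : ℝ} {η : 𝔼}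
    (h : 0 < homSymbol P m (δ, η)) (i : Fin n) :
    HasFDerivAt (fun η => polyEval (pderiv i.succ (homogenization P m)) (consL n (δ, η)) /
        (2 * √(homSymbol P m (δ, η)))) (∑ k : Fin n, (hessVal P m (δ, η) i k /
        (4 * homSymbol P m (δ, η) * √(homSymbol P m (δ, η)))) •
          (EuclideanSpace.proj k : 𝔼 →L[ℝ] ℝ)) η := by
  have h0 : 0 < √(homSymbol P m (δ, η)) := Real.sqrt_pos.2 h
  have hsq := Real.sq_sqrt h.le
  simp only [div_eq_mul_inv (polyEval _ _)]
  refine ((hasFDerivAt_polyEval_consL (pderiv i.succ (homogenization P m)) δ η).fun_mul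
    ((hasDerivAt_inv (x := 2 * √(homSymbol P m (δ, η))) (by positivity)).comp_hasFDerivAt η
      ((hasFDerivAt_sqrt_homSymbol h).const_mul 2))).congr_fderiv ?_
  ext v
  simp only [hessVal_apply, sum_apply, smul_apply,
    add_apply, smul_eq_mul, Finset.mul_sum, ← Finset.sum_add_distrib,
    Function.comp]
  refine Finset.sum_congr rfl fun k _ => ?_
  set s := √(homSymbol P m (δ, η))
  rw [← hsq]
  field_simp
  ring

/-- `Hess √p = (2p Hess p - ∇p ⊗ ∇p) / (4 p^{3/2})`. The numerator is polynomial, which reduces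
degeneracy of the Hessian to smallness of a polynomial. -/
theorem EllipticPositive.fderiv_fderiv_sqrt_homSymbol {P : MvPolynomial (Fin n) ℝ}
    (hP : EllipticPositive P m) {δ : ℝ} (hδ : 0 < δ) (η v : 𝔼) (i : Fin n) :
    fderiv ℝ (fderiv ℝ fun η => √(homSymbol P m (δ, η))) η v (EuclideanSpace.single i 1) =
      (hessVal P m (δ, η)).mulVec v i /
        (4 * homSymbol P m (δ, η) * √(homSymbol P m (δ, η))) := by
  have hpos : ∀ η, 0 < homSymbol P m (δ, η) := fun η =>
    hP.homSymbol_pos (z := (δ, η)) hδ.le (by simp [hδ.ne'])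
  have e1 : fderiv ℝ (fun η => √(homSymbol P m (δ, η))) = fun η => ∑ i : Fin n,
      (polyEval (pderiv i.succ (homogenization P m)) (consL n (δ, η)) /
        (2 * √(homSymbol P m (δ, η)))) • (EuclideanSpace.proj i : 𝔼 →L[ℝ] ℝ) := by
    funext η
    exact (hasFDerivAt_sqrt_homSymbol (hpos η)).fderiv
  rw [e1]
  have h2 := HasFDerivAt.fun_sum (u := Finset.univ) fun (i : Fin n) _ =>
    (hasFDerivAt_coeff (hpos η) i).smul_const (EuclideanSpace.proj i : 𝔼 →L[ℝ] ℝ)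
  rw [h2.fderiv]
  simp [Matrix.mulVec, dotProduct, Finset.sum_div, div_mul_eq_mul_div]

theorem continuous_polyEval {k : ℕ} (R : MvPolynomial (Fin k) ℝ) : Continuous (polyEval R) :=
  (hasTemperateGrowth_polyEval R).1.continuous

theorem continuous_hessVal (P : MvPolynomial (Fin n) ℝ) (m : ℕ) : Continuous (hessVal P m) :=
  continuous_matrix fun _ _ => (continuous_polyEval _).comp (consL n).continuous

theorem isCompact_shell : IsCompact (shell 𝔼) :=
  (isCompact_closedBall 0 4).of_isClosed_subset
    ((isClosed_le continuous_const continuous_norm).inter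
      (isClosed_le continuous_norm continuous_const)) shell_subset

theorem norm_le_sum_abs (v : 𝔼) : ‖v‖ ≤ ∑ i, |v i| := by
  rw [EuclideanSpace.norm_eq]
  refine Real.sqrt_le_iff.2 ⟨Finset.sum_nonneg fun _ _ => abs_nonneg _, ?_⟩
  simp only [Real.norm_eq_abs]
  exact Finset.sum_sq_le_sq_sum_of_nonneg fun _ _ => abs_nonneg _

/-- The Hessian of the phase is invertible off the zeros of the determinant, with bounds. -/
theorem EllipticPositive.exists_det_mul_norm_le {P : MvPolynomial (Fin n) ℝ}
    (hP : EllipticPositive P m) : ∃ c : ℝ, 0 < c ∧ ∀ δ : ℝ, 0 < δ → δ ≤ 1 → ∀ ζ ∈ shell 𝔼, ∀ v : 𝔼,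
      |polyEval (hessMatrix P m).det (consL n (δ, ζ))| * ‖v‖ ≤
        c * ‖fderiv ℝ (fderiv ℝ fun η => √(homSymbol P m (δ, η))) ζ v‖ := by
  have hK : IsCompact (Icc (0 : ℝ) 1 ×ˢ shell 𝔼) := isCompact_Icc.prod isCompact_shell
  have hcont : Continuous fun z : ℝ × 𝔼 => 4 * homSymbol P m z * √(homSymbol P m z) := by
    have := (contDiff_homSymbol P m).continuous
    fun_prop
  obtain ⟨A₁, hA₁⟩ := hK.exists_bound_of_continuousOn hcont.continuousOn
  -- `det M · v = adj M (M v)`, and the adjugate is bounded on the compact parameter set; no inverse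
  -- is needed.
  have hadj : ∀ i k, ∃ A : ℝ, ∀ z ∈ Icc (0 : ℝ) 1 ×ˢ shell 𝔼,
      ‖(hessVal P m z).adjugate i k‖ ≤ A := fun i k =>
    hK.exists_bound_of_continuousOn
      (((continuous_hessVal P m).matrix_adjugate).matrix_elem i k).continuousOn
  choose A₂ hA₂ using hadj
  set B := ∑ i, ∑ k, |A₂ i k| * |A₁| with hB
  refine ⟨B + 1, by positivity, fun δ hδ0 hδ1 ζ hζ v => ?_⟩
  set H := fderiv ℝ (fderiv ℝ fun η => √(homSymbol P m (δ, η))) ζ v with hH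
  set M := hessVal P m (δ, ζ) with hM
  have hz : (δ, ζ) ∈ Icc (0 : ℝ) 1 ×ˢ shell 𝔼 := ⟨⟨hδ0.le, hδ1⟩, hζ⟩
  have hpos : 0 < homSymbol P m (δ, ζ) := hP.homSymbol_pos (z := (δ, ζ)) hδ0.le (by simp [hδ0.ne'])
  have hMv : ∀ k, |M.mulVec v k| ≤ |A₁| * ‖H‖ := by
    intro k
    have h1 := hP.fderiv_fderiv_sqrt_homSymbol hδ0 ζ v k
    have h2 : ‖H (EuclideanSpace.single k 1)‖ ≤ ‖H‖ := by
      simpa using H.le_opNorm (EuclideanSpace.single k 1)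
    have hden : 0 < 4 * homSymbol P m (δ, ζ) * √(homSymbol P m (δ, ζ)) := by
      have := Real.sqrt_pos.2 hpos
      positivity
    rw [hH, h1, norm_div, div_le_iff₀ (norm_pos_iff.2 hden.ne'), Real.norm_eq_abs] at h2
    refine h2.trans ?_
    rw [mul_comm]
    gcongr
    exact (hA₁ _ hz).trans (le_abs_self _)
  have hv : ∀ l, |M.det * v l| ≤ ∑ k, |A₂ l k| * |A₁| * ‖H‖ := by
    intro l
    have h1 : M.det * v l = ∑ k, M.adjugate l k * M.mulVec v k := by
      have : M.adjugate.mulVec (M.mulVec v) = M.det • (v : Fin n → ℝ) := by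
        rw [Matrix.mulVec_mulVec, Matrix.adjugate_mul, Matrix.smul_mulVec, Matrix.one_mulVec]
      have := congrFun this l
      simp only [Pi.smul_apply, smul_eq_mul] at this
      rw [← this]; rfl
    rw [h1]
    refine (Finset.abs_sum_le_sum_abs _ _).trans (Finset.sum_le_sum fun k _ => ?_)
    rw [abs_mul, mul_assoc]
    exact mul_le_mul (((hA₂ l k) _ hz).trans (le_abs_self _)) (hMv k) (abs_nonneg _) (abs_nonneg _)
  rw [← det_hessVal]
  calc |M.det| * ‖v‖ ≤ |M.det| * ∑ l, |v l| := by gcongr; exact norm_le_sum_abs v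
    _ = ∑ l, |M.det * v l| := by simp_rw [Finset.mul_sum, abs_mul]
    _ ≤ ∑ l, ∑ k, |A₂ l k| * |A₁| * ‖H‖ := Finset.sum_le_sum fun l _ => hv l
    _ = B * ‖H‖ := by simp_rw [hB, Finset.sum_mul]
    _ ≤ (B + 1) * ‖H‖ := by gcongr; linarith

/-- A negative second derivative would make `x` a local maximum too, hence `f` locally constant. -/
theorem deriv_deriv_nonneg_of_isLocalMin {f : ℝ → ℝ} {x : ℝ} (hf : IsLocalMin f x)
    (hc : ContinuousAt f x) : 0 ≤ deriv (deriv f) x := by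
  by_contra! h
  have h1 := isLocalMax_of_deriv_deriv_neg h hf.deriv_eq_zero hc
  have h2 : f =ᶠ[nhds x] fun _ => f x := by
    filter_upwards [hf, h1] with y h3 h4 using le_antisymm h4 h3
  have h3 := h2.deriv.deriv_eq
  rw [h3] at h
  simp at h

theorem hasDerivAt_polyEval_line (R : MvPolynomial (Fin (n + 1)) ℝ) (δ : ℝ) (η v : 𝔼) (s : ℝ) :
    HasDerivAt (fun s : ℝ => polyEval R (consL n (δ, η + s • v)))
      (∑ i : Fin n, polyEval (pderiv i.succ R) (consL n (δ, η + s • v)) * v i) s := by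
  have h1 : HasDerivAt (fun s : ℝ => η + s • v) v s := by
    simpa using ((hasDerivAt_id s).smul_const v).const_add η
  have h2 := (hasFDerivAt_polyEval_consL R δ (η + s • v)).comp_hasDerivAt s h1
  refine h2.congr_deriv ?_
  simp

/-- `c ‖ξ‖^m` touches the principal symbol from below at `e`. Comparing the first two derivatives
along `e + s v`, with `a = ⟨e, v⟩` and `b = ‖v‖²`, gives `f' = 2cla` and `f'' ≥ cl(4(l-1)a² + 2b)`,
hence `2c f'' - f'² ≥ 4c²l((l-2)a² + b) > 0`. Here `l = m/2 ≥ 2` is needed: for `l = 1` the bound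
degenerates in the radial direction, as for a cone. -/
theorem EllipticPositive.quadratic_form_pos {P : MvPolynomial (Fin n) ℝ}
    (hP : EllipticPositive P m) {e : 𝔼} (he : ‖e‖ = 1)
    (hmin : ∀ ξ : 𝔼, homSymbol P m (0, e) * ‖ξ‖ ^ m ≤ homSymbol P m (0, ξ)) {v : 𝔼} (hv : v ≠ 0) :
    0 < ∑ i, (∑ k, hessVal P m (0, e) i k * v k) * v i := by
  have hm := hP.four_le_order
  obtain ⟨l, hl⟩ := hP.even_order
  rw [← two_mul] at hl
  set c := homSymbol P m (0, e) with hc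
  have hc0 : 0 < c := hP.homSymbol_pos (z := (0, e)) le_rfl (by
    rw [Ne, Prod.mk_eq_zero]; rintro ⟨-, h⟩; simp [h] at he)
  set R := homogenization P m with hR
  set f : ℝ → ℝ := fun s => polyEval R (consL n (0, e + s • v)) with hf
  set f₁ : ℝ → ℝ := fun s => ∑ i : Fin n,
    polyEval (pderiv i.succ R) (consL n (0, e + s • v)) * v i with hf₁
  set f₂ : ℝ := ∑ i : Fin n, (∑ k : Fin n,
    polyEval (pderiv k.succ (pderiv i.succ R)) (consL n (0, e)) * v k) * v i with hf₂
  have hd1 : ∀ s, HasDerivAt f (f₁ s) s := hasDerivAt_polyEval_line R 0 e v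
  have hd2 : HasDerivAt f₁ f₂ 0 := by
    have := HasDerivAt.fun_sum (u := Finset.univ) fun (i : Fin n) _ =>
      (hasDerivAt_polyEval_line (pderiv i.succ R) 0 e v 0).mul_const (v i)
    simpa using this
  set a := inner ℝ e v with ha
  set b := ‖v‖ ^ 2 with hb
  have hb0 : 0 < b := by positivity
  set q : ℝ → ℝ := fun s => 1 + 2 * a * s + b * s ^ 2 with hq
  have hqn : ∀ s, ‖e + s • v‖ ^ m = q s ^ l := by
    intro s
    rw [hl, pow_mul, norm_add_sq_real, he, real_inner_smul_right, norm_smul, mul_pow,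
      Real.norm_eq_abs, sq_abs]
    congr 1
    simp only [hq]; ring
  have hq1 : ∀ s, HasDerivAt q (2 * a + 2 * b * s) s := by
    intro s
    have := (((hasDerivAt_id s).const_mul (2 * a)).const_add 1).add
      ((hasDerivAt_pow 2 s).const_mul b)
    refine this.congr_deriv ?_
    simp; ring
  have hq2 : HasDerivAt (fun s => 2 * a + 2 * b * s) (2 * b) 0 := by
    simpa using ((hasDerivAt_id (0 : ℝ)).const_mul (2 * b)).const_add (2 * a)
  set g : ℝ → ℝ := fun s => f s - c * q s ^ l with hg
  have hg1 : ∀ s, HasDerivAt g (f₁ s - c * (l * q s ^ (l - 1) * (2 * a + 2 * b * s))) s :=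
    fun s => (hd1 s).sub (((hq1 s).pow l).const_mul c)
  have hg2 : HasDerivAt (fun s => f₁ s - c * (l * q s ^ (l - 1) * (2 * a + 2 * b * s)))
      (f₂ - c * (l * ((l - 1 : ℕ) * (2 * a) * (2 * a) + 2 * b))) 0 := by
    have h := hd2.sub (((((hq1 0).pow (l - 1)).const_mul (l : ℝ)).mul hq2).const_mul c)
    refine h.congr_deriv ?_
    simp only [hq, Pi.pow_apply, mul_zero, add_zero, ne_eq, OfNat.ofNat_ne_zero, not_false_eq_true,
      zero_pow, one_pow, mul_one]
    ring
  have hf0 : f 0 = c := by simp [hf, hc, homSymbol, hR]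
  have hgmin : IsLocalMin g 0 := by
    refine .of_forall fun s => ?_
    have h0 : g 0 = 0 := by simp [hg, hf0, hq]
    rw [h0]
    have := hmin (e + s • v)
    rw [hqn] at this
    simp only [hg, sub_nonneg]
    exact this
  have hg' : deriv g = fun s => f₁ s - c * (l * q s ^ (l - 1) * (2 * a + 2 * b * s)) :=
    funext fun s => (hg1 s).deriv
  have h1 : f₁ 0 = c * (l * (2 * a)) := by
    have := hgmin.deriv_eq_zero
    rw [hg'] at this
    simp [hq] at this
    linarith
  have h2 : c * (l * ((l - 1 : ℕ) * (2 * a) * (2 * a) + 2 * b)) ≤ f₂ := by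
    have := deriv_deriv_nonneg_of_isLocalMin hgmin (hg1 0).continuousAt
    rw [hg', hg2.deriv] at this
    linarith
  have hform : ∑ i, (∑ k, hessVal P m (0, e) i k * v k) * v i = 2 * c * f₂ - f₁ 0 ^ 2 := by
    have e1 : f₁ 0 ^ 2 = ∑ i : Fin n, (∑ k : Fin n, polyEval (pderiv i.succ R) (consL n (0, e)) *
        polyEval (pderiv k.succ R) (consL n (0, e)) * v k) * v i := by
      simp only [hf₁, zero_smul, add_zero, sq]
      rw [Finset.sum_mul]
      refine Finset.sum_congr rfl fun i _ => ?_
      rw [Finset.mul_sum, Finset.sum_mul]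
      refine Finset.sum_congr rfl fun k _ => ?_
      ring
    rw [e1, hf₂, Finset.mul_sum, ← Finset.sum_sub_distrib]
    refine Finset.sum_congr rfl fun i _ => ?_
    rw [← mul_assoc, ← sub_mul, Finset.mul_sum, ← Finset.sum_sub_distrib]
    congr 1
    refine Finset.sum_congr rfl fun k _ => ?_
    rw [hessVal_apply]
    ring
  rw [hform, h1]
  have hl2 : (2 : ℝ) ≤ l := by
    have : 2 ≤ l := by omega
    exact_mod_cast this
  have hl1 : ((l - 1 : ℕ) : ℝ) = l - 1 := by
    rw [Nat.cast_sub (by omega)]; simp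
  rw [hl1] at h2
  have h3 : 0 < c ^ 2 * l * b := by positivity
  have h4 : 0 ≤ c ^ 2 * l * (l - 2) * a ^ 2 := by
    have : 0 ≤ (l : ℝ) - 2 := by linarith
    positivity
  nlinarith

/-- `e` is a minimum point of the principal symbol on the unit sphere, where the matrix is positive
definite. -/
theorem EllipticPositive.exists_det_ne_zero {P : MvPolynomial (Fin n) ℝ}
    (hP : EllipticPositive P m) :
    ∃ e : 𝔼, ‖e‖ = 1 ∧ polyEval (hessMatrix P m).det (consL n (0, e)) ≠ 0 := by
  have hn := hP.two_le_dim
  have : Nontrivial 𝔼 := by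
    have : Nonempty (Fin n) := ⟨⟨0, by omega⟩⟩
    infer_instance
  have hcont : Continuous fun ξ : 𝔼 => homSymbol P m (0, ξ) :=
    (contDiff_homSymbol P m).continuous.comp (by fun_prop)
  obtain ⟨e, he, hmin⟩ := (isCompact_sphere (0 : 𝔼) 1).exists_isMinOn
    (NormedSpace.sphere_nonempty.2 zero_le_one) hcont.continuousOn
  have he1 : ‖e‖ = 1 := by simpa using he
  refine ⟨e, he1, ?_⟩
  have hmin' : ∀ ξ : 𝔼, homSymbol P m (0, e) * ‖ξ‖ ^ m ≤ homSymbol P m (0, ξ) := by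
    intro ξ
    by_cases hξ : ξ = 0
    · subst hξ
      have := hP.four_le_order
      have h0 := hP.homSymbol_smul 0 (0, (0 : 𝔼))
      rw [zero_smul] at h0
      have h00 : homSymbol P m ((0 : ℝ), (0 : 𝔼)) = 0 := by
        have e1 : ((0 : ℝ), (0 : 𝔼)) = 0 := rfl
        rw [e1, h0, zero_pow (by omega), zero_mul]
      rw [h00, norm_zero, zero_pow (by omega), mul_zero]
    have h0 : ‖ξ‖ ≠ 0 := norm_ne_zero_iff.2 hξ
    have h1 : homSymbol P m (0, e) ≤ homSymbol P m (0, ‖ξ‖⁻¹ • ξ) :=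
      hmin (by simp [norm_smul, h0])
    have h2 := hP.homSymbol_smul ‖ξ‖ (0, ‖ξ‖⁻¹ • ξ)
    rw [Prod.smul_mk, smul_zero, smul_smul, mul_inv_cancel₀ h0, one_smul] at h2
    rw [h2, mul_comm]
    gcongr
  rw [← det_hessVal]
  intro hdet
  obtain ⟨v, hv, hMv⟩ := Matrix.exists_mulVec_eq_zero_iff.2 hdet
  have hpos := hP.quadratic_form_pos he1 hmin' (v := WithLp.toLp 2 v) (by simpa using hv)
  refine hpos.ne' (Finset.sum_eq_zero fun i _ => ?_)
  have := congrFun hMv i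
  simp only [Matrix.mulVec, dotProduct, Pi.zero_apply] at this
  simp [this]

end HessianDeterminant

end HigherOrderWave

namespace HigherOrderWave

/-! ### Sublevel sets of homogeneous polynomials, uniformly in the scale parameter. -/

section Sublevel

open Set Metric

/-- If `s` is at distance at least `ρ` from the real part of every complex root, then `|q(s)| ≥ |c|
ρ^N = ε`. So the set lies in `N` intervals of length `2ρ`. -/
theorem volume_polynomial_lt_le {q : Polynomial ℝ} {N : ℕ} (hN : N ≠ 0) (hq : q.natDegree ≤ N)
    (hc : q.coeff N ≠ 0) {ε : ℝ} (hε : 0 ≤ ε) :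
    volume {s : ℝ | |q.eval s| < ε} ≤
      ENNReal.ofReal (2 * N * (ε / |q.coeff N|) ^ ((1 : ℝ) / N)) := by
  set c := q.coeff N with hcdef
  have hdeg : q.natDegree = N := le_antisymm hq (Polynomial.le_natDegree_of_ne_zero hc)
  set p : Polynomial ℂ := q.map (algebraMap ℝ ℂ) with hp
  have hpdeg : p.natDegree = N := by rw [hp, Polynomial.natDegree_map, hdeg]
  have hlead : p.leadingCoeff = (c : ℂ) := by
    rw [hp, Polynomial.leadingCoeff_map, Polynomial.leadingCoeff, hdeg]; rfl
  have hsplit : p.Splits := IsAlgClosed.splits p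
  have hcard : Multiset.card p.roots = N := by rw [← hpdeg]; exact hsplit.natDegree_eq_card_roots.symm
  set ρ := (ε / |c|) ^ ((1 : ℝ) / N) with hρ
  have hρ0 : 0 ≤ ρ := by positivity
  have hρN : ρ ^ N = ε / |c| := by
    rw [hρ, ← Real.rpow_natCast, ← Real.rpow_mul (by positivity), one_div,
      inv_mul_cancel₀ (by exact_mod_cast hN), Real.rpow_one]
  have heval : ∀ s : ℝ, |q.eval s| = |c| * (p.roots.map fun r => ‖(s : ℂ) - r‖).prod := by
    intro s
    have h1 : p.eval (s : ℂ) = ((q.eval s : ℝ) : ℂ) := by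
      rw [hp, Polynomial.eval_map_algebraMap]
      exact Polynomial.aeval_algebraMap_apply_eq_algebraMap_eval s q
    rw [← Real.norm_eq_abs, ← Complex.norm_real, ← h1, hsplit.eval_eq_prod_roots, norm_mul, hlead,
      Complex.norm_real, Real.norm_eq_abs]
    congr 1
    have h2 := map_multiset_prod (normHom : ℂ →*₀ ℝ) (p.roots.map fun r => (s : ℂ) - r)
    rw [Multiset.map_map] at h2
    exact h2
  have hsub : {s : ℝ | |q.eval s| < ε} ⊆ ⋃ r ∈ p.roots.toFinset, ball r.re ρ := by
    intro s hs
    by_contra h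
    simp only [mem_iUnion, Multiset.mem_toFinset, not_exists, mem_ball, not_lt] at h
    have h1 : ρ ^ N ≤ (p.roots.map fun r => ‖(s : ℂ) - r‖).prod := by
      rw [← hcard, ← Multiset.prod_replicate, ← Multiset.map_const']
      refine Multiset.prod_map_le_prod_map₀ _ _ (fun _ _ => hρ0) fun r hr => (h r hr).trans ?_
      rw [Real.dist_eq]
      simpa using Complex.abs_re_le_norm ((s : ℂ) - r)
    rw [mem_ofPred_eq, heval] at hs
    rw [hρN, div_le_iff₀ (abs_pos.2 hc)] at h1
    linarith
  calc volume {s : ℝ | |q.eval s| < ε} ≤ volume (⋃ r ∈ p.roots.toFinset, ball r.re ρ) :=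
        measure_mono hsub
    _ ≤ ∑ r ∈ p.roots.toFinset, volume (ball r.re ρ) := measure_biUnion_finset_le _ _
    _ = p.roots.toFinset.card * ENNReal.ofReal (2 * ρ) := by simp
    _ ≤ N * ENNReal.ofReal (2 * ρ) := by
        gcongr
        rw [← hcard]; exact Multiset.toFinset_card_le _
    _ = _ := by
        rw [← ENNReal.ofReal_natCast, ← ENNReal.ofReal_mul (by positivity)]
        congr 1; ring

/-- `s ↦ D(u + s w)` is the reflection of `y ↦ D(w + y u)`, whose constant term is `D(w)`. Hence the
top coefficient does not depend on the base point `u`. -/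
theorem exists_polynomial_line {k N : ℕ} {D : MvPolynomial (Fin k) ℝ} (hD : D.IsHomogeneous N)
    (u w : EuclideanSpace ℝ (Fin k)) : ∃ q : Polynomial ℝ, q.natDegree ≤ N ∧
      q.coeff N = polyEval D w ∧ ∀ s : ℝ, q.eval s = polyEval D (u + s • w) := by
  set r : Polynomial ℝ := MvPolynomial.aeval
    (fun i => Polynomial.C (w i) + Polynomial.X * Polynomial.C (u i)) D with hr
  have hreval : ∀ y : ℝ, r.eval y = polyEval D (w + y • u) := by
    intro y
    rw [hr, polyEval, ← Polynomial.coe_evalRingHom, MvPolynomial.aeval_def,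
      MvPolynomial.hom_eval₂]
    have : (Polynomial.evalRingHom y).comp (algebraMap ℝ (Polynomial ℝ)) = RingHom.id ℝ := by
      ext; simp
    rw [this, MvPolynomial.eval₂_id]
    congr 1
    congr 1
    ext i
    simp only [Polynomial.coe_evalRingHom, Polynomial.eval_add, Polynomial.eval_mul,
      Polynomial.eval_C, Polynomial.eval_X, PiLp.add_apply, PiLp.smul_apply, smul_eq_mul]
  have hrdeg : r.natDegree ≤ N := by
    have := MvPolynomial.aeval_natDegree_le (m := N) (n := 1) D hD.totalDegree_le
      (fun i => Polynomial.C (w i) + Polynomial.X * Polynomial.C (u i)) (fun i => by compute_degree)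
    rwa [mul_one] at this
  set q := r.reflect N with hq
  have hqdeg : q.natDegree ≤ N := by
    refine (Polynomial.natDegree_reflect_le).trans (by simp [hrdeg])
  have hqeval : ∀ s : ℝ, s ≠ 0 → q.eval s = polyEval D (u + s • w) := by
    intro s hs
    have : Invertible s⁻¹ := invertibleOfNonzero (inv_ne_zero hs)
    have h1 := Polynomial.eval₂_reflect_mul_pow (RingHom.id ℝ) s⁻¹ N r hrdeg
    rw [invOf_eq_inv, inv_inv, Polynomial.eval₂_id, Polynomial.eval₂_id, hreval] at h1
    have h2 : u + s • w = s • (w + s⁻¹ • u) := by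
      rw [smul_add, smul_smul, mul_inv_cancel₀ hs, one_smul, add_comm]
    rw [h2, polyEval_smul hD, ← h1, hq, mul_left_comm, ← mul_pow, mul_inv_cancel₀ hs, one_pow,
      mul_one]
  refine ⟨q, hqdeg, ?_, ?_⟩
  · rw [hq, Polynomial.coeff_reflect, Polynomial.revAt_le le_rfl, Nat.sub_self,
      Polynomial.coeff_zero_eq_eval_zero, hreval]
    simp
  · have h1 : Continuous fun s : ℝ => q.eval s := q.continuous
    have h2 : Continuous fun s : ℝ => polyEval D (u + s • w) :=
      (continuous_polyEval D).comp (by fun_prop)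
    exact congrFun (h1.ext_on (dense_compl_singleton 0) h2 fun s hs => hqeval s hs)

variable {n m : ℕ}

local notation "𝔼" => EuclideanSpace ℝ (Fin n)

/-- Along every line in the direction `(0, e)` the top coefficient is `D(0, e)`, whatever `δ` and
the base point, so the one-dimensional estimate is uniform. Averaging over translations by `s e`, `0
≤ s ≤ 1`, replaces slicing in adapted coordinates. -/
theorem exists_volume_polyEval_lt_le {N : ℕ} (hN : N ≠ 0) {D : MvPolynomial (Fin (n + 1)) ℝ}
    (hD : D.IsHomogeneous N) {e : 𝔼} (he : ‖e‖ = 1) (hDe : polyEval D (consL n (0, e)) ≠ 0) :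
    ∃ C : ℝ, 0 < C ∧ ∀ δ ε : ℝ, 0 ≤ ε →
      volume {ζ ∈ shell 𝔼 | |polyEval D (consL n (δ, ζ))| < ε} ≤
        ENNReal.ofReal (C * ε ^ ((1 : ℝ) / N)) := by
  set c := |polyEval D (consL n (0, e))| with hc
  have hc0 : 0 < c := abs_pos.2 hDe
  set V := (volume : Measure 𝔼).real (closedBall 0 5) with hV
  have hV0 : 0 ≤ V := measureReal_nonneg
  refine ⟨2 * N * (1 / c) ^ ((1 : ℝ) / N) * V + 1, by positivity, fun δ ε hε => ?_⟩
  set B : Set 𝔼 := {ζ ∈ shell 𝔼 | |polyEval D (consL n (δ, ζ))| < ε} with hB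
  have hBm : MeasurableSet B := by
    refine measurableSet_shell.inter (s₂ := {ζ | |polyEval D (consL n (δ, ζ))| < ε})
      (measurableSet_lt ?_ measurable_const)
    have := (continuous_polyEval D).comp ((consL n).continuous.comp
      (by fun_prop : Continuous fun ζ : 𝔼 => (δ, ζ)))
    exact this.abs.measurable
  set κ := ENNReal.ofReal (2 * N * (ε / c) ^ ((1 : ℝ) / N)) with hκ
  have hline : ∀ η : 𝔼, volume {s ∈ Icc (0 : ℝ) 1 | η + s • e ∈ B} ≤
      (closedBall (0 : 𝔼) 5).indicator (fun _ => κ) η := by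
    intro η
    by_cases hη : η ∈ closedBall (0 : 𝔼) 5
    · rw [indicator_of_mem hη]
      obtain ⟨q, hq1, hq2, hq3⟩ := exists_polynomial_line hD (consL n (δ, η)) (consL n (0, e))
      have := volume_polynomial_lt_le hN hq1 (by rw [hq2]; exact hDe) hε
      rw [hq2, ← hc] at this
      refine (measure_mono fun s hs => ?_).trans this
      have h1 := hs.2.2
      simp only [mem_ofPred_eq]
      rw [hq3, ← map_smul, ← map_add]
      simpa using h1
    · rw [indicator_of_notMem hη, nonpos_iff_eq_zero]
      have : {s ∈ Icc (0 : ℝ) 1 | η + s • e ∈ B} = ∅ := by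
        refine eq_empty_of_forall_notMem fun s hs => hη ?_
        have h1 := hs.2.1.2
        have h2 := norm_sub_le (η + s • e) (s • e)
        rw [add_sub_cancel_right, norm_smul, he, Real.norm_of_nonneg hs.1.1] at h2
        have := hs.1.2
        simp only [mem_closedBall, dist_zero_right]
        linarith
      rw [this, measure_empty]
  calc volume B = ∫⁻ s in Icc (0 : ℝ) 1, volume B := by simp
    _ = ∫⁻ s in Icc (0 : ℝ) 1, ∫⁻ η : 𝔼, B.indicator (fun _ => 1) (η + s • e) := by
        refine lintegral_congr fun s => ?_
        rw [lintegral_add_right_eq_self (fun η => B.indicator (fun _ => (1 : ℝ≥0∞)) η),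
          lintegral_indicator hBm, setLIntegral_one]
    _ = ∫⁻ η : 𝔼, ∫⁻ s in Icc (0 : ℝ) 1, B.indicator (fun _ => 1) (η + s • e) := by
        rw [lintegral_lintegral_swap]
        refine Measurable.aemeasurable ?_
        exact (measurable_const.indicator hBm).comp
          (by fun_prop : Continuous fun z : ℝ × 𝔼 => z.2 + z.1 • e).measurable
    _ ≤ ∫⁻ η : 𝔼, (closedBall (0 : 𝔼) 5).indicator (fun _ => κ) η := by
        refine lintegral_mono fun η => (le_of_eq ?_).trans (hline η)
        have hm : MeasurableSet {s : ℝ | η + s • e ∈ B} :=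
          hBm.preimage (by fun_prop : Continuous fun s : ℝ => η + s • e).measurable
        have : (fun s : ℝ => B.indicator (fun _ => (1 : ℝ≥0∞)) (η + s • e)) =
            {s : ℝ | η + s • e ∈ B}.indicator fun _ => 1 := by
          ext s; simp [indicator]
        rw [this, lintegral_indicator hm, setLIntegral_one, Measure.restrict_apply hm, inter_comm]
        rfl
    _ = κ * ENNReal.ofReal V := by
        rw [lintegral_indicator measurableSet_closedBall, setLIntegral_const, hV,
          ofReal_measureReal measure_closedBall_lt_top.ne]
    _ = ENNReal.ofReal (2 * N * (1 / c) ^ ((1 : ℝ) / N) * V * ε ^ ((1 : ℝ) / N)) := by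
        rw [hκ, ← ENNReal.ofReal_mul (by positivity), div_eq_mul_one_div ε c,
          Real.mul_rpow hε (by positivity)]
        congr 1; ring
    _ ≤ _ := by
        gcongr
        linarith

end Sublevel

end HigherOrderWave

namespace HigherOrderWave

/-! ### Derivative bounds in `η`, uniform in the parameter `δ`. -/

section Slices

open Set Metric

variable {E F : Type*} [NormedAddCommGroup E] [NormedSpace ℝ E] [NormedAddCommGroup F]
  [NormedSpace ℝ F]

/-- The slice is `f` composed with a translate of the norm-nonincreasing inclusion `η ↦ (0, η)`. -/
theorem norm_iteratedFDeriv_slice_le {f : ℝ × E → F} {U : Set (ℝ × E)} (hU : IsOpen U)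
    (hf : ContDiffOn ℝ ∞ f U) {z : ℝ × E} (hz : z ∈ U) (k : ℕ) :
    ‖iteratedFDeriv ℝ k (fun η => f (z.1, η)) z.2‖ ≤ ‖iteratedFDeriv ℝ k f z‖ := by
  set c : ℝ × E := (z.1, 0)
  set g : ℝ × E → F := fun w => f (c + w) with hg
  set U' : Set (ℝ × E) := {w | c + w ∈ U} with hU'
  have hU'o : IsOpen U' := hU.preimage (by fun_prop)
  have hgs : ContDiffOn ℝ ∞ g U' := hf.comp (by fun_prop) fun w hw => hw
  set L : E →L[ℝ] ℝ × E := ContinuousLinearMap.inr ℝ ℝ E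
  have hpre : IsOpen (L ⁻¹' U') := hU'o.preimage L.continuous
  have hLz : c + L z.2 = z := by ext <;> simp [c, L]
  have hzU : L z.2 ∈ U' := by simp only [hU', mem_ofPred_eq, hLz]; exact hz
  have h1 := L.iteratedFDerivWithin_comp_right hgs hU'o.uniqueDiffOn hpre.uniqueDiffOn hzU
    (i := k) (by exact_mod_cast le_top)
  rw [iteratedFDerivWithin_of_isOpen k hpre hzU, iteratedFDerivWithin_of_isOpen k hU'o hzU] at h1
  have h2 : g ∘ L = fun η => f (z.1, η) := by
    funext η; simp [hg, c, L]
  rw [← h2, h1]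
  refine (ContinuousMultilinearMap.norm_compContinuousLinearMap_le _ _).trans ?_
  have h3 : iteratedFDeriv ℝ k g (L z.2) = iteratedFDeriv ℝ k f z := by
    rw [hg, iteratedFDeriv_comp_add_left, hLz]
  rw [h3]
  refine mul_le_of_le_one_right (norm_nonneg _) (Finset.prod_le_one (fun _ _ => norm_nonneg _)
    fun _ _ => ContinuousLinearMap.norm_inr_le_one ℝ ℝ E)

theorem exists_norm_iteratedFDeriv_slice_le {f : ℝ × E → F} {U K : Set (ℝ × E)} (hU : IsOpen U)
    (hf : ContDiffOn ℝ ∞ f U) (hK : IsCompact K) (hKU : K ⊆ U) (N : ℕ) :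
    ∃ A : ℝ, ∀ k ≤ N, ∀ z ∈ K, ‖iteratedFDeriv ℝ k (fun η => f (z.1, η)) z.2‖ ≤ A := by
  have h : ∀ k : ℕ, ∃ A : ℝ, ∀ z ∈ K, ‖iteratedFDeriv ℝ k f z‖ ≤ A := fun k => by
    refine hK.exists_bound_of_continuousOn (ContinuousOn.mono ?_ hKU)
    exact (hf.continuousOn_iteratedFDerivWithin (m := k) (by exact_mod_cast le_top)
      hU.uniqueDiffOn).congr fun z hz => (iteratedFDerivWithin_of_isOpen k hU hz).symm
  choose A hA using h
  refine ⟨∑ k ∈ Finset.range (N + 1), |A k|, fun k hk z hz => ?_⟩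
  refine (norm_iteratedFDeriv_slice_le hU hf (hKU hz) k).trans ((hA k z hz).trans ?_)
  exact (le_abs_self _).trans (Finset.single_le_sum (f := fun k => |A k|)
    (fun _ _ => abs_nonneg _) (Finset.mem_range.2 (by omega)))

end Slices

/-! ### Dyadic cutoffs; bounds for phase and amplitude on the shell. -/

section ShellBounds

open Set Metric

variable {n m : ℕ}

local notation "𝔼" => EuclideanSpace ℝ (Fin n)

/-- A smooth cutoff, equal to one on the unit ball and supported in the ball of radius two. -/
noncomputable def bump (n : ℕ) : ContDiffBump (0 : EuclideanSpace ℝ (Fin n)) :=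
  ⟨1, 2, by norm_num, by norm_num⟩

/-- The dyadic cutoff `β (η) - β (2η)`. -/
noncomputable def dyadic (η : 𝔼) : ℝ := bump n η - bump n ((2 : ℝ) • η)

theorem bump_eq_one {η : 𝔼} (h : ‖η‖ ≤ 1) : bump n η = 1 :=
  (bump n).one_of_mem_closedBall (by rw [mem_closedBall, dist_zero_right]; exact h)

theorem bump_eq_zero {η : 𝔼} (h : 2 ≤ ‖η‖) : bump n η = 0 :=
  (bump n).zero_of_le_dist (by rw [dist_zero_right]; exact h)

theorem contDiff_dyadic : ContDiff ℝ ∞ (dyadic (n := n)) :=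
  (bump n).contDiff.sub ((bump n).contDiff.comp (contDiff_const_smul 2))

theorem dyadic_ne_zero {η : 𝔼} (h : dyadic η ≠ 0) : 1 / 2 ≤ ‖η‖ ∧ ‖η‖ ≤ 2 := by
  constructor
  · by_contra! h1
    refine h ?_
    rw [dyadic, bump_eq_one (by linarith), bump_eq_one (by rw [norm_smul]; norm_num; linarith),
      sub_self]
  · by_contra! h1
    refine h ?_
    rw [dyadic, bump_eq_zero h1.le, bump_eq_zero (by rw [norm_smul]; norm_num; linarith), sub_self]

/-- The amplitude `χ / Φ_δ` on the unit shell. -/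
noncomputable def shellAmp (P : MvPolynomial (Fin n) ℝ) (m : ℕ) (δ : ℝ) (η : 𝔼) : ℂ :=
  ((dyadic η / √(homSymbol P m (δ, η)) : ℝ) : ℂ)

theorem shellAmp_ne_zero {P : MvPolynomial (Fin n) ℝ} {δ : ℝ} {η : 𝔼}
    (h : shellAmp P m δ η ≠ 0) : 1 / 2 ≤ ‖η‖ ∧ ‖η‖ ≤ 2 :=
  dyadic_ne_zero fun h0 => h (by simp [shellAmp, h0])

theorem EllipticPositive.contDiff_phase {P : MvPolynomial (Fin n) ℝ} (hP : EllipticPositive P m)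
    {δ : ℝ} (hδ : 0 < δ) : ContDiff ℝ ∞ fun η : 𝔼 => √(homSymbol P m (δ, η)) :=
  ((contDiff_homSymbol P m).comp (by fun_prop : ContDiff ℝ ∞ fun η : 𝔼 => (δ, η))).sqrt
    fun η => (hP.homSymbol_pos (z := (δ, η)) hδ.le (by simp [hδ.ne'])).ne'

theorem EllipticPositive.contDiff_shellAmp {P : MvPolynomial (Fin n) ℝ}
    (hP : EllipticPositive P m) {δ : ℝ} (hδ : 0 < δ) : ContDiff ℝ ∞ (shellAmp P m δ) :=
  Complex.ofRealCLM.contDiff.comp (contDiff_dyadic.div (hP.contDiff_phase hδ) fun η =>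
    (Real.sqrt_pos.2 (hP.homSymbol_pos (z := (δ, η)) hδ.le (by simp [hδ.ne']))).ne')

/-- Phase and amplitude are jointly smooth near a compact set of `(δ, η)` which includes `δ = 0`.
This makes the lower-order terms of `P` harmless uniformly over the dyadic scales. -/
theorem EllipticPositive.exists_shell_bounds {P : MvPolynomial (Fin n) ℝ}
    (hP : EllipticPositive P m) (N : ℕ) : ∃ A : ℝ, 1 ≤ A ∧ ∀ δ : ℝ, 0 < δ → δ ≤ 1 →
      (∀ k ≤ N, ∀ η : 𝔼, 1 / 8 ≤ ‖η‖ → ‖η‖ ≤ 8 →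
        ‖iteratedFDeriv ℝ k (fun η : 𝔼 => √(homSymbol P m (δ, η))) η‖ ≤ A) ∧
      (∀ k ≤ N, ∀ η : 𝔼, ‖iteratedFDeriv ℝ k (shellAmp P m δ) η‖ ≤ A) := by
  set U : Set (ℝ × 𝔼) := {z | 0 < homSymbol P m z} with hU
  have hUo : IsOpen U := isOpen_lt continuous_const (contDiff_homSymbol P m).continuous
  set K : Set (ℝ × 𝔼) := Icc (0 : ℝ) 1 ×ˢ {η : 𝔼 | 1 / 8 ≤ ‖η‖ ∧ ‖η‖ ≤ 8} with hK
  have hKc : IsCompact K := by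
    refine isCompact_Icc.prod ((isCompact_closedBall 0 8).of_isClosed_subset
      ((isClosed_le continuous_const continuous_norm).inter
      (isClosed_le continuous_norm continuous_const)) fun η hη => by simpa using hη.2)
  have hKU : K ⊆ U := by
    rintro ⟨δ, η⟩ ⟨h1, h2⟩
    refine hP.homSymbol_pos h1.1 ?_
    rintro h
    rw [Prod.mk_eq_zero] at h
    have := h2.1
    rw [h.2, norm_zero] at this
    norm_num at this
  have hΦ : ContDiffOn ℝ ∞ (fun z => √(homSymbol P m z)) U :=
    (contDiff_homSymbol P m).contDiffOn.sqrt fun z hz => (ne_of_gt hz)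
  have ha : ContDiffOn ℝ ∞ (fun z : ℝ × 𝔼 => shellAmp P m z.1 z.2) U :=
    Complex.ofRealCLM.contDiff.comp_contDiffOn
      ((contDiff_dyadic.comp contDiff_snd).contDiffOn.div hΦ fun z hz => (Real.sqrt_pos.2 hz).ne')
  obtain ⟨A₁, hA₁⟩ := exists_norm_iteratedFDeriv_slice_le hUo hΦ hKc hKU N
  obtain ⟨A₂, hA₂⟩ := exists_norm_iteratedFDeriv_slice_le hUo ha hKc hKU N
  refine ⟨max 1 (max A₁ A₂), le_max_left _ _, fun δ hδ0 hδ1 => ⟨fun k hk η h1 h2 => ?_,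
    fun k hk η => ?_⟩⟩
  · exact (hA₁ k hk (δ, η) ⟨⟨hδ0.le, hδ1⟩, h1, h2⟩).trans
      ((le_max_left _ _).trans (le_max_right _ _))
  · by_cases h : iteratedFDeriv ℝ k (shellAmp P m δ) η = 0
    · rw [h, norm_zero]
      exact zero_le_one.trans (le_max_left _ _)
    · have h1 : η ∈ {η : 𝔼 | 1 / 2 ≤ ‖η‖ ∧ ‖η‖ ≤ 2} :=
        closure_minimal (fun η hη => shellAmp_ne_zero hη)
          ((isClosed_le continuous_const continuous_norm).inter
            (isClosed_le continuous_norm continuous_const)) (support_iteratedFDeriv_subset k h)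
      exact (hA₂ k hk (δ, η) ⟨⟨hδ0.le, hδ1⟩, by linarith [h1.1], by linarith [h1.2]⟩).trans
        ((le_max_right _ _).trans (le_max_right _ _))

end ShellBounds

end HigherOrderWave

namespace HigherOrderWave

/-! ### Linearity of the inverse Fourier integral. -/

section FourierLinear

variable {E : Type*} [NormedAddCommGroup E] [InnerProductSpace ℝ E] [FiniteDimensional ℝ E]
  [MeasurableSpace E] [BorelSpace E]

theorem fourierInv_add_apply {f g : E → ℂ} (hf : Integrable f) (hg : Integrable g) (x : E) :
    𝓕⁻ (fun η => f η + g η) x = 𝓕⁻ f x + 𝓕⁻ g x := by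
  rw [Real.fourierInv_eq_fourier_neg, Real.fourierInv_eq_fourier_neg,
    Real.fourierInv_eq_fourier_neg]
  exact (congrFun (VectorFourier.fourierIntegral_add (e := Real.fourierChar) (μ := volume)
    (L := innerₗ E) Real.continuous_fourierChar (continuous_inner (𝕜 := ℝ) (E := E)) hf hg) (-x))

theorem fourierInv_const_mul_apply (c : ℂ) (f : E → ℂ) (x : E) :
    𝓕⁻ (fun η => c * f η) x = c * 𝓕⁻ f x := by
  rw [Real.fourierInv_eq', Real.fourierInv_eq', ← integral_const_mul]
  refine integral_congr_ae (.of_forall fun η => ?_)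
  simp only [smul_eq_mul]
  ring

theorem fourierInv_sum_apply {ι : Type*} (s : Finset ι) {f : ι → E → ℂ}
    (hf : ∀ i ∈ s, Integrable (f i)) (x : E) :
    𝓕⁻ (fun η => ∑ i ∈ s, f i η) x = ∑ i ∈ s, 𝓕⁻ (f i) x := by
  classical
  induction s using Finset.induction_on with
  | empty => simp [Real.fourierInv_eq']
  | insert a s ha ih =>
    simp only [Finset.sum_insert ha]
    rw [fourierInv_add_apply (hf a (Finset.mem_insert_self _ _))
      (integrable_finsetSum _ fun i hi => hf i (Finset.mem_insert_of_mem hi)),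
      ih fun i hi => hf i (Finset.mem_insert_of_mem hi)]

theorem norm_sub_div_two_I_sq_le (a b : ℂ) :
    ‖(2 * Complex.I)⁻¹ * (a - b)‖ₑ ^ 2 ≤ ‖a‖ₑ ^ 2 + ‖b‖ₑ ^ 2 := by
  simp only [← ofReal_norm]
  rw [← ENNReal.ofReal_pow (norm_nonneg _), ← ENNReal.ofReal_pow (norm_nonneg _),
    ← ENNReal.ofReal_pow (norm_nonneg _), ← ENNReal.ofReal_add (by positivity) (by positivity)]
  refine ENNReal.ofReal_le_ofReal ?_
  have h := norm_sub_le a b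
  have h2 : ‖(2 * Complex.I)⁻¹ * (a - b)‖ = ‖a - b‖ / 2 := by
    rw [norm_mul, norm_inv]; simp; ring
  rw [h2]
  have h3 : ‖a - b‖ ^ 2 ≤ (‖a‖ + ‖b‖) ^ 2 := by gcongr
  nlinarith [sq_nonneg (‖a‖ - ‖b‖), norm_nonneg a, norm_nonneg b]

end FourierLinear

/-! ### The sine on the unit shell: dispersive part and small part. -/

section ShellDecomposition

open Set Metric

variable {n m : ℕ}

local notation "𝔼" => EuclideanSpace ℝ (Fin n)

/-- The good set is where the polynomial determinant is at least `c ε`; the Hessian is bounded below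
by `ε` there, and the rest of the shell has volume `O(ε^σ)`. The sine is the difference of two
exponentials, so the packet decomposition is used for `φ` and `-φ` with the same good set. -/
theorem EllipticPositive.exists_shell_decomposition {P : MvPolynomial (Fin n) ℝ}
    (hP : EllipticPositive P m) : ∃ C σ : ℝ, 0 < C ∧ 0 < σ ∧ ∀ δ τ ε : ℝ, 0 < δ → δ ≤ 1 → 0 < τ →
      0 < ε → ε ≤ 1 → ∃ g b : 𝔼 → ℂ, Integrable g ∧ Integrable b ∧
        (∀ η, shellAmp P m δ η * (Real.sin (τ⁻¹ ^ 2 * √(homSymbol P m (δ, η))) : ℂ) = g η + b η) ∧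
        (∀ x, ‖𝓕⁻ g x‖ ≤ C * (ε ^ (2 * n))⁻¹ * τ ^ n) ∧
        ∫⁻ η, ‖b η‖ₑ ^ 2 ≤ ENNReal.ofReal (C * ε ^ σ) := by
  obtain ⟨A, hA1, hA⟩ := hP.exists_shell_bounds (n + 3)
  obtain ⟨C₁, hC₁, hosc⟩ := exists_oscillatory_decomposition (E := 𝔼) A hA1
  rw [finrank_euclideanSpace_fin] at hosc
  obtain ⟨c, hc, hdet⟩ := hP.exists_det_mul_norm_le
  obtain ⟨e, he, hDe⟩ := hP.exists_det_ne_zero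
  have hN : n * (2 * m - 2) ≠ 0 := by
    have h1 := hP.two_le_dim
    have h2 := hP.four_le_order
    exact Nat.mul_ne_zero (by omega) (by omega)
  obtain ⟨C₂, hC₂, hsub⟩ := exists_volume_polyEval_lt_le hN hP.isHomogeneous_det_hessMatrix he hDe
  set σ : ℝ := (1 : ℝ) / (n * (2 * m - 2) : ℕ) with hσ
  have hσ0 : 0 < σ := by
    rw [hσ]; have := Nat.pos_of_ne_zero hN; positivity
  set V := (volume : Measure 𝔼).real (closedBall 0 2) with hV
  have hV0 : 0 ≤ V := measureReal_nonneg
  set C := C₁ + A * V * 8 ^ n + 2 * (C₁ * (C₂ * c ^ σ)) with hC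
  have hC0 : 0 < C := by positivity
  refine ⟨C, σ, hC0, hσ0, fun δ τ ε hδ0 hδ1 hτ0 hε0 hε1 => ?_⟩
  set φ : 𝔼 → ℝ := fun η => √(homSymbol P m (δ, η)) with hφ
  set a := shellAmp P m δ with ha
  have hφs : ContDiff ℝ ∞ φ := hP.contDiff_phase hδ0
  have has : ContDiff ℝ ∞ a := hP.contDiff_shellAmp hδ0
  have hac : HasCompactSupport a := HasCompactSupport.of_support_subset_isCompact
    (isCompact_closedBall 0 2) fun η hη => by simpa using (shellAmp_ne_zero hη).2
  -- For `τ > 1/8` no oscillation is needed: the trivial bound has the required form with `b = 0`,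
  -- because `8τ ≥ 1` and `ε⁻¹ ≥ 1`.
  rcases le_or_gt τ (1 / 8) with hτ1 | hτ1
  swap
  · have hcont : Continuous fun η => a η * (Real.sin (τ⁻¹ ^ 2 * φ η) : ℂ) := by
      have h1 := has.continuous
      have h2 := hφs.continuous
      fun_prop
    have hint : Integrable fun η => a η * (Real.sin (τ⁻¹ ^ 2 * φ η) : ℂ) :=
      hcont.integrable_of_hasCompactSupport hac.mul_right
    refine ⟨_, fun _ => 0, hint, integrable_zero _ _ _, fun η => (add_zero _).symm, fun x => ?_,
      by simp⟩
    refine (norm_fourierInv_le_integral_norm _ x).trans ?_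
    have h1 : ∫ η, ‖a η * (Real.sin (τ⁻¹ ^ 2 * φ η) : ℂ)‖ ≤ A * V := by
      rw [← setIntegral_eq_integral_of_forall_compl_eq_zero (s := closedBall 0 2)]
      · have h2 := norm_setIntegral_le_of_norm_le_const (μ := volume) (s := closedBall (0 : 𝔼) 2)
          (f := fun η => ‖a η * (Real.sin (τ⁻¹ ^ 2 * φ η) : ℂ)‖) (C := A)
          measure_closedBall_lt_top (fun η _ => by
            rw [norm_norm, norm_mul, Complex.norm_real, Real.norm_eq_abs]
            have h3 := (hA δ hδ0 hδ1).2 0 (by omega) η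
            rw [norm_iteratedFDeriv_zero] at h3
            have h4 := Real.abs_sin_le_one (τ⁻¹ ^ 2 * φ η)
            calc _ ≤ A * 1 := by gcongr
              _ = A := mul_one A)
        exact (Real.le_norm_self _).trans h2
      · intro η hη
        have : a η = 0 := by
          by_contra h
          exact hη (by simpa using (shellAmp_ne_zero h).2)
        simp [this]
    have h2 : 1 ≤ (ε ^ (2 * n))⁻¹ := (one_le_inv₀ (by positivity)).2 (pow_le_one₀ hε0.le hε1)
    have h3 : 1 ≤ (8 * τ) ^ n := one_le_pow₀ (by linarith)
    calc _ ≤ A * V := h1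
      _ = A * V * 1 * 1 := by ring
      _ ≤ A * V * (ε ^ (2 * n))⁻¹ * (8 * τ) ^ n := by gcongr
      _ = A * V * 8 ^ n * (ε ^ (2 * n))⁻¹ * τ ^ n := by rw [mul_pow]; ring
      _ ≤ C * (ε ^ (2 * n))⁻¹ * τ ^ n := by
        gcongr
        have : 0 < C₁ * (C₂ * c ^ σ) := by positivity
        rw [hC]; linarith
  set D := (hessMatrix P m).det
  set S : Set 𝔼 := {ζ ∈ shell 𝔼 | c * ε ≤ |polyEval D (consL n (δ, ζ))|} with hS
  have hSm : MeasurableSet S := by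
    refine measurableSet_shell.inter (s₂ := {ζ | c * ε ≤ |polyEval D (consL n (δ, ζ))|})
      (measurableSet_le measurable_const ?_)
    have := (continuous_polyEval D).comp ((consL n).continuous.comp
      (by fun_prop : Continuous fun ζ : 𝔼 => (δ, ζ)))
    exact this.abs.measurable
  have hSs : S ⊆ shell 𝔼 := fun ζ hζ => hζ.1
  have hSε : ∀ ζ ∈ S, ∀ v, ε * ‖v‖ ≤ ‖fderiv ℝ (fderiv ℝ φ) ζ v‖ := by
    intro ζ hζ v
    have h1 := hdet δ hδ0 hδ1 ζ hζ.1 v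
    have h2 : c * ε * ‖v‖ ≤ |polyEval D (consL n (δ, ζ))| * ‖v‖ := by
      have := hζ.2; gcongr
    have h3 := h2.trans h1
    rw [mul_assoc] at h3
    exact le_of_mul_le_mul_left h3 hc
  have hvol : volume (shell 𝔼 \ S) ≤ ENNReal.ofReal (C₂ * c ^ σ * ε ^ σ) := by
    have h1 := hsub δ (c * ε) (by positivity)
    rw [Real.mul_rpow hc.le hε0.le, ← mul_assoc] at h1
    refine le_trans (measure_mono fun ζ hζ => ?_) h1
    refine ⟨hζ.1, ?_⟩
    by_contra! h
    exact hζ.2 ⟨hζ.1, h⟩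
  have hneg1 : fderiv ℝ (fun η => -φ η) = fun η => -fderiv ℝ φ η := funext fun η => fderiv_fun_neg
  obtain ⟨g₁, b₁, hg₁, hb₁, hgb₁, hG₁, hB₁⟩ := hosc φ a hφs has
    (fun k hk => (hA δ hδ0 hδ1).1 k hk) (fun k hk => (hA δ hδ0 hδ1).2 k (by omega))
    (fun η hη => shellAmp_ne_zero hη) ε S hε0 hε1 hSm hSs hSε τ hτ0 hτ1
  obtain ⟨g₂, b₂, hg₂, hb₂, hgb₂, hG₂, hB₂⟩ := hosc (fun η => -φ η) a hφs.neg has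
    (fun k hk η h1 h2 => by
      have : iteratedFDeriv ℝ k (fun η => -φ η) = -iteratedFDeriv ℝ k φ := iteratedFDeriv_neg ..
      rw [this, Pi.neg_apply, norm_neg]
      exact (hA δ hδ0 hδ1).1 k hk η h1 h2) (fun k hk => (hA δ hδ0 hδ1).2 k (by omega))
    (fun η hη => shellAmp_ne_zero hη) ε S hε0 hε1 hSm hSs (fun ζ hζ v => by
      rw [hneg1, fderiv_fun_neg, neg_apply, norm_neg]; exact hSε ζ hζ v) τ hτ0 hτ1
  refine ⟨fun η => (2 * Complex.I)⁻¹ * (g₁ η + -1 * g₂ η), fun η => (2 * Complex.I)⁻¹ * (b₁ η - b₂ η),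
    (hg₁.add (hg₂.const_mul _)).const_mul _, (hb₁.sub hb₂).const_mul _, fun η => ?_, fun x => ?_, ?_⟩
  · have h1 := hgb₁ η
    have h2 := hgb₂ η
    have h3 : (Real.sin (τ⁻¹ ^ 2 * φ η) : ℂ) = (2 * Complex.I)⁻¹ *
        (Complex.exp (((τ⁻¹ ^ 2 * φ η : ℝ) : ℂ) * Complex.I) -
          Complex.exp (((τ⁻¹ ^ 2 * -φ η : ℝ) : ℂ) * Complex.I)) := by
      rw [Complex.ofReal_sin, Complex.sin, mul_neg, Complex.ofReal_neg, mul_inv, Complex.inv_I]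
      ring
    rw [h3]
    linear_combination (2 * Complex.I)⁻¹ * (h1 - h2)
  · rw [fourierInv_const_mul_apply, fourierInv_add_apply hg₁ (hg₂.const_mul _),
      fourierInv_const_mul_apply, norm_mul]
    have h1 := norm_sub_le (𝓕⁻ g₁ x) (𝓕⁻ g₂ x)
    have h2 : ‖(2 * Complex.I)⁻¹‖ = 1 / 2 := by simp
    rw [h2, neg_one_mul, ← sub_eq_add_neg]
    have h3 : C₁ * (ε ^ (2 * n))⁻¹ * τ ^ n ≤ C * (ε ^ (2 * n))⁻¹ * τ ^ n := by
      gcongr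
      have : 0 < C₁ * (C₂ * c ^ σ) := by positivity
      have : 0 ≤ A * V * 8 ^ n := by positivity
      rw [hC]; linarith
    linarith [hG₁ x, hG₂ x]
  · refine (lintegral_mono fun η => norm_sub_div_two_I_sq_le (b₁ η) (b₂ η)).trans ?_
    rw [lintegral_add_left' (hb₁.1.enorm.pow_const 2)]
    calc _ ≤ ENNReal.ofReal C₁ * volume (shell 𝔼 \ S) + ENNReal.ofReal C₁ * volume (shell 𝔼 \ S) :=
          add_le_add hB₁ hB₂
      _ ≤ ENNReal.ofReal C₁ * ENNReal.ofReal (C₂ * c ^ σ * ε ^ σ) +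
          ENNReal.ofReal C₁ * ENNReal.ofReal (C₂ * c ^ σ * ε ^ σ) := by gcongr
      _ = ENNReal.ofReal (2 * (C₁ * (C₂ * c ^ σ)) * ε ^ σ) := by
          rw [← ENNReal.ofReal_mul hC₁.le, ← ENNReal.ofReal_add (by positivity) (by positivity)]
          congr 1; ring
      _ ≤ _ := by
          gcongr
          have : 0 ≤ A * V * 8 ^ n := by positivity
          rw [hC]; linarith

end ShellDecomposition

end HigherOrderWave

namespace HigherOrderWave

/-! ### Rescaling to the frequencies of size `2^j`. -/

section Dyadic

open Set Metric

theorem fourierInv_comp_smul {E : Type*} [NormedAddCommGroup E] [InnerProductSpace ℝ E]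
    [FiniteDimensional ℝ E] [MeasurableSpace E] [BorelSpace E] (f : E → ℂ) {r : ℝ} (hr : 0 < r)
    (x : E) : 𝓕⁻ (fun ξ => f (r⁻¹ • ξ)) x = (r ^ Module.finrank ℝ E : ℝ) • 𝓕⁻ f (r • x) := by
  rw [Real.fourierInv_eq', Real.fourierInv_eq']
  have h := Measure.integral_comp_smul (volume : Measure E)
    (fun η => Complex.exp (↑(2 * Real.pi * inner ℝ η (r • x)) * Complex.I) • f η) r⁻¹
  rw [inv_pow, inv_inv, abs_of_pos (by positivity)] at h
  rw [← h]
  refine integral_congr_ae (.of_forall fun ξ => ?_)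
  simp only [real_inner_smul_left, real_inner_smul_right]
  rw [mul_inv_cancel_left₀ hr.ne']

theorem lintegral_comp_inv_smul {E : Type*} [NormedAddCommGroup E] [InnerProductSpace ℝ E]
    [FiniteDimensional ℝ E] [MeasurableSpace E] [BorelSpace E] (f : E → ℝ≥0∞) {r : ℝ} (hr : 0 < r) :
    ∫⁻ ξ, f (r⁻¹ • ξ) = ENNReal.ofReal (r ^ Module.finrank ℝ E) * ∫⁻ ξ, f ξ := by
  have h0 : r⁻¹ ≠ 0 := (inv_pos.2 hr).ne'
  have h1 : ∫⁻ ξ, f ξ ∂(Measure.map (r⁻¹ • ·) volume) = ∫⁻ ξ, f (r⁻¹ • ξ) :=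
    lintegral_map_equiv (μ := (volume : Measure E)) f (MeasurableEquiv.smul₀ r⁻¹ h0)
  rw [← h1, Measure.map_addHaar_smul _ h0, lintegral_smul_measure, inv_pow, inv_inv,
    abs_of_pos (by positivity), smul_eq_mul]

variable {n m : ℕ}

local notation "𝔼" => EuclideanSpace ℝ (Fin n)

theorem EllipticPositive.sqrt_polyEval_eq {P : MvPolynomial (Fin n) ℝ} (hP : EllipticPositive P m)
    {l : ℕ} (hl : m = 2 * l) {r : ℝ} (hr : 0 < r) (ξ : 𝔼) :
    √(polyEval P ((2 * Real.pi) • ξ)) = r ^ l * √(homSymbol P m (r⁻¹, r⁻¹ • ξ)) := by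
  have h1 : ((1 : ℝ), ξ) = r • (r⁻¹, r⁻¹ • ξ) := by
    simp [smul_smul, hr.ne']
  rw [← homSymbol_one P m, h1, hP.homSymbol_smul, hl, mul_comm 2 l, pow_mul,
    Real.sqrt_mul (by positivity), Real.sqrt_sq (by positivity)]

/-- Decomposition of a dyadic piece of the sine multiplier, in the critical dimension. -/
theorem EllipticPositive.exists_dyadic_decomposition {P : MvPolynomial (Fin n) ℝ}
    (hP : EllipticPositive P n) {l : ℕ} (hl : n = 2 * l) : ∃ C σ : ℝ, 0 < C ∧ 0 < σ ∧
      ∀ (t : ℝ) (j : ℕ) (ε : ℝ), 0 < t → 0 < ε → ε ≤ 1 →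
      ∃ g b : 𝔼 → ℂ, Integrable g ∧ Integrable b ∧
        (∀ ξ, ((sineSymbol P t ((2 * Real.pi) • ξ) * dyadic (((2 : ℝ) ^ j)⁻¹ • ξ) : ℝ) : ℂ) =
          g ξ + b ξ) ∧
        (∀ x, ‖𝓕⁻ g x‖ ≤ C * (ε ^ (2 * n))⁻¹ * ((t * 2 ^ (j * (l - 1))) ^ l)⁻¹) ∧
        ∫⁻ ξ, ‖b ξ‖ₑ ^ 2 ≤ ENNReal.ofReal (C * ε ^ σ) := by
  obtain ⟨C, σ, hC, hσ, h⟩ := hP.exists_shell_decomposition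
  refine ⟨C, σ, hC, hσ, fun t j ε ht hε0 hε1 => ?_⟩
  have hl1 : 1 ≤ l := by have := hP.four_le_order; omega
  set r : ℝ := 2 ^ j with hr
  have hr0 : 0 < r := by positivity
  have hr1 : 1 ≤ r := one_le_pow₀ (by norm_num)
  -- After scaling by `r` the phase is `t r^l` times the normalised one, and `τ⁻²` must be this
  -- factor.
  set τ := (√(t * r ^ l))⁻¹ with hτ
  have hτ0 : 0 < τ := inv_pos.2 (Real.sqrt_pos.2 (by positivity))
  have hτ2 : τ⁻¹ ^ 2 = t * r ^ l := by rw [hτ, inv_inv, Real.sq_sqrt (by positivity)]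
  obtain ⟨g, b, hg, hb, hgb, hG, hB⟩ := h r⁻¹ τ ε (by positivity) (inv_le_one_of_one_le₀ hr1) hτ0
    hε0 hε1
  set κ : ℂ := (((r ^ l)⁻¹ : ℝ) : ℂ) with hκ
  have hκn : ‖κ‖ = (r ^ l)⁻¹ := by rw [hκ, Complex.norm_of_nonneg (by positivity)]
  have hκe : ‖κ‖ₑ = ENNReal.ofReal (r ^ l)⁻¹ := by rw [← ofReal_norm, hκn]
  refine ⟨fun ξ => κ * g (r⁻¹ • ξ), fun ξ => κ * b (r⁻¹ • ξ), (hg.comp_smul (by positivity)).const_mul _,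
    (hb.comp_smul (by positivity)).const_mul _, fun ξ => ?_, fun x => ?_, ?_⟩
  · rw [← mul_add, ← hgb, hτ2, hκ, shellAmp, sineSymbol, hP.sqrt_polyEval_eq hl hr0]
    push_cast
    have hp : 0 < homSymbol P n (r⁻¹, r⁻¹ • ξ) :=
      hP.homSymbol_pos (by positivity) (by simp [hr0.ne'])
    have h2 : (√(homSymbol P n (r⁻¹, r⁻¹ • ξ)) : ℂ) ≠ 0 := by
      exact_mod_cast (Real.sqrt_pos.2 hp).ne'
    have h3 : (r : ℂ) ≠ 0 := by exact_mod_cast hr0.ne'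
    have h4 : (t : ℂ) * (r : ℂ) ^ l * (√(homSymbol P n (r⁻¹, r⁻¹ • ξ)) : ℂ) =
        (r : ℂ) ^ l * (√(homSymbol P n (r⁻¹, r⁻¹ • ξ)) : ℂ) * t := by ring
    rw [h4]
    field_simp
  · rw [fourierInv_const_mul_apply, fourierInv_comp_smul _ hr0, norm_mul, hκn, norm_smul,
      finrank_euclideanSpace_fin, Real.norm_of_nonneg (by positivity)]
    have h1 := hG (r • x)
    have h2 : τ ^ n = ((t * r ^ l) ^ l)⁻¹ := by
      conv_lhs => rw [hl]
      rw [pow_mul, ← inv_inv (τ ^ 2), ← inv_pow τ 2, hτ2, inv_pow]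
    -- Amplitude `r^{-l}`, Jacobian `r^n` and dispersion `(t r^l)^{-l}` combine, for `n = 2l`, to
    -- `(t r^{l-1})^{-l}`.
    have h3 : (r ^ l)⁻¹ * r ^ n * ((t * r ^ l) ^ l)⁻¹ = ((t * 2 ^ (j * (l - 1))) ^ l)⁻¹ := by
      rw [pow_mul, ← hr]
      conv_lhs => rw [hl]
      obtain ⟨k, rfl⟩ : ∃ k, l = k + 1 := ⟨l - 1, by omega⟩
      rw [Nat.add_sub_cancel]
      have e1 : r ^ (2 * (k + 1)) = r ^ (k + 1) * r ^ (k + 1) := by ring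
      have e2 : t * r ^ (k + 1) = t * r ^ k * r := by ring
      rw [e1, inv_mul_cancel_left₀ (by positivity), e2, mul_pow (t * r ^ k) r, mul_inv,
        mul_left_comm, mul_inv_cancel₀ (by positivity), mul_one]
    calc _ ≤ (r ^ l)⁻¹ * (r ^ n * (C * (ε ^ (2 * n))⁻¹ * τ ^ n)) := by gcongr
      _ = C * (ε ^ (2 * n))⁻¹ * ((r ^ l)⁻¹ * r ^ n * ((t * r ^ l) ^ l)⁻¹) := by rw [h2]; ring
      _ ≤ _ := by rw [h3]
  · simp_rw [enorm_mul, mul_pow, hκe]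
    rw [lintegral_const_mul' _ _ (by finiteness), lintegral_comp_inv_smul (fun ξ => ‖b ξ‖ₑ ^ 2) hr0,
      finrank_euclideanSpace_fin, ← mul_assoc, ← ENNReal.ofReal_pow (by positivity),
      ← ENNReal.ofReal_mul (by positivity)]
    -- Criticality: the `L²` norm is invariant under this scaling, so summability over the shells
    -- can come only from the factor `ε^σ`.
    have h3 : (r ^ l)⁻¹ ^ 2 * r ^ n = 1 := by
      conv_lhs => rw [hl]
      rw [inv_pow, ← pow_mul, mul_comm l 2, inv_mul_cancel₀ (by positivity)]
    rw [h3, ENNReal.ofReal_one, one_mul]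
    exact hB

end Dyadic

end HigherOrderWave

namespace HigherOrderWave

/-! ### Weighted Plancherel and the gradient of the truncated multiplier. -/

section WeightedPlancherel

open Set Metric

variable {n m : ℕ}

local notation "𝔼" => EuclideanSpace ℝ (Fin n)

theorem norm_fourierInv_fderiv_apply {f : 𝔼 → ℂ} (hf : ContDiff ℝ 1 f) (hc : HasCompactSupport f)
    (e x : 𝔼) : ‖𝓕⁻ (fun ξ => fderiv ℝ f ξ e) x‖ = 2 * Real.pi * |inner ℝ x e| * ‖𝓕⁻ f x‖ := by
  have hi : Integrable f := hf.continuous.integrable_of_hasCompactSupport hc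
  have hi' : Integrable (fderiv ℝ f) :=
    (hf.continuous_fderiv (by simp)).integrable_of_hasCompactSupport (hc.fderiv ℝ)
  have h := Real.fourier_fderiv hi (hf.differentiable (by simp)) hi'
  have h1 : 𝓕 (fun ξ => fderiv ℝ f ξ e) (-x) = 𝓕 (fderiv ℝ f) (-x) e :=
    (Real.fourier_continuousLinearMap_apply hi').symm
  rw [Real.fourierInv_eq_fourier_neg, Real.fourierInv_eq_fourier_neg, h1, h,
    VectorFourier.fourierSMulRight_apply]
  simp only [norm_smul, neg_apply, norm_neg, norm_mul, Complex.norm_I, Complex.norm_real]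
  rw [map_neg, neg_apply, norm_neg, innerSL_apply_apply]
  simp [abs_of_pos Real.pi_pos, mul_assoc]

theorem lintegral_sq_norm_mul_fourierInv_le {f : 𝔼 → ℂ} (hf : ContDiff ℝ 1 f)
    (hc : HasCompactSupport f) : ∫⁻ x, (‖x‖ₑ * ‖𝓕⁻ f x‖ₑ) ^ 2 ≤ n * ∫⁻ ξ, ‖fderiv ℝ f ξ‖ₑ ^ 2 := by
  have hi : ∀ e : 𝔼, Integrable (fun ξ => fderiv ℝ f ξ e) := fun e =>
    ((hf.continuous_fderiv (by simp)).clm_apply continuous_const).integrable_of_hasCompactSupport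
      (hc.fderiv_apply ℝ e)
  have hpt : ∀ x : 𝔼, (‖x‖ₑ * ‖𝓕⁻ f x‖ₑ) ^ 2 ≤ ∑ i : Fin n,
      ‖𝓕⁻ (fun ξ => fderiv ℝ f ξ (EuclideanSpace.single i 1)) x‖ₑ ^ 2 := by
    intro x
    simp only [← ofReal_norm]
    rw [← ENNReal.ofReal_mul (norm_nonneg _), ← ENNReal.ofReal_pow (by positivity)]
    simp_rw [← ENNReal.ofReal_pow (norm_nonneg _)]
    rw [← ENNReal.ofReal_sum_of_nonneg fun i _ => by positivity]
    refine ENNReal.ofReal_le_ofReal ?_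
    simp_rw [norm_fourierInv_fderiv_apply hf hc, mul_pow]
    rw [← Finset.sum_mul, ← Finset.mul_sum, EuclideanSpace.norm_sq_eq]
    gcongr
    have h1 : ∑ i : Fin n, |inner ℝ x (EuclideanSpace.single i (1 : ℝ))| ^ 2 = ∑ i, ‖x i‖ ^ 2 := by
      simp [EuclideanSpace.inner_single_right]
    rw [h1]
    have h2 : (1 : ℝ) ≤ 2 ^ 2 * Real.pi ^ 2 := by nlinarith [Real.pi_gt_three]
    exact le_mul_of_one_le_left (Finset.sum_nonneg fun _ _ => by positivity) h2
  calc _ ≤ ∫⁻ x, ∑ i : Fin n,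
        ‖𝓕⁻ (fun ξ => fderiv ℝ f ξ (EuclideanSpace.single i 1)) x‖ₑ ^ 2 := lintegral_mono hpt
    _ = ∑ i : Fin n, ∫⁻ x,
        ‖𝓕⁻ (fun ξ => fderiv ℝ f ξ (EuclideanSpace.single i 1)) x‖ₑ ^ 2 :=
        lintegral_finsetSum' _ fun i _ =>
          ((continuous_fourierInv (hi _)).aemeasurable.enorm.pow_const 2)
    _ ≤ ∑ i : Fin n, ∫⁻ ξ, ‖fderiv ℝ f ξ‖ₑ ^ 2 := by
        refine Finset.sum_le_sum fun i _ => (lintegral_fourierInv_sq_le (hi _)).trans ?_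
        refine lintegral_mono fun ξ => ?_
        refine pow_le_pow_left₀ zero_le ?_ 2
        rw [← ofReal_norm, ← ofReal_norm]
        refine ENNReal.ofReal_le_ofReal ?_
        simpa using (fderiv ℝ f ξ).le_opNorm (EuclideanSpace.single i 1)
    _ = _ := by simp

/-- The sine multiplier, truncated to the frequencies of size `2 ^ J`. -/
noncomputable def lowSymbol (P : MvPolynomial (Fin n) ℝ) (t : ℝ) (J : ℕ) (ξ : 𝔼) : ℂ :=
  ((sineSymbol P t ((2 * Real.pi) • ξ) * bump n (((2 : ℝ) ^ J)⁻¹ • ξ) : ℝ) : ℂ)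

theorem lowSymbol_eq_zero {P : MvPolynomial (Fin n) ℝ} {t : ℝ} {J : ℕ} {ξ : 𝔼}
    (h : 2 ^ (J + 1) ≤ ‖ξ‖) : lowSymbol P t J ξ = 0 := by
  rw [lowSymbol, bump_eq_zero, mul_zero, Complex.ofReal_zero]
  rw [norm_smul, norm_inv, Real.norm_of_nonneg (by positivity), ← div_eq_inv_mul,
    le_div_iff₀ (by positivity), ← pow_succ']
  exact h

theorem hasCompactSupport_lowSymbol (P : MvPolynomial (Fin n) ℝ) (t : ℝ) (J : ℕ) :
    HasCompactSupport (lowSymbol P t J) :=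
  HasCompactSupport.of_support_subset_isCompact (isCompact_closedBall 0 (2 ^ (J + 1)))
    fun ξ hξ => by
      by_contra h
      rw [mem_closedBall, dist_zero_right, not_le] at h
      exact hξ (lowSymbol_eq_zero h.le)

theorem EllipticPositive.contDiff_lowSymbol {P : MvPolynomial (Fin n) ℝ} (hP : EllipticPositive P m)
    (t : ℝ) (J : ℕ) : ContDiff ℝ ∞ (lowSymbol P t J) := by
  have h1 := (hP.hasTemperateGrowth_sineSymbol t).1
  have h2 : ContDiff ℝ ∞ fun ξ : 𝔼 => ((bump n (((2 : ℝ) ^ J)⁻¹ • ξ) : ℝ) : ℂ) :=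
    Complex.ofRealCLM.contDiff.comp ((bump n).contDiff.comp (contDiff_const_smul _))
  convert! h1.mul h2 using 1
  ext ξ
  simp [lowSymbol]

theorem abs_sineSymbol_le (P : MvPolynomial (Fin n) ℝ) (t : ℝ) (ξ : 𝔼) :
    |sineSymbol P t ξ| ≤ |t| := by
  rw [sineSymbol, abs_div, abs_of_nonneg (Real.sqrt_nonneg _)]
  refine div_le_of_le_mul₀ (Real.sqrt_nonneg _) (abs_nonneg _) ?_
  have := Real.abs_sin_le_abs (x := √(polyEval P ξ) * t)
  rw [abs_mul, abs_of_nonneg (Real.sqrt_nonneg _)] at this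
  linarith

/-- The derivative of `s ↦ sin(st)/s` is at most `2|t|/s`, and the logarithmic gradient of `P` is
`O((1 + ‖ξ‖)⁻¹)`. Bounding the sine by its argument avoids a term without `t`. -/
theorem EllipticPositive.exists_hasFDerivAt_sineSymbol {P : MvPolynomial (Fin n) ℝ}
    (hP : EllipticPositive P m) : ∃ C : ℝ, 0 < C ∧ ∀ (t : ℝ) (ξ : 𝔼), ∃ L : 𝔼 →L[ℝ] ℝ,
      HasFDerivAt (fun ξ => sineSymbol P t ((2 * Real.pi) • ξ)) L ξ ∧
      ‖L‖ * (1 + ‖ξ‖) ≤ C * |t| := by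
  obtain ⟨c, hc, hlow⟩ := hP.exists_le_polyEval
  obtain ⟨C, hC, hup⟩ := hP.exists_norm_fderiv_polyEval_le
  refine ⟨C / c, by positivity, fun t ξ => ?_⟩
  set p : 𝔼 → ℝ := fun ξ => polyEval P ((2 * Real.pi) • ξ) with hp
  have hpd : Differentiable ℝ p :=
    ((hasTemperateGrowth_polyEval P).1.differentiable (by simp)).comp (by fun_prop)
  have hpos : 0 < p ξ := hP.pos _
  set s := √(p ξ) with hs
  have hs0 : 0 < s := Real.sqrt_pos.2 hpos
  have hs2 : s ^ 2 = p ξ := Real.sq_sqrt hpos.le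
  have h1 := (hpd ξ).hasFDerivAt.sqrt hpos.ne'
  have h2 : HasDerivAt (fun y => Real.sin (y * t) / y)
      ((Real.cos (s * t) * t * s - Real.sin (s * t) * 1) / s ^ 2) s :=
    ((hasDerivAt_id s).mul_const t |>.sin |>.fun_div (hasDerivAt_id s) hs0.ne').congr_deriv (by simp)
  have h3 : HasFDerivAt (fun ξ => sineSymbol P t ((2 * Real.pi) • ξ)) _ ξ :=
    HasDerivAt.comp_hasFDerivAt (h₂ := fun y => Real.sin (y * t) / y) ξ h2 h1
  refine ⟨_, h3, ?_⟩
  rw [norm_smul, norm_smul]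
  have e1 : ‖(Real.cos (s * t) * t * s - Real.sin (s * t) * 1) / s ^ 2‖ ≤ 2 * |t| / s := by
    rw [norm_div, Real.norm_of_nonneg (by positivity : 0 ≤ s ^ 2), div_le_div_iff₀ (by positivity) hs0]
    have h3 : |Real.sin (s * t)| ≤ s * |t| := by
      have := Real.abs_sin_le_abs (x := s * t)
      rwa [abs_mul, abs_of_pos hs0] at this
    have h4 : |Real.cos (s * t) * t * s| ≤ s * |t| := by
      rw [abs_mul, abs_mul, abs_of_pos hs0]
      have := Real.abs_cos_le_one (s * t)
      nlinarith [abs_nonneg t, mul_nonneg hs0.le (abs_nonneg t)]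
    have h5 := norm_sub_le (Real.cos (s * t) * t * s) (Real.sin (s * t) * 1)
    rw [mul_one, Real.norm_eq_abs, Real.norm_eq_abs, Real.norm_eq_abs] at h5
    rw [mul_one, Real.norm_eq_abs]
    nlinarith
  have e2 : ‖1 / (2 * s)‖ = 1 / (2 * s) := Real.norm_of_nonneg (by positivity)
  have e3 : ‖fderiv ℝ p ξ‖ * (1 + ‖ξ‖) ≤ C / c * p ξ := by
    have hm : m = (m - 1) + 1 := by have := hP.four_le_order; omega
    calc _ ≤ C * (1 + ‖ξ‖) ^ (m - 1) * (1 + ‖ξ‖) := by gcongr; exact hup ξ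
      _ = C / c * (c * (1 + ‖ξ‖) ^ m) := by
        conv_rhs => rw [hm, pow_succ]
        field_simp
      _ ≤ _ := by gcongr; exact hlow ξ
  calc _ ≤ 2 * |t| / s * (‖1 / (2 * s)‖ * ‖fderiv ℝ p ξ‖) * (1 + ‖ξ‖) := by gcongr
    _ = |t| / s ^ 2 * (‖fderiv ℝ p ξ‖ * (1 + ‖ξ‖)) := by rw [e2]; field_simp
    _ ≤ |t| / s ^ 2 * (C / c * p ξ) := by gcongr
    _ = C / c * |t| := by rw [← hs2]; field_simp

/-- Differentiating the cutoff costs `2^{-J}`, and `2^{-J} ‖ξ‖ ≤ 2` on the support, so the constant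
does not depend on `J`. -/
theorem EllipticPositive.exists_norm_fderiv_lowSymbol_le {P : MvPolynomial (Fin n) ℝ}
    (hP : EllipticPositive P m) : ∃ C : ℝ, 0 < C ∧ ∀ (t : ℝ) (J : ℕ) (ξ : 𝔼),
      ‖fderiv ℝ (lowSymbol P t J) ξ‖ * ‖ξ‖ ≤ C * |t| := by
  obtain ⟨C, hC, hS⟩ := hP.exists_hasFDerivAt_sineSymbol
  obtain ⟨B, hB⟩ := ((bump n).hasCompactSupport.fderiv ℝ).exists_bound_of_continuous
    ((bump n).contDiff.continuous_fderiv (n := 1) (by simp))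
  have hB0 : 0 ≤ B := (norm_nonneg _).trans (hB 0)
  refine ⟨C + 2 * B, by positivity, fun t J ξ => ?_⟩
  set r : ℝ := (2 ^ J)⁻¹ with hr
  have hr0 : 0 < r := by positivity
  by_cases hξ : ‖ξ‖ ≤ 2 ^ (J + 1)
  swap
  · have : fderiv ℝ (lowSymbol P t J) ξ = 0 := by
      by_contra h
      have h1 : ξ ∈ closedBall (0 : 𝔼) (2 ^ (J + 1)) :=
        closure_minimal (fun η hη => by
          by_contra h
          rw [mem_closedBall, dist_zero_right, not_le] at h
          exact hη (lowSymbol_eq_zero h.le)) isClosed_closedBall (support_fderiv_subset ℝ h)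
      exact hξ (by simpa using h1)
    rw [this, norm_zero, zero_mul]; positivity
  obtain ⟨L, hL, hLn⟩ := hS t ξ
  have h1 : HasFDerivAt (fun ξ : 𝔼 => bump n (r • ξ))
      ((fderiv ℝ (bump n) (r • ξ)).comp (r • ContinuousLinearMap.id ℝ 𝔼)) ξ :=
    (((bump n).contDiff (n := 1)).differentiable (by simp) (r • ξ)).hasFDerivAt.comp ξ
      ((ContinuousLinearMap.id ℝ 𝔼).hasFDerivAt.const_smul r)
  have h2 := Complex.ofRealCLM.hasFDerivAt.comp ξ (hL.fun_mul h1)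
  have h3 : HasFDerivAt (lowSymbol P t J) _ ξ := h2
  rw [h3.fderiv]
  have h4 : ‖(fderiv ℝ (bump n) (r • ξ)).comp (r • ContinuousLinearMap.id ℝ 𝔼)‖ ≤ B * r := by
    rw [ContinuousLinearMap.comp_smul, ContinuousLinearMap.comp_id, norm_smul,
      Real.norm_of_nonneg hr0.le, mul_comm]
    gcongr
    exact hB _
  have h5 : ‖Complex.ofRealCLM‖ = 1 := Complex.ofRealCLM_norm
  have h6 : |bump n (r • ξ)| ≤ 1 := by
    rw [abs_of_nonneg (bump n).nonneg]; exact (bump n).le_one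
  have h7 : r * ‖ξ‖ ≤ 2 := by
    rw [hr, ← div_eq_inv_mul, div_le_iff₀ (by positivity), ← pow_succ']; exact hξ
  refine (mul_le_mul_of_nonneg_right (ContinuousLinearMap.opNorm_comp_le _ _) (norm_nonneg _)).trans ?_
  rw [h5, one_mul]
  refine (mul_le_mul_of_nonneg_right (norm_add_le _ _) (norm_nonneg _)).trans ?_
  rw [norm_smul, norm_smul, Real.norm_eq_abs, Real.norm_eq_abs]
  have h8 := abs_sineSymbol_le P t ((2 * Real.pi) • ξ)
  calc _ ≤ (|t| * (B * r) + 1 * ‖L‖) * ‖ξ‖ := by gcongr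
    _ = |t| * B * (r * ‖ξ‖) + ‖L‖ * ‖ξ‖ := by ring
    _ ≤ |t| * B * 2 + ‖L‖ * (1 + ‖ξ‖) := by gcongr; linarith
    _ ≤ |t| * B * 2 + C * |t| := by gcongr
    _ = _ := by ring

end WeightedPlancherel

end HigherOrderWave

namespace HigherOrderWave

/-! ### Weak `L²` bound for the frequencies below the threshold. -/

section LowFrequencies

open Set Metric

variable {n m : ℕ}

local notation "𝔼" => EuclideanSpace ℝ (Fin n)

theorem EllipticPositive.integrable_lowSymbol {P : MvPolynomial (Fin n) ℝ}
    (hP : EllipticPositive P m) (t : ℝ) (J : ℕ) : Integrable (lowSymbol P t J) :=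
  (hP.contDiff_lowSymbol t J).continuous.integrable_of_hasCompactSupport
    (hasCompactSupport_lowSymbol P t J)

/-- The weight `|x|` becomes a gradient of size `|t| / ‖ξ‖`, and `∫ t² ‖ξ‖^{-2}` over `‖ξ‖ ≤
2^{J+1}` is a multiple of `(t 2^{J(l-1)})²`, as `n - 2 = 2(l-1)`. The quantity `t 2^{J(l-1)}` is the
distance travelled in time `t` at the frequency `2^J`. -/
theorem EllipticPositive.exists_lintegral_weight_le {P : MvPolynomial (Fin n) ℝ}
    (hP : EllipticPositive P n) {l : ℕ} (hl : n = 2 * l) : ∃ C : ℝ, 0 < C ∧ ∀ (t : ℝ) (J : ℕ),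
      ∫⁻ x, (‖x‖ₑ * ‖𝓕⁻ (lowSymbol P t J) x‖ₑ) ^ 2 ≤
        ENNReal.ofReal (C * (t * 2 ^ (J * (l - 1))) ^ 2) := by
  have hn := hP.four_le_order
  have : Nontrivial 𝔼 := by
    have : Nonempty (Fin n) := ⟨⟨0, by omega⟩⟩
    infer_instance
  obtain ⟨C, hC, hgrad⟩ := hP.exists_norm_fderiv_lowSymbol_le
  obtain ⟨c, hc, hint⟩ := exists_setLIntegral_closedBall_norm_rpow_le (E := 𝔼) (θ := 2) (by
    rw [finrank_euclideanSpace_fin]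
    have : (4 : ℝ) ≤ n := by exact_mod_cast hn
    linarith)
  rw [finrank_euclideanSpace_fin] at hint
  refine ⟨n * (C ^ 2 * (c * 2 ^ (2 * (l - 1)))), by positivity, fun t J => ?_⟩
  refine (lintegral_sq_norm_mul_fourierInv_le ((hP.contDiff_lowSymbol t J).of_le (by simp))
    (hasCompactSupport_lowSymbol P t J)).trans ?_
  have hpt : ∀ᵐ ξ : 𝔼, ‖fderiv ℝ (lowSymbol P t J) ξ‖ₑ ^ 2 ≤
      (closedBall (0 : 𝔼) (2 ^ (J + 1))).indicator
        (fun ξ => ENNReal.ofReal (C ^ 2 * t ^ 2) * ENNReal.ofReal (‖ξ‖ ^ (-2 : ℝ))) ξ := by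
    filter_upwards [compl_mem_ae_iff.2 (measure_singleton (μ := (volume : Measure 𝔼)) 0)] with ξ hξ
    have hξ0 : 0 < ‖ξ‖ := norm_pos_iff.2 hξ
    by_cases hξ1 : ξ ∈ closedBall (0 : 𝔼) (2 ^ (J + 1))
    · rw [indicator_of_mem hξ1, ← ENNReal.ofReal_mul (by positivity), ← ofReal_norm,
        ← ENNReal.ofReal_pow (norm_nonneg _)]
      refine ENNReal.ofReal_le_ofReal ?_
      have h1 := hgrad t J ξ
      rw [Real.rpow_neg hξ0.le, Real.rpow_ofNat, ← div_eq_mul_inv, le_div_iff₀ (by positivity),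
        ← mul_pow, ← sq_abs t, ← mul_pow]
      gcongr
    · have : fderiv ℝ (lowSymbol P t J) ξ = 0 := by
        by_contra h
        refine hξ1 (closure_minimal (fun η hη => ?_) isClosed_closedBall
          (support_fderiv_subset ℝ h))
        by_contra h
        rw [mem_closedBall, dist_zero_right, not_le] at h
        exact hη (lowSymbol_eq_zero h.le)
      rw [this, ← ofReal_norm, norm_zero]; simp
  calc (n : ℝ≥0∞) * ∫⁻ ξ, ‖fderiv ℝ (lowSymbol P t J) ξ‖ₑ ^ 2
      ≤ n * (ENNReal.ofReal (C ^ 2 * t ^ 2) *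
          ENNReal.ofReal (c * (2 ^ (J + 1)) ^ ((n : ℝ) - 2))) := by
        gcongr
        refine (lintegral_mono_ae hpt).trans ?_
        rw [lintegral_indicator measurableSet_closedBall,
          lintegral_const_mul' _ _ ENNReal.ofReal_ne_top]
        gcongr
        exact hint _ (by positivity)
    _ = _ := by
        rw [← ENNReal.ofReal_mul (by positivity), ← ENNReal.ofReal_natCast,
          ← ENNReal.ofReal_mul (by positivity)]
        congr 1
        have e1 : (n : ℝ) - 2 = ((2 * (l - 1) : ℕ) : ℝ) := by
          have : 2 * (l - 1) = n - 2 := by omega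
          rw [this, Nat.cast_sub (by omega)]
          norm_num
        rw [e1, Real.rpow_natCast, ← pow_mul, mul_pow, ← pow_mul]
        have e2 : (2 : ℝ) ^ ((J + 1) * (2 * (l - 1))) = 2 ^ (J * (l - 1) * 2) * 2 ^ (2 * (l - 1)) := by
          rw [← pow_add]; congr 1; ring
        rw [e2]; ring

/-- Inside the ball of radius `R = t 2^{J(l-1)}` the volume `≲ R^n` suffices, since the hypothesis
gives `R^n ≲ s^{-2}`; outside it, Chebyshev for `|x| K`. The index `J - 1` occurs because `J` will
be at most the first scale satisfying the reverse inequality. For `J = 0` the frequencies are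
bounded and plain Plancherel suffices, uniformly in `t`. -/
theorem EllipticPositive.exists_volume_lowSymbol_le {P : MvPolynomial (Fin n) ℝ}
    (hP : EllipticPositive P n) {l : ℕ} (hl : n = 2 * l) : ∃ C : ℝ, 0 < C ∧
      ∀ (t : ℝ) (J : ℕ) (s : ℝ), 0 < t → 0 < s →
      (J = 0 ∨ J ≠ 0 ∧ s ≤ ((t * 2 ^ ((J - 1) * (l - 1))) ^ l)⁻¹) →
      volume {x | ENNReal.ofReal s < ‖𝓕⁻ (lowSymbol P t J) x‖ₑ} ≤ ENNReal.ofReal (C / s ^ 2) := by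
  obtain ⟨C₁, hC₁, hQ⟩ := hP.exists_sineSymbol_le (κ := 0) le_rfl zero_le_one
  obtain ⟨C₂, hC₂, hW⟩ := hP.exists_lintegral_weight_le hl
  set V₂ := (volume : Measure 𝔼).real (closedBall 0 2) with hV₂
  set V := (volume : Measure 𝔼).real (closedBall 0 1) with hV
  have hV₂0 : 0 ≤ V₂ := measureReal_nonneg
  have hV0 : 0 ≤ V := measureReal_nonneg
  refine ⟨C₁ ^ 2 * V₂ + ((2 ^ (l - 1)) ^ n * V + C₂), by positivity, fun t J s ht hs hJ => ?_⟩
  have hKc : Continuous (𝓕⁻ (lowSymbol P t J)) := continuous_fourierInv (hP.integrable_lowSymbol t J)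
  have hs0 : ENNReal.ofReal s ≠ 0 := by simpa using hs
  rcases hJ with rfl | ⟨hJ0, hJ⟩
  · refine (volume_lt_enorm_le hKc.aemeasurable hs0 ENNReal.ofReal_ne_top).trans ?_
    have h1 : ∫⁻ ξ, ‖lowSymbol P t 0 ξ‖ₑ ^ 2 ≤ ENNReal.ofReal (C₁ ^ 2 * V₂) := by
      calc _ ≤ ∫⁻ ξ, (closedBall (0 : 𝔼) 2).indicator (fun _ => ENNReal.ofReal (C₁ ^ 2)) ξ := by
            refine lintegral_mono fun ξ => ?_
            by_cases hξ : ξ ∈ closedBall (0 : 𝔼) 2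
            · rw [indicator_of_mem hξ, ← ofReal_norm, ← ENNReal.ofReal_pow (norm_nonneg _)]
              refine ENNReal.ofReal_le_ofReal ?_
              gcongr
              rw [lowSymbol, Complex.norm_real, Real.norm_eq_abs, abs_mul]
              have h2 := (hQ t ξ).2
              simp only [zero_mul, zero_div, neg_zero, Real.rpow_zero, mul_one] at h2
              have h3 : |bump n (((2 : ℝ) ^ 0)⁻¹ • ξ)| ≤ 1 := by
                rw [abs_of_nonneg (bump n).nonneg]; exact (bump n).le_one
              calc _ ≤ C₁ * 1 := by gcongr
                _ = C₁ := mul_one _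
            · rw [lowSymbol_eq_zero]
              · simp
              · rw [mem_closedBall, dist_zero_right, not_le] at hξ
                simpa using hξ.le
        _ = _ := by
            rw [lintegral_indicator measurableSet_closedBall, setLIntegral_const, hV₂,
              ENNReal.ofReal_mul (by positivity), ofReal_measureReal measure_closedBall_lt_top.ne]
    calc _ ≤ ENNReal.ofReal (C₁ ^ 2 * V₂) / ENNReal.ofReal s ^ 2 := by
          gcongr
          exact (lintegral_fourierInv_sq_le (hP.integrable_lowSymbol t 0)).trans h1
      _ = ENNReal.ofReal (C₁ ^ 2 * V₂ / s ^ 2) := by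
          rw [← ENNReal.ofReal_pow hs.le, ENNReal.ofReal_div_of_pos (by positivity)]
      _ ≤ _ := by
          gcongr
          have : 0 ≤ (2 ^ (l - 1)) ^ n * V + C₂ := by positivity
          linarith
  set R := t * 2 ^ (J * (l - 1)) with hR
  have hR0 : 0 < R := by positivity
  have hRn : R ^ n ≤ (2 ^ (l - 1)) ^ n / s ^ 2 := by
    set R' := t * 2 ^ ((J - 1) * (l - 1)) with hR'
    have hR'0 : 0 < R' := by positivity
    have e1 : R = R' * 2 ^ (l - 1) := by
      rw [hR, hR', mul_assoc, ← pow_add]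
      congr 2
      obtain ⟨k, rfl⟩ : ∃ k, J = k + 1 := ⟨J - 1, by omega⟩
      rw [Nat.add_sub_cancel]; ring
    have e2 : R' ^ n ≤ (s ^ 2)⁻¹ := by
      conv_lhs => rw [hl]
      rw [mul_comm, pow_mul, ← inv_pow]
      gcongr
      rwa [le_inv_comm₀ hs (by positivity)] at hJ
    rw [e1, mul_pow, mul_comm, div_eq_mul_inv]
    gcongr
  have hsub : {x | ENNReal.ofReal s < ‖𝓕⁻ (lowSymbol P t J) x‖ₑ} ⊆ closedBall 0 R ∪
      {x | ENNReal.ofReal (R * s) < ‖(‖x‖ : ℂ) * 𝓕⁻ (lowSymbol P t J) x‖ₑ} := by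
    intro x hx
    by_cases hxR : ‖x‖ ≤ R
    · left; simpa using hxR
    · right
      push Not at hxR
      simp only [mem_ofPred_eq, ← ofReal_norm] at hx ⊢
      have hx' := (ENNReal.ofReal_lt_ofReal_iff_of_nonneg hs.le).1 hx
      rw [ENNReal.ofReal_lt_ofReal_iff_of_nonneg (by positivity), norm_mul, Complex.norm_real, norm_norm]
      exact mul_lt_mul'' hxR hx' hR0.le hs.le
  refine (measure_mono hsub).trans ((measure_union_le _ _).trans ?_)
  have hm : AEMeasurable (fun x : 𝔼 => (‖x‖ : ℂ) * 𝓕⁻ (lowSymbol P t J) x) :=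
    (by fun_prop : Continuous fun x : 𝔼 => (‖x‖ : ℂ) * 𝓕⁻ (lowSymbol P t J) x).aemeasurable
  have h1 : volume (closedBall (0 : 𝔼) R) ≤ ENNReal.ofReal ((2 ^ (l - 1)) ^ n * V / s ^ 2) := by
    rw [Measure.addHaar_closedBall' _ _ hR0.le, finrank_euclideanSpace_fin,
      ← ofReal_measureReal (measure_closedBall_lt_top (μ := volume) (x := (0 : 𝔼)) (r := 1)).ne,
      ← ENNReal.ofReal_mul (by positivity)]
    refine ENNReal.ofReal_le_ofReal ?_
    calc _ ≤ (2 ^ (l - 1)) ^ n / s ^ 2 * V := by gcongr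
      _ = _ := by ring
  have h2 : volume {x | ENNReal.ofReal (R * s) < ‖(‖x‖ : ℂ) * 𝓕⁻ (lowSymbol P t J) x‖ₑ} ≤
      ENNReal.ofReal (C₂ / s ^ 2) := by
    refine (volume_lt_enorm_le hm (by simpa using mul_pos hR0 hs) ENNReal.ofReal_ne_top).trans ?_
    have e1 : ∀ x : 𝔼, ‖(‖x‖ : ℂ) * 𝓕⁻ (lowSymbol P t J) x‖ₑ = ‖x‖ₑ * ‖𝓕⁻ (lowSymbol P t J) x‖ₑ := by
      intro x
      rw [enorm_mul]
      congr 1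
      rw [← ofReal_norm, Complex.norm_real, norm_norm, ofReal_norm]
    simp_rw [e1]
    calc _ ≤ ENNReal.ofReal (C₂ * R ^ 2) / ENNReal.ofReal (R * s) ^ 2 := by
          gcongr; exact hW t J
      _ = ENNReal.ofReal (C₂ / s ^ 2) := by
          rw [← ENNReal.ofReal_pow (by positivity), ← ENNReal.ofReal_div_of_pos (by positivity)]
          congr 1
          field_simp
  refine (add_le_add h1 h2).trans ?_
  rw [← ENNReal.ofReal_add (by positivity) (by positivity), ← add_div]
  refine ENNReal.ofReal_le_ofReal (div_le_div_of_nonneg_right ?_ (by positivity))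
  have : 0 ≤ C₁ ^ 2 * V₂ := by positivity
  linarith

end LowFrequencies

end HigherOrderWave

namespace HigherOrderWave

/-! ### Summation of the high frequencies and the weak `L²` bound for the kernels. -/

section KernelEstimate

open Set Metric

theorem lintegral_enorm_sq_eq {α : Type*} [MeasurableSpace α] {μ : Measure α} (f : α → ℂ) :
    ∫⁻ x, ‖f x‖ₑ ^ 2 ∂μ = eLpNorm f 2 μ ^ 2 := by
  rw [eLpNorm_eq_lintegral_rpow_enorm_toReal (by norm_num) (by norm_num)]
  simp only [ENNReal.toReal_ofNat, ENNReal.rpow_ofNat]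
  rw [← ENNReal.rpow_natCast, ← ENNReal.rpow_mul]
  norm_num

theorem sum_range_pow_succ_le {r : ℝ} (h0 : 0 ≤ r) (h1 : r < 1) (N : ℕ) :
    ∑ k ∈ Finset.range N, r ^ (k + 1) ≤ (1 - r)⁻¹ := by
  rw [← tsum_geometric_of_lt_one h0 h1]
  refine le_trans (Finset.sum_le_sum fun k _ => ?_)
    ((summable_geometric_of_lt_one h0 h1).sum_le_tsum (Finset.range N) fun _ _ => by positivity)
  exact pow_le_pow_of_le_one h0 h1.le (Nat.le_succ k)

variable {n m : ℕ}

local notation "𝔼" => EuclideanSpace ℝ (Fin n)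

theorem lowSymbol_add (P : MvPolynomial (Fin n) ℝ) (t : ℝ) (J K : ℕ) (ξ : 𝔼) :
    lowSymbol P t (J + K) ξ = lowSymbol P t J ξ + ∑ k ∈ Finset.range K,
      ((sineSymbol P t ((2 * Real.pi) • ξ) *
        dyadic (((2 : ℝ) ^ (J + (k + 1)))⁻¹ • ξ) : ℝ) : ℂ) := by
  induction K with
  | zero => simp
  | succ K ih =>
    rw [Finset.sum_range_succ, ← add_assoc (lowSymbol P t J ξ), ← ih, lowSymbol, lowSymbol, dyadic, smul_smul]
    have : (2 : ℝ) * (2 ^ (J + (K + 1)))⁻¹ = (2 ^ (J + K))⁻¹ := by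
      rw [← add_assoc, pow_succ]; field_simp
    rw [this, ← add_assoc]
    push_cast
    ring

theorem EllipticPositive.exists_high_decomposition {P : MvPolynomial (Fin n) ℝ}
    (hP : EllipticPositive P n) {l : ℕ} (hl : n = 2 * l) : ∃ C₁ C₂ : ℝ, 0 < C₁ ∧ 0 < C₂ ∧
      ∀ (t s : ℝ) (J K : ℕ), 0 < t → ((t * 2 ^ (J * (l - 1))) ^ l)⁻¹ ≤ s →
      ∃ G B : 𝔼 → ℂ, Integrable G ∧ Integrable B ∧
        (∀ ξ, lowSymbol P t (J + K) ξ = lowSymbol P t J ξ + (G ξ + B ξ)) ∧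
        (∀ x, ‖𝓕⁻ G x‖ ≤ C₁ * s) ∧ ∫⁻ ξ, ‖B ξ‖ₑ ^ 2 ≤ ENNReal.ofReal C₂ := by
  obtain ⟨C, σ, hC, hσ, hdec⟩ := hP.exists_dyadic_decomposition hl
  have hn := hP.four_le_order
  have hn0 : (0 : ℝ) < n := by have : 0 < n := by omega
                               exact_mod_cast this
  -- The piece `J + k + 1` is cut with `ε = ρ^{k+1}`. The sup bound loses `ε^{-2n} = κ^{-(k+1)}`,
  -- while dispersion gains at least `2^{-(k+1)} = κ^{2(k+1)}` because `l ≥ 2`; the `L²` norm of the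
  -- other part is `O(r^{k+1})`. Both are geometric.
  set ρ : ℝ := (1 / 2) ^ (1 / (4 * n : ℝ)) with hρ
  have hρ0 : 0 < ρ := by positivity
  have hρ1 : ρ < 1 := Real.rpow_lt_one (by norm_num) (by norm_num) (by positivity)
  set κ := ρ ^ (2 * n) with hκ
  have hκ0 : 0 < κ := by positivity
  have hκ1 : κ < 1 := pow_lt_one₀ hρ0.le hρ1 (by omega)
  have hκ2 : κ ^ 2 = 1 / 2 := by
    rw [hκ, ← pow_mul, hρ, ← Real.rpow_natCast, ← Real.rpow_mul (by norm_num)]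
    have : 1 / (4 * (n : ℝ)) * ((2 * n * 2 : ℕ) : ℝ) = 1 := by
      push_cast; field_simp; norm_num
    rw [this, Real.rpow_one]
  set r := ρ ^ (σ / 2) with hr
  have hr0 : 0 < r := by positivity
  have hr1 : r < 1 := Real.rpow_lt_one hρ0.le hρ1 (by positivity)
  have h1κ : 0 < 1 - κ := by linarith
  have h1r : 0 < 1 - r := by linarith
  refine ⟨C * (1 - κ)⁻¹, (√C * (1 - r)⁻¹) ^ 2, by positivity,
    by have := Real.sqrt_pos.2 hC; positivity, fun t s J K ht hJs => ?_⟩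
  have hs0 : 0 < s := lt_of_lt_of_le (by positivity) hJs
  choose g b hg hb hgb hG hB using fun k : ℕ => hdec t (J + (k + 1)) (ρ ^ (k + 1)) ht
    (by positivity) (pow_le_one₀ hρ0.le hρ1.le)
  refine ⟨fun ξ => ∑ k ∈ Finset.range K, g k ξ, fun ξ => ∑ k ∈ Finset.range K, b k ξ,
    integrable_finsetSum _ fun k _ => hg k, integrable_finsetSum _ fun k _ => hb k,
    fun ξ => ?_, fun x => ?_, ?_⟩
  · rw [lowSymbol_add, ← Finset.sum_add_distrib]
    simp_rw [hgb]
  · rw [fourierInv_sum_apply _ fun k _ => hg k]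
    refine (norm_sum_le _ _).trans ?_
    have hk : ∀ k, ‖𝓕⁻ (g k) x‖ ≤ C * s * κ ^ (k + 1) := by
      intro k
      refine (hG k x).trans ?_
      have e1 : (ρ ^ (k + 1)) ^ (2 * n) = κ ^ (k + 1) := by
        rw [hκ, ← pow_mul, ← pow_mul, mul_comm]
      have e2 : ((t * 2 ^ ((J + (k + 1)) * (l - 1))) ^ l)⁻¹ ≤ s * (κ ^ (k + 1) * κ ^ (k + 1)) := by
        have e3 : t * 2 ^ ((J + (k + 1)) * (l - 1)) =
            t * 2 ^ (J * (l - 1)) * 2 ^ ((k + 1) * (l - 1)) := by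
          rw [mul_assoc, ← pow_add]; congr 2; ring
        have e4 : κ ^ (k + 1) * κ ^ (k + 1) = (2 ^ (k + 1))⁻¹ := by
          rw [← mul_pow, ← sq, hκ2, one_div, inv_pow]
        rw [e3, mul_pow, mul_inv, e4]
        gcongr ?_ * ?_⁻¹
        rw [← pow_mul]
        have h1 : 1 ≤ l - 1 := by omega
        have h2 : 1 ≤ l := by omega
        refine pow_le_pow_right₀ (by norm_num) ?_
        calc k + 1 = (k + 1) * 1 * 1 := by ring
          _ ≤ (k + 1) * (l - 1) * l := by gcongr
      rw [e1]
      calc _ ≤ C * (κ ^ (k + 1))⁻¹ * (s * (κ ^ (k + 1) * κ ^ (k + 1))) := by gcongr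
        _ = _ := by field_simp
    calc _ ≤ ∑ k ∈ Finset.range K, C * s * κ ^ (k + 1) := Finset.sum_le_sum fun k _ => hk k
      _ = C * s * ∑ k ∈ Finset.range K, κ ^ (k + 1) := (Finset.mul_sum _ _ _).symm
      _ ≤ C * s * (1 - κ)⁻¹ := by gcongr; exact sum_range_pow_succ_le hκ0.le hκ1 K
      _ = _ := by ring
  · have hk : ∀ k, eLpNorm (b k) 2 volume ≤ ENNReal.ofReal (√C * r ^ (k + 1)) := by
      intro k
      have h1 := hB k
      rw [lintegral_enorm_sq_eq] at h1
      have h2 : C * (ρ ^ (k + 1)) ^ σ = (√C * r ^ (k + 1)) ^ 2 := by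
        rw [mul_pow, Real.sq_sqrt hC.le, hr, ← pow_mul, ← Real.rpow_natCast (ρ ^ (σ / 2)),
          ← Real.rpow_mul hρ0.le, ← Real.rpow_natCast ρ, ← Real.rpow_mul hρ0.le]
        congr 2; push_cast; ring
      rw [h2, ENNReal.ofReal_pow (by positivity)] at h1
      exact (ENNReal.pow_le_pow_left_iff two_ne_zero).1 h1
    rw [lintegral_enorm_sq_eq, ENNReal.ofReal_pow (by positivity)]
    refine pow_le_pow_left₀ zero_le ?_ 2
    have h3 : (fun ξ => ∑ k ∈ Finset.range K, b k ξ) = ∑ k ∈ Finset.range K, b k := by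
      ext ξ; simp
    rw [h3]
    refine (eLpNorm_sum_le (fun k _ => (hb k).1) (by norm_num)).trans ?_
    calc _ ≤ ∑ k ∈ Finset.range K, ENNReal.ofReal (√C * r ^ (k + 1)) :=
          Finset.sum_le_sum fun k _ => hk k
      _ = ENNReal.ofReal (√C * ∑ k ∈ Finset.range K, r ^ (k + 1)) := by
          rw [← ENNReal.ofReal_sum_of_nonneg (fun k _ => by positivity), Finset.mul_sum]
      _ ≤ _ := by
          gcongr
          exact sum_range_pow_succ_le hr0.le hr1 K

/-- The truncated kernels are uniformly in weak `L²`. -/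
theorem EllipticPositive.exists_volume_kernel_le {P : MvPolynomial (Fin n) ℝ}
    (hP : EllipticPositive P n) : ∃ C : ℝ, 0 < C ∧ ∀ (t : ℝ) (N : ℕ) (s : ℝ), 0 < t → 0 < s →
      volume {x | ENNReal.ofReal s < ‖𝓕⁻ (lowSymbol P t N) x‖ₑ} ≤ ENNReal.ofReal (C / s ^ 2) := by
  obtain ⟨l, hl⟩ := hP.even_order
  rw [← two_mul] at hl
  have hn := hP.four_le_order
  obtain ⟨C₀, hC₀, hlow⟩ := hP.exists_volume_lowSymbol_le hl
  obtain ⟨C₁, C₂, hC₁, hC₂, hhigh⟩ := hP.exists_high_decomposition hl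
  refine ⟨(C₀ + C₂) * (2 + C₁) ^ 2, by positivity, fun t N s ht hs => ?_⟩
  -- The level is shared out: `s'` for the low part, `C₁ s'` for the dispersive part, `s'` for the
  -- `L²` part. As the dispersive part never exceeds its share, only two level sets remain.
  set s' := s / (2 + C₁) with hs'
  have hs'0 : 0 < s' := by positivity
  have hss : s = (2 + C₁) * s' := by rw [hs']; field_simp
  have hCs : (C₀ + C₂) * (2 + C₁) ^ 2 / s ^ 2 = C₀ / s' ^ 2 + C₂ / s' ^ 2 := by
    rw [hss]; field_simp
  have hmono : ENNReal.ofReal s' ≤ ENNReal.ofReal s := by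
    refine ENNReal.ofReal_le_ofReal ?_
    rw [hss]; nlinarith
  rw [hCs]
  -- The threshold `J` is the first scale at which the dispersive bound falls below `s'`; it exists
  -- since `l - 1 ≥ 1`.
  have hex : ∃ j : ℕ, ((t * 2 ^ (j * (l - 1))) ^ l)⁻¹ ≤ s' := by
    obtain ⟨j, hj⟩ := pow_unbounded_of_one_lt (max 1 s'⁻¹ / t) (one_lt_two (α := ℝ))
    refine ⟨j, ?_⟩
    rw [inv_le_comm₀ (by positivity) hs'0]
    rw [div_lt_iff₀ ht, mul_comm] at hj
    have h1 : (2 : ℝ) ^ j ≤ 2 ^ (j * (l - 1)) :=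
      pow_le_pow_right₀ (by norm_num) (Nat.le_mul_of_pos_right _ (by omega))
    have h2 : max 1 s'⁻¹ ≤ t * 2 ^ (j * (l - 1)) := hj.le.trans (by gcongr)
    exact (le_max_right _ _).trans (h2.trans
      (le_self_pow₀ ((le_max_left _ _).trans h2) (by omega)))
  classical
  set J := Nat.find hex with hJ
  have hJs := Nat.find_spec hex
  rw [← hJ] at hJs
  have hmin : ∀ J', J' ≤ J → (J' = 0 ∨ J' ≠ 0 ∧ s' ≤ ((t * 2 ^ ((J' - 1) * (l - 1))) ^ l)⁻¹) := by
    intro J' hJ'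
    by_cases h0 : J' = 0
    · exact Or.inl h0
    · have h1 := Nat.find_min hex (m := J' - 1) (by omega)
      exact Or.inr ⟨h0, (not_le.1 h1).le⟩
  rcases le_total N J with hNJ | hNJ
  · refine (measure_mono fun x hx => lt_of_le_of_lt hmono hx).trans
      ((hlow t N s' ht hs'0 (hmin N hNJ)).trans ?_)
    gcongr
    have : 0 < C₂ / s' ^ 2 := by positivity
    linarith
  obtain ⟨K, rfl⟩ := Nat.exists_eq_add_of_le hNJ
  obtain ⟨G, B, hG, hB, hGB, hGs, hB2⟩ := hhigh t s' J K ht hJs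
  have hK : ∀ x, 𝓕⁻ (lowSymbol P t (J + K)) x =
      𝓕⁻ (lowSymbol P t J) x + (𝓕⁻ G x + 𝓕⁻ B x) := by
    intro x
    rw [← fourierInv_add_apply hG hB, ← fourierInv_add_apply (g := fun ξ => G ξ + B ξ)
      (hP.integrable_lowSymbol t J) (hG.add hB)]
    exact congrArg (fun f : 𝔼 → ℂ => 𝓕⁻ f x) (funext hGB)
  have hsub : {x | ENNReal.ofReal s < ‖𝓕⁻ (lowSymbol P t (J + K)) x‖ₑ} ⊆
      {x | ENNReal.ofReal s' < ‖𝓕⁻ (lowSymbol P t J) x‖ₑ} ∪ {x | ENNReal.ofReal s' < ‖𝓕⁻ B x‖ₑ} := by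
    intro x hx
    by_contra h
    simp only [mem_union, mem_ofPred_eq, not_or, not_lt, ← ofReal_norm] at h hx
    rw [ENNReal.ofReal_le_ofReal_iff hs'0.le, ENNReal.ofReal_le_ofReal_iff hs'0.le] at h
    rw [ENNReal.ofReal_lt_ofReal_iff_of_nonneg hs.le, hK] at hx
    have h1 := norm_add_le (𝓕⁻ (lowSymbol P t J) x) (𝓕⁻ G x + 𝓕⁻ B x)
    have h2 := norm_add_le (𝓕⁻ G x) (𝓕⁻ B x)
    have h3 := hGs x
    linarith [h.1, h.2]
  refine (measure_mono hsub).trans ((measure_union_le _ _).trans ?_)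
  rw [ENNReal.ofReal_add (by positivity) (by positivity)]
  refine add_le_add (hlow t J s' ht hs'0 (hmin J le_rfl)) ?_
  refine (volume_lt_enorm_le (continuous_fourierInv hB).aemeasurable (by simpa using hs'0)
    ENNReal.ofReal_ne_top).trans ?_
  calc _ ≤ ENNReal.ofReal C₂ / ENNReal.ofReal s' ^ 2 := by
        gcongr; exact (lintegral_fourierInv_sq_le hB).trans hB2
    _ = _ := by rw [← ENNReal.ofReal_pow hs'0.le, ENNReal.ofReal_div_of_pos (by positivity)]

end KernelEstimate

end HigherOrderWave

namespace HigherOrderWave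

/-! ### From weak `L²` kernels to bounds over sets, for Schwartz data. -/

section EndpointSchwartz

open Set Metric Filter Topology

theorem setLIntegral_Ioi_div_sq {C A : ℝ} (hC : 0 ≤ C) (hA : 0 < A) :
    ∫⁻ s in Ioi A, ENNReal.ofReal (C / s ^ 2) = ENNReal.ofReal (C / A) := by
  have h1 : ∫⁻ s in Ioi A, ENNReal.ofReal (C / s ^ 2) =
      ∫⁻ s in Ioi A, ENNReal.ofReal (C * s ^ (-2 : ℝ)) := by
    refine setLIntegral_congr_fun measurableSet_Ioi fun s (hs : A < s) => ?_
    have : 0 < s := hA.trans hs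
    rw [Real.rpow_neg this.le, Real.rpow_ofNat, div_eq_mul_inv]
  rw [h1, ← ofReal_integral_eq_lintegral_ofReal
    ((integrableOn_Ioi_rpow_of_lt (by norm_num) hA).const_mul C), integral_const_mul,
    integral_Ioi_rpow_of_lt (by norm_num) hA]
  · congr 1
    norm_num
    rw [Real.rpow_neg_one, div_eq_mul_inv]
  · filter_upwards [ae_restrict_mem measurableSet_Ioi] with s hs
    have : 0 < s := hA.trans hs
    positivity

/-- A function in weak `L²` is integrable over sets of finite measure. -/
theorem setLIntegral_enorm_le_of_weak {α : Type*} [MeasurableSpace α] {μ : Measure α}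
    {f : α → ℂ} (hf : AEMeasurable f μ) {C : ℝ} (hC : 0 ≤ C)
    (h : ∀ s : ℝ, 0 < s → μ {x | ENNReal.ofReal s < ‖f x‖ₑ} ≤ ENNReal.ofReal (C / s ^ 2))
    (A : Set α) :
    ∫⁻ x in A, ‖f x‖ₑ ∂μ ≤ ENNReal.ofReal (1 + C) * μ A ^ (1 / 2 : ℝ) := by
  rcases eq_or_ne (μ A) 0 with h0 | h0
  · rw [Measure.restrict_eq_zero.2 h0]; simp
  rcases eq_or_ne (μ A) ⊤ with ht | ht
  · rw [ht, ENNReal.top_rpow_of_pos (by norm_num), ENNReal.mul_top]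
    · exact le_top
    · simp; linarith
  obtain ⟨V, hV0, hV⟩ : ∃ V : ℝ, 0 < V ∧ μ A = ENNReal.ofReal V :=
    ⟨_, ENNReal.toReal_pos h0 ht, (ENNReal.ofReal_toReal ht).symm⟩
  -- The layer-cake integral is cut at `|A|^{-1/2}`, which balances `a |A|` against `C / a`.
  set a := (√V)⁻¹ with ha
  have ha0 : 0 < a := by positivity
  calc ∫⁻ x in A, ‖f x‖ₑ ∂μ = ∫⁻ x in A, ENNReal.ofReal ‖f x‖ ∂μ := by
        simp_rw [ofReal_norm]
    _ = ∫⁻ s in Ioi 0, (μ.restrict A) {x | s < ‖f x‖} :=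
        lintegral_eq_lintegral_meas_lt _ (.of_forall fun x => norm_nonneg _) hf.restrict.norm
    _ = (∫⁻ s in Ioc 0 a, (μ.restrict A) {x | s < ‖f x‖}) +
        ∫⁻ s in Ioi a, (μ.restrict A) {x | s < ‖f x‖} := by
        rw [← Ioc_union_Ioi_eq_Ioi ha0.le, lintegral_union measurableSet_Ioi]
        exact Ioc_disjoint_Ioi le_rfl
    _ ≤ (∫⁻ _ in Ioc 0 a, ENNReal.ofReal V) + ∫⁻ s in Ioi a, ENNReal.ofReal (C / s ^ 2) := by
        refine add_le_add (lintegral_mono fun s => ?_)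
          (setLIntegral_mono' measurableSet_Ioi fun s (hs : a < s) => ?_)
        · rw [← hV, ← Measure.restrict_apply_univ (μ := μ) A]
          exact measure_mono (μ := μ.restrict A) (subset_univ _)
        · have hs0 : 0 < s := ha0.trans hs
          refine (Measure.restrict_apply_le _ _).trans ((measure_mono (μ := μ) fun x hx => ?_).trans (h s hs0))
          rw [mem_ofPred_eq, ← ofReal_norm]
          exact (ENNReal.ofReal_lt_ofReal_iff (hs0.trans hx)).2 hx
    _ = ENNReal.ofReal (1 + C) * μ A ^ (1 / 2 : ℝ) := by
        rw [setLIntegral_const, Real.volume_Ioc, sub_zero, setLIntegral_Ioi_div_sq hC ha0, hV,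
          ENNReal.ofReal_rpow_of_pos hV0, ← ENNReal.ofReal_mul hV0.le,
          ← ENNReal.ofReal_add (by positivity) (by positivity), ← ENNReal.ofReal_mul (by positivity),
          ← Real.sqrt_eq_rpow]
        congr 1
        rw [ha]
        have : √V * √V = V := Real.mul_self_sqrt hV0.le
        field_simp
        nlinarith

theorem continuous_fourierChar_inner {E : Type*} [NormedAddCommGroup E] [InnerProductSpace ℝ E]
    (x : E) : Continuous fun ξ : E => (Real.fourierChar (inner ℝ ξ x) : ℂ) :=
  continuous_subtype_val.comp
    (Real.continuous_fourierChar.comp (continuous_id.inner continuous_const))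

variable {E : Type*} [NormedAddCommGroup E] [InnerProductSpace ℝ E] [FiniteDimensional ℝ E]
  [MeasurableSpace E] [BorelSpace E]

/-- The kernel of a Fourier multiplier with an integrable symbol. -/
theorem fourierInv_mul_fourier_eq {a : E → ℂ} (ha : Integrable a) (f : 𝓢(E, ℂ)) (x : E) :
    𝓕⁻ (fun ξ => a ξ * 𝓕 f ξ) x = ∫ y, 𝓕⁻ a (x - y) * f y := by
  have hb : Integrable fun ξ : E => (Real.fourierChar (inner ℝ ξ x)) • a ξ := by
    rw [← integrable_norm_iff]
    · simpa using ha.norm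
    · refine AEStronglyMeasurable.smul ?_ ha.aestronglyMeasurable
      exact (continuous_fourierChar_inner x).aestronglyMeasurable
  have h := VectorFourier.integral_fourierIntegral_smul_eq_flip (e := Real.fourierChar)
    (μ := volume) (ν := volume) (L := innerₗ E) Real.continuous_fourierChar
    (continuous_inner (𝕜 := ℝ) (E := E)) hb (f.integrable (μ := volume))
  rw [flip_innerₗ] at h
  have e1 : ∀ y, VectorFourier.fourierIntegral Real.fourierChar volume (innerₗ E)
      (fun ξ : E => (Real.fourierChar (inner ℝ ξ x)) • a ξ) y = 𝓕⁻ a (x - y) := by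
    intro y
    rw [Real.fourierInv_eq, VectorFourier.fourierIntegral]
    refine integral_congr_ae (.of_forall fun ξ => ?_)
    simp only [innerₗ_apply_apply]
    rw [smul_smul, ← AddChar.map_add_eq_mul, inner_sub_right]
    congr 2; ring
  have e2 : ∀ ξ, VectorFourier.fourierIntegral Real.fourierChar volume (innerₗ E) f ξ = 𝓕 f ξ := by
    intro ξ
    rw [SchwartzMap.fourier_coe]; rfl
  simp only [e1, e2, smul_eq_mul] at h
  rw [h, Real.fourierInv_eq]
  refine integral_congr_ae (.of_forall fun ξ => ?_)
  simp only [smul_mul_assoc]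

/-- Integrals over `A` commute with the superposition of translates of the kernel, which a weak
quasi-norm would not allow; translation invariance gives the same bound for each translate. -/
theorem setLIntegral_fourierInv_mul_fourier_le {a : E → ℂ} (ha : Integrable a) {C : ℝ} (hC : 0 ≤ C)
    (h : ∀ s : ℝ, 0 < s →
      volume {x | ENNReal.ofReal s < ‖𝓕⁻ a x‖ₑ} ≤ ENNReal.ofReal (C / s ^ 2))
    (f : 𝓢(E, ℂ)) (A : Set E) :
    ∫⁻ x in A, ‖𝓕⁻ (fun ξ => a ξ * 𝓕 f ξ) x‖ₑ ≤
      ENNReal.ofReal (1 + C) * volume A ^ (1 / 2 : ℝ) * eLpNorm f 1 volume := by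
  have hK : Continuous (𝓕⁻ a) := continuous_fourierInv ha
  calc ∫⁻ x in A, ‖𝓕⁻ (fun ξ => a ξ * 𝓕 f ξ) x‖ₑ
      ≤ ∫⁻ x in A, ∫⁻ y, ‖𝓕⁻ a (x - y)‖ₑ * ‖f y‖ₑ := by
        refine lintegral_mono fun x => ?_
        rw [fourierInv_mul_fourier_eq ha]
        refine (enorm_integral_le_lintegral_enorm _).trans (le_of_eq ?_)
        simp_rw [enorm_mul]
    _ = ∫⁻ y, ∫⁻ x in A, ‖𝓕⁻ a (x - y)‖ₑ * ‖f y‖ₑ := by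
        refine lintegral_lintegral_swap ?_
        have := f.continuous
        have h1 : Continuous fun z : E × E => ‖𝓕⁻ a (z.1 - z.2)‖ₑ :=
          (hK.comp (continuous_fst.sub continuous_snd)).enorm
        have h2 : Continuous fun z : E × E => ‖f z.2‖ₑ := (this.comp continuous_snd).enorm
        exact (h1.measurable.mul h2.measurable).aemeasurable
    _ ≤ ∫⁻ y, ENNReal.ofReal (1 + C) * volume A ^ (1 / 2 : ℝ) * ‖f y‖ₑ := by
        refine lintegral_mono fun y => ?_
        rw [lintegral_mul_const' _ _ (by simp)]
        gcongr
        refine setLIntegral_enorm_le_of_weak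
          (hK.comp (continuous_id.sub continuous_const)).aemeasurable hC (fun s hs => ?_) A
        refine le_trans (le_of_eq ?_) (h s hs)
        simpa [sub_eq_add_neg] using measure_preimage_add_right volume (-y) {x | ENNReal.ofReal s < ‖𝓕⁻ a x‖ₑ}
    _ = _ := by
        rw [lintegral_const_mul _ f.continuous.enorm.measurable, eLpNorm_one_eq_lintegral_enorm]

end EndpointSchwartz

/-! ### Removal of the frequency truncation. -/

section SineEndpoint

open Set Metric Filter Topology

variable {n : ℕ}

local notation "𝔼" => EuclideanSpace ℝ (Fin n)

theorem lowSymbol_neg (P : MvPolynomial (Fin n) ℝ) (t : ℝ) (N : ℕ) :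
    lowSymbol P (-t) N = fun ξ => (-1 : ℂ) * lowSymbol P t N ξ := by
  ext ξ
  simp only [lowSymbol, sineSymbol, mul_neg, Real.sin_neg]
  push_cast
  ring

theorem EllipticPositive.exists_volume_kernel_le_of_ne {P : MvPolynomial (Fin n) ℝ}
    (hP : EllipticPositive P n) : ∃ C : ℝ, 0 < C ∧ ∀ (t : ℝ) (N : ℕ) (s : ℝ), t ≠ 0 → 0 < s →
      volume {x | ENNReal.ofReal s < ‖𝓕⁻ (lowSymbol P t N) x‖ₑ} ≤ ENNReal.ofReal (C / s ^ 2) := by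
  obtain ⟨C, hC, h⟩ := hP.exists_volume_kernel_le
  refine ⟨C, hC, fun t N s ht hs => ?_⟩
  rcases ht.lt_or_gt with h0 | h0
  · have e := lowSymbol_neg P (-t) N
    rw [neg_neg] at e
    rw [e]
    simp_rw [fourierInv_const_mul_apply, neg_one_mul, enorm_neg]
    exact h _ N s (by linarith) hs
  · exact h t N s h0 hs

theorem tendsto_lowSymbol (P : MvPolynomial (Fin n) ℝ) (t : ℝ) (ξ : 𝔼) :
    Tendsto (fun N => lowSymbol P t N ξ) atTop (𝓝 ((sineSymbol P t ((2 * Real.pi) • ξ) : ℝ) : ℂ)) := by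
  refine tendsto_const_nhds.congr' ?_
  filter_upwards [(tendsto_pow_atTop_atTop_of_one_lt (one_lt_two (α := ℝ))).eventually_ge_atTop ‖ξ‖]
    with N hN
  rw [lowSymbol, bump_eq_one, mul_one]
  rw [norm_smul, norm_inv, Real.norm_of_nonneg (by positivity), inv_mul_le_iff₀ (by positivity),
    mul_one]
  exact hN

theorem norm_lowSymbol_le (P : MvPolynomial (Fin n) ℝ) (t : ℝ) (N : ℕ) (ξ : 𝔼) :
    ‖lowSymbol P t N ξ‖ ≤ |t| := by
  rw [lowSymbol, Complex.norm_real, norm_mul, Real.norm_eq_abs, Real.norm_eq_abs,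
    abs_of_nonneg (bump n).nonneg]
  exact (mul_le_of_le_one_right (abs_nonneg _) (bump n).le_one).trans (abs_sineSymbol_le _ _ _)

/-- In the critical dimension the sine propagator maps `L¹` to weak `L²`, in the dual form. -/
theorem EllipticPositive.exists_setLIntegral_le {P : MvPolynomial (Fin n) ℝ}
    (hP : EllipticPositive P n) : ∃ C : ℝ, 0 < C ∧ ∀ t : ℝ, t ≠ 0 → ∀ (f : 𝓢(𝔼, ℂ)) (A : Set 𝔼),
      ∫⁻ x in A, ‖SchwartzMap.fourierMultiplierCLM ℂ
          (fun ξ => ((sineSymbol P t ((2 * Real.pi) • ξ) : ℝ) : ℂ)) f x‖ₑ ≤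
        ENNReal.ofReal C * volume A ^ (1 / 2 : ℝ) * eLpNorm f 1 volume := by
  obtain ⟨C, hC, h⟩ := hP.exists_volume_kernel_le_of_ne
  refine ⟨1 + C, by positivity, fun t ht f A => ?_⟩
  set g : 𝔼 → ℂ := fun ξ => ((sineSymbol P t ((2 * Real.pi) • ξ) : ℝ) : ℂ) with hg
  have hgt := hP.hasTemperateGrowth_sineSymbol t
  set F : ℕ → 𝔼 → ℂ := fun N => 𝓕⁻ (fun ξ => lowSymbol P t N ξ * 𝓕 f ξ) with hF
  have hint : ∀ N, Integrable (fun ξ => lowSymbol P t N ξ * 𝓕 f ξ) := fun N =>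
    ((𝓕 f).integrable (μ := volume)).bdd_mul
      (hP.contDiff_lowSymbol t N).continuous.aestronglyMeasurable
      (.of_forall fun ξ => norm_lowSymbol_le P t N ξ)
  -- The truncated multipliers are dominated by `|t|`, so the outputs converge pointwise, and Fatou
  -- transfers the uniform bound to the limit.
  have hlim : ∀ x, Tendsto (fun N => F N x) atTop
      (𝓝 (SchwartzMap.fourierMultiplierCLM ℂ g f x)) := by
    intro x
    rw [SchwartzMap.fourierMultiplierCLM_apply, SchwartzMap.fourierInv_coe, Real.fourierInv_eq]
    simp only [hF, Real.fourierInv_eq]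
    refine tendsto_integral_of_dominated_convergence (fun ξ => |t| * ‖𝓕 f ξ‖) (fun N => ?_)
      (((𝓕 f).integrable (μ := volume)).norm.const_mul _) (fun N => .of_forall fun ξ => ?_)
      (.of_forall fun ξ => ?_)
    · refine AEStronglyMeasurable.smul ?_ (hint N).aestronglyMeasurable
      exact (continuous_fourierChar_inner x).aestronglyMeasurable
    · rw [Circle.norm_smul, norm_mul]
      gcongr
      exact norm_lowSymbol_le P t N ξ
    · rw [SchwartzMap.smulLeftCLM_apply_apply hgt, smul_eq_mul]
      exact ((tendsto_lowSymbol P t ξ).mul_const _).const_smul _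
  calc ∫⁻ x in A, ‖SchwartzMap.fourierMultiplierCLM ℂ g f x‖ₑ
      = ∫⁻ x in A, liminf (fun N => ‖F N x‖ₑ) atTop :=
        lintegral_congr fun x => ((hlim x).enorm.liminf_eq).symm
    _ ≤ liminf (fun N => ∫⁻ x in A, ‖F N x‖ₑ) atTop :=
        lintegral_liminf_le fun N => (continuous_fourierInv (hint N)).enorm.measurable
    _ ≤ _ := by
        refine liminf_le_of_le (by isBoundedDefault) fun b hb => ?_
        obtain ⟨N, hN⟩ := hb.exists
        exact hN.trans (setLIntegral_fourierInv_mul_fourier_le (hP.integrable_lowSymbol t N) hC.le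
          (fun s hs => h t N s ht hs) f A)

end SineEndpoint

end HigherOrderWave

namespace HigherOrderWave

/-! ### Extension to `L¹` through a weighted `L¹` space. -/

section WeightedExtension

open Set Metric Filter Topology

/-- Local `L¹` bounds by the square root of the measure imply a weak `L²` bound. -/
theorem mul_measure_rpow_le_of_setLIntegral_le {α : Type*} [MeasurableSpace α] {μ : Measure α}
    [SigmaFinite μ] {f : α → ℂ} (hf : Measurable f) {c : ℝ≥0∞}
    (h : ∀ A : Set α, μ A ≠ ⊤ → ∫⁻ x in A, ‖f x‖ₑ ∂μ ≤ c * μ A ^ (1 / 2 : ℝ)) (s : ℝ≥0) :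
    (s : ℝ≥0∞) * μ {x | s < ‖f x‖₊} ^ (1 / 2 : ℝ) ≤ c := by
  rcases eq_or_ne s 0 with rfl | hs
  · simp
  have hs' : (s : ℝ≥0∞) ≠ 0 := by simpa using hs
  have hm : MeasurableSet {x | s < ‖f x‖₊} := measurableSet_lt measurable_const hf.nnnorm
  rw [mul_comm, ← ENNReal.le_div_iff_mul_le (.inl hs') (.inl ENNReal.coe_ne_top),
    one_div, ENNReal.rpow_inv_le_iff (by norm_num)]
  refine le_of_forall_lt fun r hr => ?_
  -- The level set is not known to have finite measure, so the hypothesis is tested on its subsets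
  -- of finite measure, where one may divide by `μ(T)^{1/2}`.
  obtain ⟨T, hT, hTs, hrT, hTfin⟩ := Measure.exists_subset_measure_lt_top hm hr
  refine hrT.trans_le ?_
  rw [← ENNReal.rpow_inv_le_iff (by norm_num), ENNReal.le_div_iff_mul_le (.inl hs')
    (.inl ENNReal.coe_ne_top), ← one_div]
  have hT0 : μ T ≠ 0 := (pos_of_gt hrT).ne'
  have h1 : (s : ℝ≥0∞) * μ T ≤ c * μ T ^ (1 / 2 : ℝ) := by
    refine le_trans ?_ (h T hTfin.ne)
    rw [← setLIntegral_const]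
    refine setLIntegral_mono' hT fun x hx => ?_
    exact ENNReal.coe_le_coe.2 (le_of_lt (hTs hx))
  have h2 : μ T = μ T ^ (1 / 2 : ℝ) * μ T ^ (1 / 2 : ℝ) := by
    rw [← ENNReal.rpow_add _ _ hT0 hTfin.ne]; norm_num
  have h3 : μ T ^ (1 / 2 : ℝ) ≠ 0 := by
    simp [ENNReal.rpow_eq_zero_iff, hT0, hTfin.ne]
  have h4 : μ T ^ (1 / 2 : ℝ) ≠ ⊤ := ENNReal.rpow_ne_top_of_nonneg (by norm_num) hTfin.ne
  rw [h2, ← h2, mul_comm] at h1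
  nth_rw 1 [h2] at h1
  rw [mul_right_comm] at h1
  exact (ENNReal.mul_le_mul_iff_left h3 h4).1 h1

variable {E : Type*} [NormedAddCommGroup E] [InnerProductSpace ℝ E] [FiniteDimensional ℝ E]
  [MeasurableSpace E] [BorelSpace E]

local notation "dim" => Module.finrank ℝ E

/-- The terms are `O(k^{dim/2 - 2(dim + 2)})`; cruder powers suffice. -/
theorem tsum_weight_lt_top : ∑' k : ℕ, ENNReal.ofReal ((1 + (k : ℝ) ^ 2) ^ (dim + 2))⁻¹ *
    volume (ball (0 : E) (k + 1)) ^ (1 / 2 : ℝ) < ⊤ := by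
  set B := (volume (ball (0 : E) 1)).toReal with hB
  have hBe : volume (ball (0 : E) 1) = ENNReal.ofReal B :=
    (ENNReal.ofReal_toReal measure_ball_lt_top.ne).symm
  have hB0 : 0 ≤ B := ENNReal.toReal_nonneg
  have hsum : Summable fun k : ℕ => √B * 2 ^ (dim + 2) * (((k + 1 : ℕ) : ℝ) ^ 2)⁻¹ := by
    refine Summable.mul_left _ ?_
    exact (summable_nat_add_iff 1).2 (Real.summable_nat_pow_inv.2 one_lt_two)
  refine lt_of_le_of_lt (ENNReal.tsum_le_tsum fun k => ?_) hsum.tsum_ofReal_lt_top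
  have hk : (0 : ℝ) < k + 1 := by positivity
  rw [Measure.addHaar_ball_of_pos _ _ hk, hBe, ← ENNReal.ofReal_mul (by positivity),
    ENNReal.ofReal_rpow_of_nonneg (by positivity) (by norm_num), ← Real.sqrt_eq_rpow,
    ← ENNReal.ofReal_mul (by positivity), Real.sqrt_mul (by positivity)]
  refine ENNReal.ofReal_le_ofReal ?_
  have h1 : √(((k : ℝ) + 1) ^ dim) ≤ ((k : ℝ) + 1) ^ dim := by
    rw [Real.sqrt_le_left (by positivity), sq]
    exact le_mul_of_one_le_left (by positivity) (one_le_pow₀ (by linarith))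
  have h2 : (((k : ℝ) + 1) ^ 2) ^ (dim + 2) ≤ 2 ^ (dim + 2) * (1 + (k : ℝ) ^ 2) ^ (dim + 2) := by
    rw [← mul_pow]
    gcongr
    nlinarith [sq_nonneg ((k : ℝ) - 1)]
  push_cast
  rw [inv_mul_le_iff₀ (by positivity), ← div_eq_mul_inv, mul_div_assoc', le_div_iff₀ (by positivity)]
  calc √(((k : ℝ) + 1) ^ dim) * √B * ((k : ℝ) + 1) ^ 2
      ≤ ((k : ℝ) + 1) ^ dim * √B * ((k : ℝ) + 1) ^ 2 := by gcongr
    _ = √B * ((k : ℝ) + 1) ^ (dim + 2) := by ring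
    _ ≤ √B * (((k : ℝ) + 1) ^ 2) ^ (dim + 2) := by
        gcongr
        nlinarith
    _ ≤ √B * (2 ^ (dim + 2) * (1 + (k : ℝ) ^ 2) ^ (dim + 2)) := by gcongr
    _ = _ := by ring

/-- A point `x` lies in the ball of radius `⌊‖x‖⌋ + 1`, and its weight is at most that of `k =
⌊‖x‖⌋`; the bounds over balls are then summed. -/
theorem lintegral_weight_le {f : E → ℂ} (hf : Measurable f) {c : ℝ≥0∞}
    (h : ∀ A : Set E, ∫⁻ x in A, ‖f x‖ₑ ≤ c * volume A ^ (1 / 2 : ℝ)) :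
    ∫⁻ x, ENNReal.ofReal ((1 + ‖x‖ ^ 2) ^ (dim + 2))⁻¹ * ‖f x‖ₑ ≤
      c * ∑' k : ℕ, ENNReal.ofReal ((1 + (k : ℝ) ^ 2) ^ (dim + 2))⁻¹ *
        volume (ball (0 : E) (k + 1)) ^ (1 / 2 : ℝ) := by
  calc ∫⁻ x, ENNReal.ofReal ((1 + ‖x‖ ^ 2) ^ (dim + 2))⁻¹ * ‖f x‖ₑ
      ≤ ∫⁻ x, ∑' k : ℕ, (ball (0 : E) (k + 1)).indicator
          (fun x => ENNReal.ofReal ((1 + (k : ℝ) ^ 2) ^ (dim + 2))⁻¹ * ‖f x‖ₑ) x := by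
        refine lintegral_mono fun x => ?_
        refine le_trans ?_ (ENNReal.le_tsum ⌊‖x‖⌋₊)
        rw [indicator_of_mem (by simpa using Nat.lt_floor_add_one ‖x‖)]
        gcongr
        exact Nat.floor_le (norm_nonneg x)
    _ = ∑' k : ℕ, ENNReal.ofReal ((1 + (k : ℝ) ^ 2) ^ (dim + 2))⁻¹ *
          ∫⁻ x in ball (0 : E) (k + 1), ‖f x‖ₑ := by
        rw [lintegral_tsum fun k => ((hf.enorm.const_mul _).indicator measurableSet_ball).aemeasurable]
        refine tsum_congr fun k => ?_
        rw [lintegral_indicator measurableSet_ball, lintegral_const_mul _ hf.enorm]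
    _ ≤ ∑' k : ℕ, c * (ENNReal.ofReal ((1 + (k : ℝ) ^ 2) ^ (dim + 2))⁻¹ *
        volume (ball (0 : E) (k + 1)) ^ (1 / 2 : ℝ)) := by
        refine ENNReal.tsum_le_tsum fun k => ?_
        rw [mul_left_comm]
        gcongr
        exact h _
    _ = _ := ENNReal.tsum_mul_left

/-- A Fourier multiplier mapping Schwartz functions from `L¹` to weak `L²` extends to `L¹`. -/
theorem exists_fourierMultiplier_weak {g : E → ℂ} (hg : g.HasTemperateGrowth) {K : ℝ} (hK : 0 ≤ K)
    (h : ∀ (f : 𝓢(E, ℂ)) (A : Set E), ∫⁻ x in A, ‖SchwartzMap.fourierMultiplierCLM ℂ g f x‖ₑ ≤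
        ENNReal.ofReal K * volume A ^ (1 / 2 : ℝ) * eLpNorm f 1 volume)
    (u : Lp ℂ 1 (volume : Measure E)) :
    ∃ v : E → ℂ, StronglyMeasurable v ∧
      (∀ ψ : 𝓢(E, ℂ), Integrable (fun x => ψ x • v x) ∧
        TemperedDistribution.fourierMultiplierCLM ℂ g (Lp.toTemperedDistribution u) ψ =
          ∫ x, ψ x • v x) ∧
      ∀ A : Set E, volume A ≠ ⊤ → ∫⁻ x in A, ‖v x‖ₑ ≤ ENNReal.ofReal (K * ‖u‖) * volume A ^ (1 / 2 : ℝ) := by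
  -- The bounds over sets place the outputs in `L¹(W⁻¹ dx)`, a Banach space in which extension by
  -- density is available. Multiplying the resulting distribution by `W` undoes the weight.
  set W : E → ℝ := fun x => (1 + ‖x‖ ^ 2) ^ (dim + 2) with hW
  have hWpos : ∀ x, 0 < W x := fun x => by positivity
  have hWt : (fun x : E => ((W x : ℝ) : ℂ)).HasTemperateGrowth := by
    have := hasTemperateGrowth_japanese (E := E) ((dim + 2 : ℕ) : ℝ)
    simpa only [Real.rpow_natCast] using this
  set w : E → ℝ≥0∞ := fun x => ENNReal.ofReal (W x)⁻¹ with hw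
  have hwm : Measurable w := by fun_prop
  have hwr : ∀ x, (w x).toReal = (W x)⁻¹ := fun x => 
    ENNReal.toReal_ofReal (inv_nonneg.2 (hWpos x).le)
  have hwfin : ∀ᵐ x ∂(volume : Measure E), w x < ⊤ := .of_forall fun x => ENNReal.ofReal_lt_top
  set μ : Measure E := volume.withDensity w with hμ
  have hac : (volume : Measure E) ≪ μ := withDensity_absolutelyContinuous' hwm.aemeasurable
    (.of_forall fun x => by simpa [hw] using hWpos x)
  have hfinite : IsFiniteMeasure μ := by
    refine isFiniteMeasure_withDensity_ofReal (Integrable.hasFiniteIntegral ?_)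
    have := integrable_rpow_neg_one_add_norm_sq (E := E) (μ := volume) (r := 2 * ((dim + 2 : ℕ) : ℝ))
      (by push_cast; have : (0 : ℝ) ≤ dim := by positivity
          linarith)
    refine this.congr (.of_forall fun x => ?_)
    simp only [hW]
    rw [← Real.rpow_natCast _ (dim + 2), ← Real.rpow_neg (by positivity)]
    congr 1; ring
  have hintegral : ∀ F : E → ℂ, ∫ x, F x ∂μ = ∫ x, (w x).toReal • F x := fun F =>
    integral_withDensity_eq_integral_toReal_smul hwm hwfin F
  have hintegrable : ∀ F : E → ℂ, Integrable F μ ↔ Integrable (fun x => (w x).toReal • F x) :=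
    fun F => integrable_withDensity_iff_integrable_smul' hwm hwfin
  set Z := ∑' k : ℕ, ENNReal.ofReal ((1 + (k : ℝ) ^ 2) ^ (dim + 2))⁻¹ *
        volume (ball (0 : E) (k + 1)) ^ (1 / 2 : ℝ) with hZ
  have hZtop : Z ≠ ⊤ := (tsum_weight_lt_top (E := E)).ne
  set T : 𝓢(E, ℂ) →ₗ[ℂ] Lp ℂ 1 μ :=
    (SchwartzMap.toLpCLM ℂ (E := E) ℂ 1 μ ∘L
      SchwartzMap.fourierMultiplierCLM ℂ g).toLinearMap with hT
  set e : 𝓢(E, ℂ) →ₗ[ℂ] Lp ℂ 1 (volume : Measure E) :=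
    (SchwartzMap.toLpCLM ℂ (E := E) ℂ 1 volume).toLinearMap with he
  have hd : DenseRange e := SchwartzMap.denseRange_toLpCLM ENNReal.one_ne_top
  have hb : ∀ f, ‖T f‖ ≤ K * Z.toReal * ‖e f‖ := by
    intro f
    change ‖(SchwartzMap.fourierMultiplierCLM ℂ g f).toLp 1 μ‖ ≤ _ * ‖f.toLp 1 volume‖
    rw [SchwartzMap.norm_toLp, SchwartzMap.norm_toLp]
    have hm : Measurable (SchwartzMap.fourierMultiplierCLM ℂ g f) :=
      (SchwartzMap.fourierMultiplierCLM ℂ g f).continuous.measurable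
    have h1 := lintegral_weight_le hm (c := ENNReal.ofReal K * eLpNorm f 1 volume)
      fun A => (h f A).trans (le_of_eq (mul_right_comm _ _ _))
    have h2 := ENNReal.toReal_mono (ENNReal.mul_ne_top (ENNReal.mul_ne_top ENNReal.ofReal_ne_top
      (f.memLp 1 volume).eLpNorm_ne_top) hZtop) h1
    rw [ENNReal.toReal_mul, ENNReal.toReal_mul, ENNReal.toReal_ofReal hK] at h2
    rw [eLpNorm_one_eq_lintegral_enorm, hμ,
      lintegral_withDensity_eq_lintegral_mul _ hwm hm.enorm]
    refine h2.trans (le_of_eq ?_)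
    ring
  set S := T.extendOfNorm e with hS
  have hSe : ∀ f, S (e f) = T f := fun f => LinearMap.extendOfNorm_eq hd ⟨_, hb⟩ f
  refine ⟨S u, Lp.stronglyMeasurable _, fun ψ => ?_, fun A hA => ?_⟩
  · have hψ : ∀ x, (w x).toReal • (SchwartzMap.smulLeftCLM ℂ (fun x : E => ((W x : ℝ) : ℂ)) ψ x • S u x)
        = ψ x • S u x := by
      intro x
      rw [SchwartzMap.smulLeftCLM_apply_apply hWt, hwr, smul_eq_mul, smul_eq_mul, smul_eq_mul,
        Complex.real_smul]
      have : (W x : ℂ) ≠ 0 := Complex.ofReal_ne_zero.2 (hWpos x).ne'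
      push_cast
      field_simp
    -- An element of `L¹(μ)` is paired with test functions through `μ`, so multiplication by `W`
    -- turns it into integration against Lebesgue measure.
    have hcl : IsClosed {u : Lp ℂ 1 (volume : Measure E) |
        TemperedDistribution.fourierMultiplierCLM ℂ g (Lp.toTemperedDistribution u) =
          TemperedDistribution.smulLeftCLM ℂ (fun x : E => ((W x : ℝ) : ℂ))
            (Lp.toTemperedDistribution (S u))} := by
      apply isClosed_eq
      · exact (TemperedDistribution.fourierMultiplierCLM ℂ g ∘L
          Lp.toTemperedDistributionCLM ℂ volume 1).continuous
      · exact (TemperedDistribution.smulLeftCLM ℂ (fun x : E => ((W x : ℝ) : ℂ)) ∘L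
          Lp.toTemperedDistributionCLM ℂ μ 1 ∘L S).continuous
    have hu : u ∈ {u : Lp ℂ 1 (volume : Measure E) |
        TemperedDistribution.fourierMultiplierCLM ℂ g (Lp.toTemperedDistribution u) =
          TemperedDistribution.smulLeftCLM ℂ (fun x : E => ((W x : ℝ) : ℂ))
            (Lp.toTemperedDistribution (S u))} := by
      refine hd.induction_on (p := fun u => u ∈ {u : Lp ℂ 1 (volume : Measure E) |
        TemperedDistribution.fourierMultiplierCLM ℂ g (Lp.toTemperedDistribution u) =
          TemperedDistribution.smulLeftCLM ℂ (fun x : E => ((W x : ℝ) : ℂ))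
            (Lp.toTemperedDistribution (S u))}) u hcl fun f => ?_
      rw [Set.mem_ofPred_eq, hSe]
      change TemperedDistribution.fourierMultiplierCLM ℂ g
        (Lp.toTemperedDistribution (f.toLp 1 volume)) = TemperedDistribution.smulLeftCLM ℂ _
          (Lp.toTemperedDistribution ((SchwartzMap.fourierMultiplierCLM ℂ g f).toLp 1 μ))
      rw [Lp.toTemperedDistribution_toLp_eq, Lp.toTemperedDistribution_toLp_eq,
        TemperedDistribution.fourierMultiplierCLM_toTemperedDistributionCLM_eq hg]
      ext φ
      rw [TemperedDistribution.smulLeftCLM_apply_apply,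
        SchwartzMap.toTemperedDistributionCLM_apply_apply (μ := volume),
        SchwartzMap.toTemperedDistributionCLM_apply_apply (μ := μ), hintegral]
      refine integral_congr_ae (.of_forall fun x => ?_)
      simp only
      rw [SchwartzMap.smulLeftCLM_apply_apply hWt, hwr, smul_eq_mul, smul_eq_mul, smul_eq_mul,
        Complex.real_smul]
      have : (W x : ℂ) ≠ 0 := Complex.ofReal_ne_zero.2 (hWpos x).ne'
      push_cast
      field_simp
    have hint : Integrable (fun x =>
        SchwartzMap.smulLeftCLM ℂ (fun x : E => ((W x : ℝ) : ℂ)) ψ x • S u x) μ := by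
      set φ := SchwartzMap.smulLeftCLM ℂ (fun x : E => ((W x : ℝ) : ℂ)) ψ
      exact (L1.integrable_coeFn (S u)).bdd_mul φ.continuous.aestronglyMeasurable
        (.of_forall fun x => φ.toBoundedContinuousFunction.norm_coe_le_norm x)
    rw [hintegrable] at hint
    simp only [hψ] at hint
    refine ⟨hint, ?_⟩
    rw [Set.mem_ofPred_eq] at hu
    rw [hu, TemperedDistribution.smulLeftCLM_apply_apply, Lp.toTemperedDistribution_apply,
      hintegral]
    exact integral_congr_ae (.of_forall hψ)
  -- Convergence in `L¹(μ)` gives almost everywhere convergence along a subsequence, also for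
  -- Lebesgue measure as `W⁻¹ > 0`; Fatou then preserves the bound over `A`.
  · obtain ⟨z, hz, hzu⟩ := mem_closure_iff_seq_limit.1 (hd u)
    choose f hf using hz
    have hlim : Tendsto (fun k => T (f k)) atTop (𝓝 (S u)) := by
      simp only [← hSe, hf]
      exact (S.continuous.tendsto u).comp hzu
    obtain ⟨ns, hns, hae⟩ := (tendstoInMeasure_of_tendsto_Lp hlim).exists_seq_tendsto_ae
    have hae' : ∀ᵐ x ∂μ, Tendsto (fun i => SchwartzMap.fourierMultiplierCLM ℂ g (f (ns i)) x) atTop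
        (𝓝 (S u x)) := by
      have h1 : ∀ᵐ x ∂μ, ∀ i, T (f (ns i)) x =
          SchwartzMap.fourierMultiplierCLM ℂ g (f (ns i)) x :=
        ae_all_iff.2 fun i => SchwartzMap.coeFn_toLp _ 1 μ
      filter_upwards [hae, h1] with x hx hx1
      simpa only [hx1] using hx
    have hae'' := ae_restrict_of_ae (s := A) (hac.ae_le hae')
    calc ∫⁻ x in A, ‖S u x‖ₑ
        = ∫⁻ x in A, liminf (fun i => ‖SchwartzMap.fourierMultiplierCLM ℂ g (f (ns i)) x‖ₑ) atTop := by
          refine lintegral_congr_ae ?_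
          filter_upwards [hae''] with x hx
          exact hx.enorm.liminf_eq.symm
      _ ≤ liminf (fun i => ∫⁻ x in A,
            ‖SchwartzMap.fourierMultiplierCLM ℂ g (f (ns i)) x‖ₑ) atTop :=
          lintegral_liminf_le fun i =>
            (SchwartzMap.fourierMultiplierCLM ℂ g (f (ns i))).continuous.enorm.measurable
      _ ≤ liminf (fun i => ENNReal.ofReal (K * ‖e (f (ns i))‖) * volume A ^ (1 / 2 : ℝ)) atTop := by
          refine liminf_le_liminf (.of_forall fun i => (h _ A).trans (le_of_eq ?_))
          change _ = ENNReal.ofReal (K * ‖(f (ns i)).toLp 1 volume‖) * _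
          rw [SchwartzMap.norm_toLp, ENNReal.ofReal_mul hK,
            ENNReal.ofReal_toReal ((f (ns i)).memLp 1 volume).eLpNorm_ne_top]
          ring
      _ = _ := by
          refine Tendsto.liminf_eq ?_
          have h1 : Tendsto (fun i => ‖e (f (ns i))‖) atTop (𝓝 ‖u‖) := by
            simp only [hf]
            exact (hzu.comp hns.tendsto_atTop).norm
          exact ENNReal.Tendsto.mul_const (ENNReal.tendsto_ofReal (h1.const_mul K))
            (.inr (ENNReal.rpow_ne_top_of_nonneg (by norm_num) hA))

end WeightedExtension

end HigherOrderWave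

namespace HigherOrderWave

/-! ### The vertex `E` in the critical dimension. -/

section Endpoint

variable {n : ℕ}

/-- In the critical dimension the sine propagator maps `L¹` to weak `L²`. -/
theorem EllipticPositive.exists_weakLpNorm_sinePart_le {P : MvPolynomial (Fin n) ℝ}
    (hP : EllipticPositive P n) : ∃ C : ℝ, 0 < C ∧ ∀ t : ℝ, t ≠ 0 →
      ∀ u : Lp ℂ 1 (volume : Measure (EuclideanSpace ℝ (Fin n))),
        ∃ v : EuclideanSpace ℝ (Fin n) → ℂ, IsGivenBy (sinePart P t (Lp.toTemperedDistribution u)) v ∧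
          weakLpNorm v 2 ≤ ENNReal.ofReal (C * ‖u‖) := by
  obtain ⟨C, hC, h⟩ := hP.exists_setLIntegral_le
  refine ⟨C, hC, fun t ht u => ?_⟩
  obtain ⟨v, hv, hgiven, hbound⟩ := exists_fourierMultiplier_weak (hP.hasTemperateGrowth_sineSymbol t)
    hC.le (h t ht) u
  refine ⟨v, ⟨hv.aestronglyMeasurable, hgiven⟩, ?_⟩
  rw [weakLpNorm, if_neg ENNReal.ofNat_ne_top]
  refine iSup_le fun s => ?_
  simpa using mul_measure_rpow_le_of_setLIntegral_le hv.measurable hbound s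

end Endpoint

end HigherOrderWave

theorem theorem4 {n m : ℕ} (P : MvPolynomial (Fin n) ℝ)
    (hP : EllipticPositive P m) (hnm : m ≤ n)
    (p q : ℝ≥0∞) [Fact (1 ≤ p)] (hq : 1 ≤ q) (hq_top : q ≠ ⊤)
    (hpq : (recip p, recip q) ∈
      triangleAEF n m) :
    ∃ C : ℝ, 0 < C ∧
      ∀ t : ℝ, t ≠ 0 → ∀ u₁ : Lp ℂ p (volume : Measure (EuclideanSpace ℝ (Fin n))),
        ∃ v : EuclideanSpace ℝ (Fin n) → ℂ,
          IsGivenBy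
            (sinePart P t (Lp.toTemperedDistribution u₁)) v ∧
          (|t| ≤ 1 → targetNorm n m p q v ≤
            ENNReal.ofReal
              (C * |t| ^ ((n : ℝ) / ((m : ℝ) / 2) *
                (recip q - recip p) + 1) * ‖u₁‖)) ∧
          (1 ≤ |t| → targetNorm n m p q v ≤
            ENNReal.ofReal (C * ‖u₁‖)) := by
  have hn : 0 < n := by have := hP.two_le_dim; omega
  have hn' : (0 : ℝ) < n := by exact_mod_cast hn
  have hp1 : 1 ≤ p := Fact.out
  have h := triangleAEF_subset hn hpq
  obtain ⟨hp, hq', hpq'⟩ := h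
  simp only at hp hq' hpq'
  have hq0 : 0 < q := zero_lt_one.trans_le hq
  have hp2 : p ≤ 2 := by
    have hpt : p ≠ ⊤ := by rintro rfl; norm_num [recip] at hp
    have h1 : 1 ≤ p.toReal := by simpa using ENNReal.toReal_mono hpt hp1
    rw [recip_eq, div_le_div_iff₀ two_pos (by linarith)] at hp
    rw [← ENNReal.toReal_le_toReal hpt ENNReal.ofNat_ne_top]
    simpa using hp
  have hq2 : 2 ≤ q := by
    have h1 : 0 < q.toReal := ENNReal.toReal_pos hq0.ne' hq_top
    rw [recip_eq, div_le_div_iff₀ h1 two_pos] at hq'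
    rw [← ENNReal.toReal_le_toReal ENNReal.ofNat_ne_top hq_top]
    simpa using hq'
  -- For `p = 1` the inequalities of the triangle leave only `m = n`, `q = 2`. That point lies on
  -- `EF`, so the target is weak `L²`, and the exponent of `|t|` is zero, so one bound serves all
  -- times.
  rcases hp1.eq_or_lt with rfl | hp1
  · have hr1 : recip 1 = 1 := by simp [recip]
    have hnm' : (m : ℝ) ≤ n := by exact_mod_cast hnm
    rw [hr1] at hpq'
    have h1 : (1 : ℝ) / 2 ≤ m / (2 * n) := by linarith
    rw [div_le_div_iff₀ two_pos (by positivity)] at h1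
    obtain rfl : m = n := le_antisymm hnm (by exact_mod_cast (by linarith : (n : ℝ) ≤ m))
    have h2 : (m : ℝ) / (2 * m) = 1 / 2 := by field_simp
    have hrq : recip q = 1 / 2 := by rw [h2] at hpq'; linarith
    have hq_eq : q = 2 := by
      rw [recip_eq] at hrq
      have h3 : q.toReal = 2 := by
        rw [← one_div_one_div q.toReal, hrq]; norm_num
      rw [← ENNReal.ofReal_toReal hq_top, h3]; simp
    obtain ⟨C, hC, h⟩ := hP.exists_weakLpNorm_sinePart_le
    refine ⟨C, hC, fun t ht u => ?_⟩
    obtain ⟨v, hv, hb⟩ := h t ht u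
    have hexp : (m : ℝ) / ((m : ℝ) / 2) * (recip q - recip 1) + 1 = 0 := by
      rw [hrq, hr1]; field_simp; norm_num
    have htarget : targetNorm m m 1 q v = weakLpNorm v 2 := by
      rw [targetNorm, if_pos (by rw [hrq, hr1, h2]; norm_num), hq_eq]
    refine ⟨v, hv, ?_, ?_⟩
    · rw [hexp, Real.rpow_zero, mul_one, htarget]
      exact fun _ => hb
    · rw [htarget]
      exact fun _ => hb
  -- For `p > 1` the strong bound holds up to and including `EF`, where only the weak one is
  -- claimed.
  · obtain ⟨C, hC, h⟩ := hP.exists_eLpNorm_sinePart_le hp1 hp2 hq2 hq_top hpq'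
    refine ⟨C, hC, fun t _ u => ?_⟩
    obtain ⟨v, hv, hb, hb'⟩ := h t u
    have hle := targetNorm_le_eLpNorm (n := n) (m := m) (p := p) hq0.ne' hq_top hv.1
    exact ⟨v, hv, fun _ => hle.trans hb, fun _ => hle.trans hb'⟩
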